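/- Fix $\tau,\iota\in(0,1)$ and $\kappa>0$. Write $\psi_w(u)=w-I(u\le 0)$ and $\rho_w(u)=u\{w-I(u\le 0)\}$. For every sample size $n$ let $(Y_i,\mathbf X_i,\mathbf W_i)$, $i=1,\dots,n$, be i.i.d. copies of $(Y,\mathbf X,\mathbf W)\in\mathbb R\times\mathbb R^{p_n}\times\mathbb R^{r_n}$, whose law may depend on $n$. For $1\le j\le p_n$ let $\mathcal S_j\subset\{1,\dots,p_n\}\setminus\{j\}$ be a given set (which may depend on $n$), let $\mathbf Z_j=(\mathbf W^T,\mathbf X_{\mathcal S_j}^T)^T$ be the conditioning vector of $X_j$, with sample values $\mathbf Z_{ij}$, and put $q_n=\max_{j}(r_n+|\mathcal S_j|)$, which may diverge. Let $$\alpha_j^0=\arg\min_{\alpha}\mathrm E\{\rho_\tau(Y-\mathbf Z_j^T\alpha)\},\qquad \theta_j^0=\arg\min_{\theta}\mathrm E\{\rho_\iota(X_j-\mathbf Z_j^T\theta)\}$$ (if $Y$ or $X_j$ is not integrable, the values of the criterion are compared through the expectation of their difference), and let $\hat\alpha_j$, $\hat\theta_j$ be (any measurable) minimizers of $n^{-1}\sum_i\rho_\tau(Y_i-\mathbf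 Z_{ij}^T\alpha)$ and $n^{-1}\sum_i\rho_\iota(X_{ij}-\mathbf Z_{ij}^T\theta)$. Put $$u_j=\left|\frac{\mathrm E\{\psi_\tau(Y-\mathbf Z_j^T\alpha_j^0)\psi_\iota(X_j-\mathbf Z_j^T\theta_j^0)\}}{\sqrt{\tau(1-\tau)\iota(1-\iota)}}\right|,\qquad \hat u_j=\left|\frac{n^{-1}\sum_{i=1}^n\psi_\tau(Y_i-\mathbf Z_{ij}^T\hat\alpha_j)\psi_\iota(X_{ij}-\mathbf Z_{ij}^T\hat\theta_j)}{\sqrt{\tau(1-\tau)\iota(1-\iota)}}\right|,$$ let $\mathcal M^*=\{j:u_j>0\}$ be the true active set, $s_n=|\mathcal M^*|$, and for a threshold $v_n$ let $\widehat{\mathcal M}=\{j:\hat u_j\ge v_n\}$. Assume, with constants that depend neither on $n$ nor on $j$: (D1) there are $L,\delta,b>0$ such that for all $n$ and $j$ the conditional density $f_{Y|\mathbf Z_j=\mathbf z}(y)$ exists and, for almost every $\mathbf z$, on $|y-\mathbf z^T\alpha_j^0|\le\delta$ it is $L$-Lipschitz in $y$ and at least $b$; likewise the conditional density $f_{X_j|\mathbf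 Z_j=\mathbf z}(x)$ exists and, for almost every $\mathbf z$, on $|x-\mathbf z^T\theta_j^0|\le\delta$ it is $L$-Lipschitz in $x$ and at least $b$. (D2) (i) there are finite constants $m_1,m_2,m_3$ such that, almost surely, every coordinate of $\mathbf Z_j$ is at most $m_1$ in absolute value, $|\mathbf Z_j^T\alpha_j^0|\le m_2$ and $|\mathbf Z_j^T\theta_j^0|\le m_3$; (ii) there are $0<c_{\min},c_{\max}<\infty$ such that all eigenvalues of $\mathrm E(\mathbf Z_j\mathbf Z_j^T)$ lie in $[c_{\min},c_{\max}]$. Then: (i) For every $C>0$ there is a constant $c=c(C)>0$ such that, for all sufficiently large $n$, $$P\Big(\max_{1\le j\le p_n}|\hat u_j-u_j|\ge C n^{-\kappa}\Big)\le 12\,p_n\exp(-c\,q_n^{-1}n^{1-2\kappa}).$$ (ii) If in addition (D3) holds, that is, for some $C_0>0$, $u_j\ge C_0n^{-\kappa}$ for all $n$ and all $j\in\mathcal M^*$, and if $v_n=C_2n^{-\kappa}$ with $C_2\le C_0/2$, then, with $c=c(C_0/2)$ the constant of (i) for $C=C_0/2$, for all sufficiently large $n$, $$P\big(\mathcal M^*\subset\widehat{\mathcal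 M}\big)\ge 1-12\,s_n\exp(-c\,q_n^{-1}n^{1-2\kappa}).$$ -/

import Mathlib

open MeasureTheory ProbabilityTheory Filter Set

noncomputable section

namespace CPC

/-- One observation `(Y, X, W)`: a response, `p` covariates and `r` external variables. -/
abbrev Obs (p r : ℕ) : Type := ℝ × (Fin p → ℝ) × (Fin r → ℝ)

/-- The response of an observation. -/
def resp {p r : ℕ} (d : Obs p r) : ℝ := d.1

/-- The `j`-th covariate of an observation. -/
def covar {p r : ℕ} (j : Fin p) (d : Obs p r) : ℝ := d.2.1 j

/-- Coordinates of the conditioning vector built from `W` and from the covariates in `S`. -/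
abbrev ZIdx {p : ℕ} (r : ℕ) (S : Finset (Fin p)) : Type := Fin r ⊕ {k : Fin p // k ∈ S}

/-- The conditioning vector `Z = (W, X_S)`. -/
def condVec {p r : ℕ} (S : Finset (Fin p)) (d : Obs p r) : ZIdx r S → ℝ :=
  Sum.elim (fun k => d.2.2 k) (fun k => d.2.1 k.1)

/-- `q = max_j (r + |S_j|)`, the largest dimension of the conditioning vectors. -/
def condDim {p : ℕ} (r : ℕ) (S : Fin p → Finset (Fin p)) : ℕ :=
  Finset.univ.sup (fun j => r + (S j).card)

/-- `ψ_w(u) = w - I(u ≤ 0)`. -/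
def psi (w u : ℝ) : ℝ := w - (if u ≤ 0 then 1 else 0)

/-- The check loss `ρ_w(u) = u (w - I(u ≤ 0))`. -/
def checkLoss (w u : ℝ) : ℝ := u * (w - (if u ≤ 0 then 1 else 0))

/-- `a` minimizes `b ↦ E ρ_w(U - Zᵀ b)`. The comparison of two values is written as the
expectation of the difference, which is at most `|Zᵀ (b - a)|` in absolute value: for integrable
`U` this is the minimization of `E ρ_w(U - Zᵀ b)` itself, and it remains meaningful when `U` has
no first moment. -/
def IsPopQuantileCoef {E K : Type*} [MeasurableSpace E] [Fintype K] (μ : Measure E) (w : ℝ)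
    (U : E → ℝ) (Z : E → K → ℝ) (a : K → ℝ) : Prop :=
  ∀ b : K → ℝ, 0 ≤ ∫ d, (checkLoss w (U d - Z d ⬝ᵥ b) - checkLoss w (U d - Z d ⬝ᵥ a)) ∂μ

/-- `a` minimizes `b ↦ n⁻¹ ∑ᵢ ρ_w(Uᵢ - Zᵢᵀ b)` over the sample `x`. -/
def IsSampleQuantileCoef {E K : Type*} [Fintype K] {n : ℕ} (w : ℝ)
    (U : E → ℝ) (Z : E → K → ℝ) (x : Fin n → E) (a : K → ℝ) : Prop :=
  ∀ b : K → ℝ, (n : ℝ)⁻¹ * ∑ i, checkLoss w (U (x i) - Z (x i) ⬝ᵥ a) ≤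
    (n : ℝ)⁻¹ * ∑ i, checkLoss w (U (x i) - Z (x i) ⬝ᵥ b)

/-- The copula-based partial correlation of `Y` and `X` given `Z` at the levels `(τ, ι)`, where
`a` and `t` are the population quantile regression coefficients of `Y` and `X` on `Z`. -/
def cpc {E K : Type*} [MeasurableSpace E] [Fintype K] (μ : Measure E) (τ ι : ℝ)
    (Y X : E → ℝ) (Z : E → K → ℝ) (a t : K → ℝ) : ℝ :=
  (∫ d, psi τ (Y d - Z d ⬝ᵥ a) * psi ι (X d - Z d ⬝ᵥ t) ∂μ) /
    Real.sqrt (τ * (1 - τ) * (ι * (1 - ι)))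

/-- The sample copula-based partial correlation, where `a` and `t` are the sample quantile
regression coefficients. -/
def cpcHat {E K : Type*} [Fintype K] {n : ℕ} (τ ι : ℝ)
    (Y X : E → ℝ) (Z : E → K → ℝ) (x : Fin n → E) (a t : K → ℝ) : ℝ :=
  ((n : ℝ)⁻¹ * ∑ i, psi τ (Y (x i) - Z (x i) ⬝ᵥ a) * psi ι (X (x i) - Z (x i) ⬝ᵥ t)) /
    Real.sqrt (τ * (1 - τ) * (ι * (1 - ι)))

/-- `f` is a conditional density of `U` given `Z`: the joint law of `(Z, U)` is
`f(z, u) P_Z(dz) du`. -/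
def IsCondDensity {E K : Type*} [MeasurableSpace E] (μ : Measure E)
    (U : E → ℝ) (Z : E → K → ℝ) (f : (K → ℝ) → ℝ → ℝ) : Prop :=
  Measurable (Function.uncurry f) ∧ (∀ z u, 0 ≤ f z u) ∧
    μ.map (fun d => (Z d, U d)) =
      ((μ.map Z).prod volume).withDensity (fun v => ENNReal.ofReal (f v.1 v.2))

/-- `U` has a conditional density given `Z` which, for (almost) every value `z` of `Z`, is
`L`-Lipschitz and at least `b` on the neighbourhood of radius `δ` of `zᵀ a`. -/
def HasRegularCondDensity {E K : Type*} [MeasurableSpace E] [Fintype K] (μ : Measure E)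
    (U : E → ℝ) (Z : E → K → ℝ) (a : K → ℝ) (L δ b : ℝ) : Prop :=
  ∃ f : (K → ℝ) → ℝ → ℝ, IsCondDensity μ U Z f ∧
    ∀ᵐ z ∂(μ.map Z),
      (∀ u ∈ Icc (z ⬝ᵥ a - δ) (z ⬝ᵥ a + δ), ∀ v ∈ Icc (z ⬝ᵥ a - δ) (z ⬝ᵥ a + δ),
        |f z u - f z v| ≤ L * |u - v|) ∧
      ∀ u ∈ Icc (z ⬝ᵥ a - δ) (z ⬝ᵥ a + δ), b ≤ f z u

/-- The second moment matrix `E(Z Zᵀ)`. -/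
def secondMoment {E K : Type*} [MeasurableSpace E] (μ : Measure E) (Z : E → K → ℝ) :
    Matrix K K ℝ :=
  Matrix.of fun k l => ∫ d, Z d k * Z d l ∂μ

/-- Condition (D1), with constants that do not depend on `n` and `j`. -/
def CondD1 (p r : ℕ → ℕ) (S : ∀ n, Fin (p n) → Finset (Fin (p n)))
    (μ : ∀ n, Measure (Obs (p n) (r n)))
    (α₀ θ₀ : ∀ n (j : Fin (p n)), ZIdx (r n) (S n j) → ℝ) : Prop :=
  ∃ L δ b : ℝ, 0 < L ∧ 0 < δ ∧ 0 < b ∧ ∀ n (j : Fin (p n)),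
    HasRegularCondDensity (μ n) resp (condVec (S n j)) (α₀ n j) L δ b ∧
    HasRegularCondDensity (μ n) (covar j) (condVec (S n j)) (θ₀ n j) L δ b

/-- Condition (D2), with constants that do not depend on `n` and `j`. -/
def CondD2 (p r : ℕ → ℕ) (S : ∀ n, Fin (p n) → Finset (Fin (p n)))
    (μ : ∀ n, Measure (Obs (p n) (r n)))
    (α₀ θ₀ : ∀ n (j : Fin (p n)), ZIdx (r n) (S n j) → ℝ) : Prop :=
  (∃ m₁ m₂ m₃ : ℝ, ∀ n (j : Fin (p n)), ∀ᵐ d ∂(μ n),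
    (∀ k, |condVec (S n j) d k| ≤ m₁) ∧
    |condVec (S n j) d ⬝ᵥ α₀ n j| ≤ m₂ ∧ |condVec (S n j) d ⬝ᵥ θ₀ n j| ≤ m₃) ∧
  (∃ cmin cmax : ℝ, 0 < cmin ∧ 0 < cmax ∧ ∀ n (j : Fin (p n)) (ev : ℝ),
    Module.End.HasEigenvalue (Matrix.toLin' (secondMoment (μ n) (condVec (S n j)))) ev →
      cmin ≤ ev ∧ ev ≤ cmax)

/-- The utilities `u_j = |ϱ_{Y, X_j | Z_j}(τ, ι)|`. -/
def util {p r : ℕ} (S : Fin p → Finset (Fin p)) (μ : Measure (Obs p r)) (τ ι : ℝ)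
    (α₀ θ₀ : ∀ j : Fin p, ZIdx r (S j) → ℝ) (j : Fin p) : ℝ :=
  |cpc μ τ ι resp (covar j) (condVec (S j)) (α₀ j) (θ₀ j)|

/-- The empirical utilities `û_j` of the sample `x`, computed with the estimators `αh`, `θh`. -/
def utilHat {p r n : ℕ} (S : Fin p → Finset (Fin p)) (τ ι : ℝ)
    (αh θh : ∀ j : Fin p, (Fin n → Obs p r) → ZIdx r (S j) → ℝ)
    (x : Fin n → Obs p r) (j : Fin p) : ℝ :=
  |cpcHat τ ι resp (covar j) (condVec (S j)) x (αh j x) (θh j x)|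

/-- The true active set `{j : u_j > 0}`. -/
def activeSet {p : ℕ} (u : Fin p → ℝ) : Set (Fin p) := {j | 0 < u j}

/-- The selected set `{j : û_j ≥ v}`. -/
def selectedSet {p : ℕ} (uh : Fin p → ℝ) (v : ℝ) : Set (Fin p) := {j | v ≤ uh j}

end CPC

end

/-! The function `psi` only sees the sign of a residual. Replacing population coefficients by sample
ones therefore changes a product of two `psi` values only for observations whose residual is crossed
by the change of a linear predictor. If the proportion of crossings is of order `s = k n ^ (-κ)` for
both regressions, the remaining error is that of a mean of bounded i.i.d. variables, which
Hoeffding's inequality controls (`real_psi_mean_deviation_le`).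

Crossings are controlled in `real_crossing_gt_le`. The lower bound on the conditional density gives
the excess population risk at `a + t` a curvature `b / 4 * E huber δ (Zᵀ t)`. A uniform bound for
the empirical process penalized by a multiple of `E huber` then shows `E huber δ (Zᵀ t) ≤ s ^ 2` for
the estimation error `t`. A second use of that bound, for a Lipschitz majorant of the crossing
indicator, turns this into few crossings.

The core is `real_penalizedDeviation_le`, an exponential bound with no growth condition on `q`.
Symmetrization and contraction reduce the process to `2 v ⬝ᵥ t - β E huber (Zᵀ t)`, with `v` a
Rademacher mean of the `Z`. Writing `v ⬝ᵥ t = E (Zᵀ w)(Zᵀ t)` with `w = Σ⁻¹ v`, where `Σ = E Z Zᵀ`,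
and applying Young's inequality pointwise bounds this by `|v|² / (β c)` plus a term living where
`|Zᵀ w|` is large. Both have dimension-free exponential tails, obtained from moments of `cosh`. The
level `x` is itself a member of the supremum, so the expected excess over `x` is exponentially small
and Markov's inequality suffices.

Finally, if `q⁻¹ n ^ (1 - 2κ) ≤ 1` the claimed bound exceeds one; otherwise `q ≤ n`, and polynomial
factors are absorbed into the exponential. Events quantify over all minimizers and are measured by
outer measure, so their measurability plays no role. -/

namespace CPC

/-! ### Symmetrization and contraction for finite suprema, one observation. -/

section FiniteSup

variable {T : Type*} [Finite T]

theorem le_ciSup_finite (f : T → ℝ) (t : T) : f t ≤ ⨆ t, f t :=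
  le_ciSup (Set.finite_range f).bddAbove t

theorem integrable_ciSup_finite [Nonempty T] {E : Type*} [MeasurableSpace E] {μ : Measure E}
    {f : T → E → ℝ} (hf : ∀ t, Integrable (f t) μ) : Integrable (fun x => ⨆ t, f t x) μ := by
  have := Fintype.ofFinite T
  refine (integrable_finsetSum Finset.univ fun t _ => (hf t).abs).mono'
    (AEMeasurable.iSup fun t => (hf t).aemeasurable).aestronglyMeasurable
    (ae_of_all _ fun x => ?_)
  obtain ⟨t, ht⟩ := exists_eq_ciSup_of_finite (f := fun t => f t x)
  simp only [← ht, Real.norm_eq_abs]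
  exact Finset.single_le_sum (f := fun t => |f t x|) (fun _ _ => abs_nonneg _)
    (Finset.mem_univ t)

/-- The one-coordinate contraction principle for Rademacher averages. -/
theorem ciSup_add_ciSup_sub_le [Nonempty T] (b u y : T → ℝ)
    (h : ∀ s t, |u s - u t| ≤ |y s - y t|) :
    (⨆ t, (b t + u t)) + (⨆ t, (b t - u t)) ≤ (⨆ t, (b t + y t)) + ⨆ t, (b t - y t) := by
  obtain ⟨s, hs⟩ := exists_eq_ciSup_of_finite (f := fun t => b t + u t)
  obtain ⟨t, ht⟩ := exists_eq_ciSup_of_finite (f := fun t => b t - u t)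
  rw [← hs, ← ht]
  have h1 := le_ciSup_finite (fun t => b t + y t) s
  have h2 := le_ciSup_finite (fun t => b t - y t) t
  have h3 := le_ciSup_finite (fun t => b t + y t) t
  -- With `s` and `t` the two maximizers, the left side is at most `b s + b t + |y s - y t|`; the
  -- sign of `y s - y t` decides which of them is used in which supremum on the right.
  have h4 := le_ciSup_finite (fun t => b t - y t) s
  have h5 := (le_abs_self _).trans (h s t)
  rcases abs_cases (y s - y t) with ⟨h6, _⟩ | ⟨h6, _⟩ <;> linarith

/-- Symmetrization and contraction for one observation. -/
theorem integral_ciSup_centered_le [Nonempty T] {E : Type*} [MeasurableSpace E] {μ : Measure E}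
    [IsProbabilityMeasure μ] {F Y : T → E → ℝ} (hF : ∀ t, Integrable (F t) μ)
    (hY : ∀ t, Integrable (Y t) μ) (hFY : ∀ x s t, |F s x - F t x| ≤ |Y s x - Y t x|)
    (b : T → ℝ) :
    ∫ x, ⨆ t, (b t + (F t x - ∫ x', F t x' ∂μ)) ∂μ ≤
      ∫ x, ((⨆ t, (b t + 2 * Y t x)) + ⨆ t, (b t - 2 * Y t x)) / 2 ∂μ := by
  have hp : Integrable (fun x => ⨆ t, (b t + 2 * F t x)) μ :=
    integrable_ciSup_finite fun t => (integrable_const _).add ((hF t).const_mul 2)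
  have hm : Integrable (fun x => ⨆ t, (b t - 2 * F t x)) μ :=
    integrable_ciSup_finite fun t => (integrable_const _).sub ((hF t).const_mul 2)
  have hp' : Integrable (fun x => ⨆ t, (b t + 2 * Y t x)) μ :=
    integrable_ciSup_finite fun t => (integrable_const _).add ((hY t).const_mul 2)
  have hm' : Integrable (fun x => ⨆ t, (b t - 2 * Y t x)) μ :=
    integrable_ciSup_finite fun t => (integrable_const _).sub ((hY t).const_mul 2)
  have hl : Integrable (fun x => ⨆ t, (b t + (F t x - ∫ x', F t x' ∂μ))) μ :=
    integrable_ciSup_finite fun t =>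
      (integrable_const _).add ((hF t).sub (integrable_const _))
  -- The centered term is half of `b t + 2 F t x` plus half of the mean of `b t - 2 F t` over a
  -- ghost copy. After integration the two one-sided suprema are the two values of a Rademacher
  -- sign.
  have key : ∀ x, ⨆ t, (b t + (F t x - ∫ x', F t x' ∂μ)) ≤
      (⨆ t, (b t + 2 * F t x)) / 2 + (∫ x', ⨆ t, (b t - 2 * F t x') ∂μ) / 2 := by
    intro x
    refine ciSup_le fun t => ?_
    have h1 := le_ciSup_finite (fun t => b t + 2 * F t x) t
    have h2 : ∫ x', (b t - 2 * F t x') ∂μ ≤ ∫ x', ⨆ t, (b t - 2 * F t x') ∂μ :=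
      integral_mono ((integrable_const _).sub ((hF t).const_mul 2)) hm
        fun x' => le_ciSup_finite (fun t => b t - 2 * F t x') t
    rw [integral_sub (integrable_const _) ((hF t).const_mul 2), integral_const_mul] at h2
    simp only [integral_const, probReal_univ, smul_eq_mul, one_mul] at h1 h2
    linarith
  calc ∫ x, ⨆ t, (b t + (F t x - ∫ x', F t x' ∂μ)) ∂μ
      ≤ ∫ x, ((⨆ t, (b t + 2 * F t x)) / 2 + (∫ x', ⨆ t, (b t - 2 * F t x') ∂μ) / 2) ∂μ :=
        integral_mono hl ((hp.div_const 2).add (integrable_const _)) key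
    _ = ∫ x, ((⨆ t, (b t + 2 * F t x)) + ⨆ t, (b t - 2 * F t x)) / 2 ∂μ := by
        have e : ∫ x, ((⨆ t, (b t + 2 * F t x)) + ⨆ t, (b t - 2 * F t x)) / 2 ∂μ =
            ((∫ x, ⨆ t, (b t + 2 * F t x) ∂μ) + ∫ x, ⨆ t, (b t - 2 * F t x) ∂μ) / 2 := by
          rw [integral_div, integral_add hp hm]
        rw [e, integral_add (hp.div_const 2) (integrable_const _), integral_div]
        simp only [integral_const, probReal_univ, smul_eq_mul, one_mul]
        ring
    _ ≤ _ := by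
        refine integral_mono ((hp.add hm).div_const 2) ((hp'.add hm').div_const 2) fun x => ?_
        have := ciSup_add_ciSup_sub_le b (fun t => 2 * F t x) (fun t => 2 * Y t x) (by
          intro s t
          have := hFY x s t
          rw [← mul_sub, ← mul_sub, abs_mul, abs_mul]
          gcongr)
        simp only
        linarith

end FiniteSup

/-! ### From one observation to independent sums. -/

section Tensor

variable {E : Type*} [MeasurableSpace E]

/-- The product of `n + 1` copies of a law, split at the first coordinate. -/
theorem measurePreserving_cons (μ : Measure E) [SigmaFinite μ] (n : ℕ) :
    MeasurePreserving (fun y : E × (Fin n → E) => (Fin.cons y.1 y.2 : Fin (n + 1) → E))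
      (μ.prod (Measure.pi fun _ : Fin n => μ)) (Measure.pi fun _ : Fin (n + 1) => μ) := by
  have h := (measurePreserving_piFinSuccAbove (fun _ : Fin (n + 1) => μ) 0).symm
  convert h using 1
  ext y i
  simp [MeasurableEquiv.piFinSuccAbove]

theorem measurableEmbedding_cons (n : ℕ) :
    MeasurableEmbedding (fun y : E × (Fin n → E) => (Fin.cons y.1 y.2 : Fin (n + 1) → E)) := by
  have h := (MeasurableEquiv.piFinSuccAbove (fun _ : Fin (n + 1) => E) 0).symm.measurableEmbedding
  convert h using 1
  ext y i
  simp [MeasurableEquiv.piFinSuccAbove]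

theorem integrable_sum_pi {μ : Measure E} [IsProbabilityMeasure μ] {f : E → ℝ}
    (hf : Integrable f μ) (n : ℕ) :
    Integrable (fun x : Fin n → E => ∑ i, f (x i)) (Measure.pi fun _ => μ) :=
  integrable_finsetSum _ fun i _ =>
    (measurePreserving_eval (fun _ : Fin n => μ) i).integrable_comp_of_integrable hf

/-- Coordinatewise comparison of the expected suprema of two sums of independent terms. -/
theorem integral_ciSup_sum_le {T : Type*} [Finite T] [Nonempty T]
    {E' : Type*} [MeasurableSpace E'] {μ : Measure E} [IsProbabilityMeasure μ]
    {μ' : Measure E'} [IsProbabilityMeasure μ'] {F : T → E → ℝ} {G : T → E' → ℝ}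
    (hF : ∀ t, Integrable (F t) μ) (hG : ∀ t, Integrable (G t) μ')
    (h : ∀ b : T → ℝ, ∫ x, ⨆ t, (b t + F t x) ∂μ ≤ ∫ x, ⨆ t, (b t + G t x) ∂μ')
    (n : ℕ) (b : T → ℝ) :
    ∫ x, ⨆ t, (b t + ∑ i, F t (x i)) ∂(Measure.pi fun _ : Fin n => μ) ≤
      ∫ x, ⨆ t, (b t + ∑ i, G t (x i)) ∂(Measure.pi fun _ : Fin n => μ') := by
  induction n generalizing b with
  | zero => simp
  | succ n ih =>
    have hFn := fun t => integrable_sum_pi (hF t) n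
    have hGn := fun t => integrable_sum_pi (hG t) n
    rw [← (measurePreserving_cons μ n).integral_comp (measurableEmbedding_cons n),
      ← (measurePreserving_cons μ' n).integral_comp (measurableEmbedding_cons n)]
    simp only [Fin.sum_univ_succ, Fin.cons_zero, Fin.cons_succ]
    -- The three integrands replace `F` by `G` in stages: nowhere, in the last `n` coordinates,
    -- everywhere. At each stage the frozen coordinates are absorbed into the offset `b`, which is
    -- why the hypothesis and the induction are stated for every offset.
    have i1 : Integrable (fun y : E × (Fin n → E) =>
        ⨆ t, (b t + (F t y.1 + ∑ i, F t (y.2 i)))) (μ.prod (Measure.pi fun _ => μ)) :=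
      integrable_ciSup_finite fun t =>
        (integrable_const _).add (((hF t).comp_fst _).add ((hFn t).comp_snd _))
    have i2 : Integrable (fun y : E × (Fin n → E') =>
        ⨆ t, (b t + F t y.1 + ∑ i, G t (y.2 i))) (μ.prod (Measure.pi fun _ => μ')) :=
      integrable_ciSup_finite fun t =>
        ((integrable_const _).add ((hF t).comp_fst _)).add ((hGn t).comp_snd _)
    have i3 : Integrable (fun y : E' × (Fin n → E') =>
        ⨆ t, (b t + (G t y.1 + ∑ i, G t (y.2 i)))) (μ'.prod (Measure.pi fun _ => μ')) :=
      integrable_ciSup_finite fun t =>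
        (integrable_const _).add (((hG t).comp_fst _).add ((hGn t).comp_snd _))
    rw [integral_prod _ i1, integral_prod_symm _ i3]
    calc _ ≤ ∫ x, ∫ y, ⨆ t, (b t + F t x + ∑ i, G t (y i))
            ∂(Measure.pi fun _ : Fin n => μ') ∂μ := by
          refine integral_mono i1.integral_prod_left i2.integral_prod_left fun x => ?_
          simpa only [add_assoc] using ih (fun t => b t + F t x)
      _ = ∫ y, ∫ x, ⨆ t, (b t + F t x + ∑ i, G t (y i)) ∂μ
            ∂(Measure.pi fun _ : Fin n => μ') := integral_integral_swap i2
      _ ≤ _ := by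
          refine integral_mono i2.integral_prod_right i3.integral_prod_right fun y => ?_
          have e1 : ∀ x t, b t + F t x + ∑ i, G t (y i) = b t + ∑ i, G t (y i) + F t x :=
            fun _ _ => by ring
          have e2 : ∀ x t, b t + (G t x + ∑ i, G t (y i)) = b t + ∑ i, G t (y i) + G t x :=
            fun _ _ => by ring
          simp only [e1, e2]
          exact h (fun t => b t + ∑ i, G t (y i))

end Tensor

end CPC

namespace CPC

/-! ### A dimension-free inequality for `cosh` of a norm. -/

section Cosh

/-- `A + B` and `A - B` are convex combinations of `A + C` and `A - C` with exchanged weights, all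
in the half-line where the power is convex. -/
theorem pow_add_pow_le_of_abs_le {A B C : ℝ} (hB : |B| ≤ C) (hC : C ≤ A) (k : ℕ) :
    (A + B) ^ k + (A - B) ^ k ≤ (A + C) ^ k + (A - C) ^ k := by
  have hC0 : 0 ≤ C := (abs_nonneg B).trans hB
  rcases hC0.eq_or_lt with rfl | hC0
  · have : B = 0 := abs_nonpos_iff.mp hB
    simp [this]
  obtain ⟨h1, h2⟩ := abs_le.mp hB
  have hcv := convexOn_pow (𝕜 := ℝ) k
  have hp : A + C ∈ Ici (0 : ℝ) := by simp only [mem_Ici]; linarith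
  have hm : A - C ∈ Ici (0 : ℝ) := by simp only [mem_Ici]; linarith
  have hl : 0 ≤ (C + B) / (2 * C) := div_nonneg (by linarith) (by linarith)
  have hr : 0 ≤ (C - B) / (2 * C) := div_nonneg (by linarith) (by linarith)
  have hs : (C + B) / (2 * C) + (C - B) / (2 * C) = 1 := by field_simp; ring
  have e1 := hcv.2 hp hm hl hr hs
  have e2 := hcv.2 hp hm hr hl (by rw [add_comm]; exact hs)
  simp only [smul_eq_mul] at e1 e2
  have f1 : (C + B) / (2 * C) * (A + C) + (C - B) / (2 * C) * (A - C) = A + B := by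
    field_simp; ring
  have f2 : (C - B) / (2 * C) * (A + C) + (C + B) / (2 * C) * (A - C) = A - B := by
    field_simp; ring
  rw [f1] at e1
  rw [f2] at e2
  have : (A + B) ^ k + (A - B) ^ k ≤
      ((C + B) / (2 * C) + (C - B) / (2 * C)) * ((A + C) ^ k + (A - C) ^ k) := by linarith
  rwa [hs, one_mul] at this

/-- The power series of `cosh` involves only squared norms. These are `‖x‖² + ‖z‖² ± 2⟨x, z⟩` on the
left and the same with `‖x‖ ‖z‖` for the inner product on the right, so Cauchy–Schwarz gives a
termwise comparison. It lets the exponential moment of a Rademacher sum in a Hilbert space factor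
over its terms. -/
theorem cosh_norm_add_add_cosh_norm_sub_le {H : Type*} [NormedAddCommGroup H]
    [InnerProductSpace ℝ H] (x z : H) :
    Real.cosh ‖x + z‖ + Real.cosh ‖x - z‖ ≤ 2 * (Real.cosh ‖x‖ * Real.cosh ‖z‖) := by
  have e : 2 * (Real.cosh ‖x‖ * Real.cosh ‖z‖) =
      Real.cosh (‖x‖ + ‖z‖) + Real.cosh (‖x‖ - ‖z‖) := by
    rw [Real.cosh_add, Real.cosh_sub]; ring
  rw [e]
  refine hasSum_le (fun k => ?_) ((Real.hasSum_cosh ‖x + z‖).add (Real.hasSum_cosh ‖x - z‖))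
    ((Real.hasSum_cosh (‖x‖ + ‖z‖)).add (Real.hasSum_cosh (‖x‖ - ‖z‖)))
  rw [← add_div, ← add_div]
  refine div_le_div_of_nonneg_right ?_ (Nat.cast_nonneg _)
  rw [pow_mul, pow_mul, pow_mul, pow_mul]
  have h1 : ‖x + z‖ ^ 2 = (‖x‖ ^ 2 + ‖z‖ ^ 2) + 2 * inner ℝ x z := by
    rw [norm_add_sq_real]; ring
  have h2 : ‖x - z‖ ^ 2 = (‖x‖ ^ 2 + ‖z‖ ^ 2) - 2 * inner ℝ x z := by
    rw [norm_sub_sq_real]; ring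
  have h3 : (‖x‖ + ‖z‖) ^ 2 = (‖x‖ ^ 2 + ‖z‖ ^ 2) + 2 * (‖x‖ * ‖z‖) := by ring
  have h4 : (‖x‖ - ‖z‖) ^ 2 = (‖x‖ ^ 2 + ‖z‖ ^ 2) - 2 * (‖x‖ * ‖z‖) := by ring
  rw [h1, h2, h3, h4]
  refine pow_add_pow_le_of_abs_le ?_ (by nlinarith [sq_nonneg (‖x‖ - ‖z‖)]) k
  rw [abs_mul, abs_two]
  gcongr
  exact abs_real_inner_le_norm x z

end Cosh

/-! ### Rademacher signs and exponential moments of signed sums. -/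

section Signs

/-- The law of a Rademacher sign, coded by `Bool`. -/
noncomputable def signLaw : Measure Bool := (PMF.uniformOfFintype Bool).toMeasure

/-- The sign coded by a Boolean. -/
noncomputable def sgn (b : Bool) : ℝ := if b then 1 else -1

instance : IsProbabilityMeasure signLaw := by unfold signLaw; infer_instance

theorem abs_sgn (b : Bool) : |sgn b| = 1 := by cases b <;> simp [sgn]

variable {E : Type*} [MeasurableSpace E]

theorem lintegral_signLaw (f : Bool → ENNReal) :
    ∫⁻ s, f s ∂signLaw = (f true + f false) / 2 := by
  have h : ∀ b : Bool, signLaw {b} = 2⁻¹ := by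
    intro b
    rw [signLaw, PMF.toMeasure_apply_singleton _ _ (measurableSet_singleton b)]
    simp
  rw [lintegral_fintype]
  simp [h, div_eq_mul_inv, add_mul]

theorem integral_signLaw (f : Bool → ℝ) :
    ∫ s, f s ∂signLaw = (f true + f false) / 2 := by
  rw [signLaw, PMF.integral_eq_sum]
  simp
  ring

theorem lintegral_prod_signLaw {μ : Measure E} [IsProbabilityMeasure μ]
    {f : E × Bool → ENNReal} (hf : Measurable f) :
    ∫⁻ y, f y ∂(μ.prod signLaw) = ∫⁻ x, (f (x, true) + f (x, false)) / 2 ∂μ := by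
  rw [lintegral_prod _ hf.aemeasurable]
  simp [lintegral_signLaw]

theorem integral_prod_signLaw {μ : Measure E} [IsProbabilityMeasure μ]
    {f : E × Bool → ℝ} (hf : Integrable f (μ.prod signLaw)) :
    ∫ y, f y ∂(μ.prod signLaw) = ∫ x, (f (x, true) + f (x, false)) / 2 ∂μ := by
  rw [integral_prod _ hf]
  simp [integral_signLaw]

theorem measurable_sgn : Measurable sgn := measurable_of_countable _

/-- Exponential moment of the norm of a Rademacher sum of independent vectors. -/
theorem lintegral_cosh_norm_sum_le {H : Type*} [NormedAddCommGroup H] [InnerProductSpace ℝ H]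
    [MeasurableSpace H] [BorelSpace H] [SecondCountableTopology H]
    {μ : Measure E} [IsProbabilityMeasure μ] {V : E → H} (hV : Measurable V)
    {M : ENNReal} (hM : ∫⁻ x, ENNReal.ofReal (Real.cosh ‖V x‖) ∂μ ≤ M) (n : ℕ) (w : H) :
    ∫⁻ x, ENNReal.ofReal (Real.cosh ‖w + ∑ i, sgn (x i).2 • V (x i).1‖)
        ∂(Measure.pi fun _ : Fin n => μ.prod signLaw) ≤
      ENNReal.ofReal (Real.cosh ‖w‖) * M ^ n := by
  have hc : Measurable fun h : H => ENNReal.ofReal (Real.cosh ‖h‖) :=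
    (Real.measurable_cosh.comp measurable_norm).ennreal_ofReal
  have hV' : Measurable fun y : E × Bool => sgn y.2 • V y.1 :=
    (measurable_sgn.comp measurable_snd).smul (hV.comp measurable_fst)
  have hsum : ∀ n : ℕ, Measurable fun x : Fin n → E × Bool => ∑ i, sgn (x i).2 • V (x i).1 :=
    fun n => Finset.measurable_sum _ fun i _ => hV'.comp (measurable_pi_apply i)
  induction n generalizing w with
  | zero => simp
  | succ n ih =>
    have hw : Measurable fun x : Fin (n + 1) → E × Bool =>
        ENNReal.ofReal (Real.cosh ‖w + ∑ i, sgn (x i).2 • V (x i).1‖) := by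
      exact hc.comp ((hsum (n + 1)).const_add w)
    rw [← (measurePreserving_cons (μ.prod signLaw) n).lintegral_comp hw]
    simp only [Fin.sum_univ_succ, Fin.cons_zero, Fin.cons_succ]
    have hm : Measurable fun y : (E × Bool) × (Fin n → E × Bool) =>
        ENNReal.ofReal (Real.cosh ‖w + sgn y.1.2 • V y.1.1 + ∑ i, sgn (y.2 i).2 • V (y.2 i).1‖) :=
      hc.comp (((hV'.comp measurable_fst).const_add w).add ((hsum n).comp measurable_snd))
    simp only [← add_assoc]
    rw [lintegral_prod _ hm.aemeasurable]
    calc _ ≤ ∫⁻ y, ENNReal.ofReal (Real.cosh ‖w + sgn y.2 • V y.1‖) * M ^ n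
            ∂(μ.prod signLaw) := lintegral_mono fun y => ih _
      _ = (∫⁻ y, ENNReal.ofReal (Real.cosh ‖w + sgn y.2 • V y.1‖) ∂(μ.prod signLaw)) * M ^ n :=
          lintegral_mul_const _ (hc.comp (hV'.const_add w))
      _ ≤ (ENNReal.ofReal (Real.cosh ‖w‖) * M) * M ^ n := by
          gcongr
          refine (lintegral_prod_signLaw (hc.comp (hV'.const_add w))).trans_le ?_
          calc _ ≤ ∫⁻ x, ENNReal.ofReal (Real.cosh ‖w‖) * ENNReal.ofReal (Real.cosh ‖V x‖) ∂μ := by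
                refine lintegral_mono fun x => ?_
                have := cosh_norm_add_add_cosh_norm_sub_le w (V x)
                simp only [Function.comp_apply, sgn, if_true, one_smul, Bool.false_eq_true, if_false, neg_smul,
                  ← sub_eq_add_neg]
                rw [← ENNReal.ofReal_add (Real.cosh_pos _).le (Real.cosh_pos _).le,
                  ← ENNReal.ofReal_mul (Real.cosh_pos _).le]
                refine ENNReal.div_le_of_le_mul ?_
                rw [← ENNReal.ofReal_ofNat 2,
                  ← ENNReal.ofReal_mul (mul_pos (Real.cosh_pos _) (Real.cosh_pos _)).le]
                exact ENNReal.ofReal_le_ofReal (by linarith)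
            _ = ENNReal.ofReal (Real.cosh ‖w‖) * ∫⁻ x, ENNReal.ofReal (Real.cosh ‖V x‖) ∂μ :=
                lintegral_const_mul _ (hc.comp hV)
            _ ≤ _ := by gcongr
      _ = _ := by rw [pow_succ]; ring

/-- Symmetrization and contraction for a sum of independent observations. -/
theorem integral_ciSup_sum_centered_le {T : Type*} [Finite T] [Nonempty T] {μ : Measure E}
    [IsProbabilityMeasure μ] {F Y : T → E → ℝ} (hF : ∀ t, Integrable (F t) μ)
    (hY : ∀ t, Integrable (Y t) μ) (hFY : ∀ x s t, |F s x - F t x| ≤ |Y s x - Y t x|)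
    (n : ℕ) (b : T → ℝ) :
    ∫ x, ⨆ t, (b t + ∑ i, (F t (x i) - ∫ x', F t x' ∂μ)) ∂(Measure.pi fun _ : Fin n => μ) ≤
      ∫ x, ⨆ t, (b t + ∑ i, 2 * (sgn (x i).2 * Y t (x i).1))
        ∂(Measure.pi fun _ : Fin n => μ.prod signLaw) := by
  have hG : ∀ t, Integrable (fun y : E × Bool => 2 * (sgn y.2 * Y t y.1)) (μ.prod signLaw) := by
    intro t
    refine Integrable.const_mul ?_ 2
    refine ((hY t).comp_fst signLaw).bdd_mul (c := 1)
      (measurable_sgn.comp measurable_snd).aestronglyMeasurable (ae_of_all _ fun y => ?_)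
    simp [abs_sgn]
  refine integral_ciSup_sum_le (F := fun t x => F t x - ∫ x', F t x' ∂μ)
    (G := fun t (y : E × Bool) => 2 * (sgn y.2 * Y t y.1))
    (fun t => (hF t).sub (integrable_const _)) hG (fun b => ?_) n b
  refine (integral_ciSup_centered_le hF hY hFY b).trans_eq ?_
  have hi : Integrable (fun y : E × Bool => ⨆ t, (b t + 2 * (sgn y.2 * Y t y.1)))
      (μ.prod signLaw) := integrable_ciSup_finite fun t => (integrable_const _).add (hG t)
  rw [integral_prod_signLaw hi]
  simp [sgn, sub_eq_add_neg]

end Signs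

end CPC

namespace CPC

/-! ### Linear algebra of bounded designs and their second moment matrix. -/

theorem sq_dotProduct_le {K : Type*} [Fintype K] (v w : K → ℝ) :
    (v ⬝ᵥ w) ^ 2 ≤ (v ⬝ᵥ v) * (w ⬝ᵥ w) := by
  simpa [dotProduct, sq] using Finset.sum_mul_sq_le_sq_mul_sq Finset.univ v w

theorem dotProduct_self_nonneg' {K : Type*} [Fintype K] (v : K → ℝ) : 0 ≤ v ⬝ᵥ v :=
  Finset.sum_nonneg fun _ _ => mul_self_nonneg _

theorem dotProduct_self_le {K : Type*} [Fintype K] {v : K → ℝ} {m q : ℝ}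
    (hv : ∀ k, |v k| ≤ m) (hq : (Fintype.card K : ℝ) ≤ q) : v ⬝ᵥ v ≤ m ^ 2 * q := by
  calc v ⬝ᵥ v ≤ ∑ _k : K, m ^ 2 := by
        refine Finset.sum_le_sum fun k _ => ?_
        rw [← sq, ← sq_abs]
        exact pow_le_pow_left₀ (abs_nonneg _) (hv k) 2
    _ = m ^ 2 * Fintype.card K := by simp [mul_comm]
    _ ≤ _ := by gcongr

theorem abs_dotProduct_le {K : Type*} [Fintype K] {v t : K → ℝ} {m q R : ℝ} (hm : 0 ≤ m)
    (hR : 0 ≤ R) (hv : ∀ k, |v k| ≤ m) (hq : (Fintype.card K : ℝ) ≤ q) (ht : t ⬝ᵥ t ≤ R ^ 2) :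
    |v ⬝ᵥ t| ≤ m * Real.sqrt q * R := by
  have hq0 : 0 ≤ q := (Nat.cast_nonneg _).trans hq
  refine abs_le_of_sq_le_sq ?_ (by positivity)
  calc (v ⬝ᵥ t) ^ 2 ≤ (v ⬝ᵥ v) * (t ⬝ᵥ t) := sq_dotProduct_le v t
    _ ≤ (m ^ 2 * q) * R ^ 2 :=
        mul_le_mul (dotProduct_self_le hv hq) ht (dotProduct_self_nonneg' t) (by positivity)
    _ = _ := by rw [mul_pow, mul_pow, Real.sq_sqrt hq0]

section SecondMoment

variable {E K : Type*} [MeasurableSpace E] [Fintype K] {μ : Measure E} [IsProbabilityMeasure μ]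
  {Z : E → K → ℝ} {m : ℝ}

theorem measurable_dotProduct_const (hZ : Measurable Z) (t : K → ℝ) :
    Measurable fun d => Z d ⬝ᵥ t :=
  Finset.measurable_sum _ fun k _ => ((measurable_pi_apply k).comp hZ).mul_const _

theorem ae_abs_dotProduct_le (hm : ∀ᵐ d ∂μ, ∀ k, |Z d k| ≤ m) (t : K → ℝ) :
    ∀ᵐ d ∂μ, |Z d ⬝ᵥ t| ≤ m * ∑ k, |t k| := by
  filter_upwards [hm] with d hd
  rw [Finset.mul_sum]
  refine (Finset.abs_sum_le_sum_abs _ _).trans (Finset.sum_le_sum fun k _ => ?_)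
  rw [abs_mul]
  exact mul_le_mul_of_nonneg_right (hd k) (abs_nonneg _)

theorem integrable_dotProduct (hZ : Measurable Z) (hm : ∀ᵐ d ∂μ, ∀ k, |Z d k| ≤ m) (t : K → ℝ) :
    Integrable (fun d => Z d ⬝ᵥ t) μ :=
  Integrable.of_bound (measurable_dotProduct_const hZ t).aestronglyMeasurable _
    (ae_abs_dotProduct_le hm t)

theorem integrable_dotProduct_mul (hZ : Measurable Z) (hm : ∀ᵐ d ∂μ, ∀ k, |Z d k| ≤ m)
    (t u : K → ℝ) : Integrable (fun d => (Z d ⬝ᵥ t) * (Z d ⬝ᵥ u)) μ :=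
  (integrable_dotProduct hZ hm u).bdd_mul
    (measurable_dotProduct_const hZ t).aestronglyMeasurable (ae_abs_dotProduct_le hm t)

theorem dotProduct_secondMoment_mulVec (hZ : Measurable Z)
    (hm : ∀ᵐ d ∂μ, ∀ k, |Z d k| ≤ m) (t u : K → ℝ) :
    t ⬝ᵥ (secondMoment μ Z).mulVec u = ∫ d, (Z d ⬝ᵥ t) * (Z d ⬝ᵥ u) ∂μ := by
  classical
  have hi : ∀ k l, Integrable (fun d => Z d k * Z d l) μ := by
    intro k l
    simpa using integrable_dotProduct_mul hZ hm (Pi.single k 1) (Pi.single l 1)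
  have e : ∀ d, (Z d ⬝ᵥ t) * (Z d ⬝ᵥ u) = ∑ k, ∑ l, t k * (Z d k * Z d l * u l) := by
    intro d
    simp only [dotProduct, Finset.sum_mul_sum]
    exact Finset.sum_congr rfl fun k _ => Finset.sum_congr rfl fun l _ => by ring
  simp only [e]
  rw [integral_finsetSum _ fun k _ => integrable_finsetSum _ fun l _ =>
    ((hi k l).mul_const _).const_mul _]
  simp only [dotProduct, Matrix.mulVec, secondMoment, Matrix.of_apply, Finset.mul_sum]
  refine Finset.sum_congr rfl fun k _ => ?_
  rw [integral_finsetSum _ fun l _ => ((hi k l).mul_const _).const_mul _]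
  refine Finset.sum_congr rfl fun l _ => ?_
  rw [integral_const_mul, integral_mul_const]

theorem secondMoment_isHermitian : (secondMoment μ Z).IsHermitian := by
  ext k l
  simp [secondMoment, mul_comm]

/-- The quadratic form of a symmetric matrix dominates its least eigenvalue. -/
theorem mul_dotProduct_self_le_of_eigenvalues [DecidableEq K] {A : Matrix K K ℝ}
    (hA : A.IsHermitian) {c : ℝ}
    (hc : ∀ ev : ℝ, Module.End.HasEigenvalue (Matrix.toLin' A) ev → c ≤ ev) (t : K → ℝ) :
    c * (t ⬝ᵥ t) ≤ t ⬝ᵥ A.mulVec t := by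
  have hB : (A - c • (1 : Matrix K K ℝ)).IsHermitian :=
    hA.sub (Matrix.isHermitian_one.smul (IsSelfAdjoint.all c))
  have hpos : (A - c • (1 : Matrix K K ℝ)).PosSemidef := by
    rw [hB.posSemidef_iff_eigenvalues_nonneg]
    intro i
    have hv := hB.mulVec_eigenvectorBasis i
    set x : K → ℝ := ⇑(hB.eigenvectorBasis i) with hx
    have hx0 : x ≠ 0 := by
      intro h0
      apply hB.eigenvectorBasis.toBasis.ne_zero i
      ext k
      simpa using congrFun h0 k
    have hev : Module.End.HasEigenvalue (Matrix.toLin' A) (hB.eigenvalues i + c) := by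
      refine Module.End.hasEigenvalue_of_hasEigenvector (x := x) ⟨?_, hx0⟩
      rw [Module.End.mem_eigenspace_iff, Matrix.toLin'_apply]
      rw [Matrix.sub_mulVec, Matrix.smul_mulVec, Matrix.one_mulVec] at hv
      rw [add_smul, ← hv]
      simp
    have := hc _ hev
    simp only [Pi.zero_apply]
    linarith
  have := hpos.dotProduct_mulVec_nonneg t
  rw [Matrix.sub_mulVec, Matrix.smul_mulVec, Matrix.one_mulVec, dotProduct_sub,
    dotProduct_smul] at this
  simp only [star_trivial, smul_eq_mul] at this
  linarith

end SecondMoment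

section Inverse

variable {K : Type*} [Fintype K] [DecidableEq K] {A : Matrix K K ℝ} {c : ℝ}

/-- Coercivity makes `A` injective, so `A⁻¹` is a genuine inverse and not the default value of a
singular matrix. -/
theorem mulVec_inv_mulVec (hc : 0 < c) (h : ∀ t, c * (t ⬝ᵥ t) ≤ t ⬝ᵥ A.mulVec t) (v : K → ℝ) :
    A.mulVec (A⁻¹.mulVec v) = v := by
  have hdet : IsUnit A.det := by
    rw [← Matrix.isUnit_iff_isUnit_det, ← Matrix.mulVec_injective_iff_isUnit]
    intro x y hxy
    have h0 : A.mulVec (x - y) = 0 := by rw [Matrix.mulVec_sub]; exact sub_eq_zero.mpr hxy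
    have h1 := h (x - y)
    rw [h0, dotProduct_zero] at h1
    have h2 : (x - y) ⬝ᵥ (x - y) = 0 :=
      le_antisymm (by nlinarith) (dotProduct_self_nonneg' _)
    exact sub_eq_zero.mp (dotProduct_self_eq_zero.mp h2)
  rw [Matrix.mulVec_mulVec, Matrix.mul_nonsing_inv _ hdet, Matrix.one_mulVec]

/-- With `w = A⁻¹ v`, coercivity and Cauchy–Schwarz give `c |w|² ≤ w ⬝ᵥ v ≤ |w| |v|`. -/
theorem inv_mulVec_dotProduct_self_le (hc : 0 < c)
    (h : ∀ t, c * (t ⬝ᵥ t) ≤ t ⬝ᵥ A.mulVec t) (v : K → ℝ) :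
    A⁻¹.mulVec v ⬝ᵥ A⁻¹.mulVec v ≤ (v ⬝ᵥ v) / c ^ 2 := by
  set w := A⁻¹.mulVec v with hw
  have h1 := h w
  rw [mulVec_inv_mulVec hc h v] at h1
  have h2 := sq_dotProduct_le w v
  have h3 := dotProduct_self_nonneg' w
  rw [le_div_iff₀ (by positivity)]
  rcases h3.eq_or_lt with h4 | h4
  · rw [← h4, zero_mul]; exact dotProduct_self_nonneg' v
  · have h5 : (c * (w ⬝ᵥ w)) ^ 2 ≤ (w ⬝ᵥ v) ^ 2 := pow_le_pow_left₀ (by positivity) h1 2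
    have h6 : (w ⬝ᵥ w) * (w ⬝ᵥ w * c ^ 2) ≤ (w ⬝ᵥ w) * (v ⬝ᵥ v) := by nlinarith
    exact le_of_mul_le_mul_left h6 h4

theorem inv_mulVec_dotProduct_le (hc : 0 < c)
    (h : ∀ t, c * (t ⬝ᵥ t) ≤ t ⬝ᵥ A.mulVec t) (v : K → ℝ) :
    A⁻¹.mulVec v ⬝ᵥ v ≤ (v ⬝ᵥ v) / c := by
  have h1 := inv_mulVec_dotProduct_self_le hc h v
  have h2 := sq_dotProduct_le (A⁻¹.mulVec v) v
  have h3 := dotProduct_self_nonneg' v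
  refine le_of_sq_le_sq (h2.trans ?_) (by positivity)
  calc _ ≤ (v ⬝ᵥ v) / c ^ 2 * (v ⬝ᵥ v) := by gcongr
    _ = _ := by rw [div_pow]; ring

end Inverse

end CPC

/-! ### The Huber-type penalty, duality, and tails of the dual terms. -/

namespace CPC

/-- A loss which is quadratic near zero and linear far from it. -/
noncomputable def huber (δ x : ℝ) : ℝ := min (x ^ 2) (δ * |x|)

theorem huber_nonneg {δ : ℝ} (hδ : 0 ≤ δ) (x : ℝ) : 0 ≤ huber δ x :=
  le_min (sq_nonneg _) (by positivity)

theorem continuous_huber (δ : ℝ) : Continuous (huber δ) := by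
  unfold huber; fun_prop

/-- In the quadratic regime this is completing the square. In the linear regime the penalty has
slope only `β δ`, so it absorbs `2 g x` up to `|g| = β δ / 2`; the last term is what remains. -/
theorem young_huber {β δ : ℝ} (hβ : 0 < β) (g x : ℝ) :
    2 * (g * x) - β * huber δ x ≤ g ^ 2 / β + 2 * (max (|g| - β * δ / 2) 0 * |x|) := by
  have hr : 0 ≤ max (|g| - β * δ / 2) 0 * |x| := mul_nonneg (le_max_right _ _) (abs_nonneg _)
  have hg : 0 ≤ g ^ 2 / β := by positivity
  rcases min_choice (x ^ 2) (δ * |x|) with h | h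
  · rw [huber, h]
    have h1 : 2 * (g * x) - β * x ^ 2 ≤ g ^ 2 / β := by
      rw [le_div_iff₀ hβ]
      nlinarith [sq_nonneg (g - β * x)]
    linarith
  · rw [huber, h]
    have h1 : g * x ≤ |g| * |x| := by rw [← abs_mul]; exact le_abs_self _
    have h2 : (|g| - β * δ / 2) * |x| ≤ max (|g| - β * δ / 2) 0 * |x| :=
      mul_le_mul_of_nonneg_right (le_max_left _ _) (abs_nonneg _)
    nlinarith

/-- Uses `z ≤ exp (θ z) / θ`; the majorant is written with `cosh` because that is the moment which
is bounded for signed sums. -/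
theorem max_sub_zero_le_cosh {θ : ℝ} (hθ : 0 < θ) (g c : ℝ) :
    max (|g| - c) 0 ≤ 2 / θ * Real.exp (-(θ * c)) * Real.cosh (θ * g) := by
  have h1 : Real.exp (θ * |g|) ≤ 2 * Real.cosh (θ * g) := by
    have : Real.cosh (θ * g) = Real.cosh (θ * |g|) := by
      rw [← Real.cosh_abs, abs_mul, abs_of_pos hθ]
    rw [this, Real.cosh_eq]
    linarith [Real.exp_pos (-(θ * |g|))]
  have h2 : 2 / θ * Real.exp (-(θ * c)) * Real.cosh (θ * g) ≥
      Real.exp (θ * (|g| - c)) / θ := by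
    rw [mul_sub, sub_eq_add_neg, Real.exp_add]
    calc Real.exp (θ * |g|) * Real.exp (-(θ * c)) / θ
        ≤ (2 * Real.cosh (θ * g)) * Real.exp (-(θ * c)) / θ := by gcongr
      _ = _ := by ring
  refine le_trans (max_le ?_ (by positivity)) h2
  rw [le_div_iff₀ hθ]
  linarith [Real.add_one_le_exp (θ * (|g| - c))]

/-- Split `u² - y² = (u - y)² + 2 y (u - y)` and bound each power of `ρ (u - y)` by its exponential.
-/
theorem max_sq_sub_sq_le_cosh {ρ y : ℝ} (hρ : 0 < ρ) (hy : 0 ≤ y) {u : ℝ} (hu : 0 ≤ u) :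
    max (u ^ 2 - y ^ 2) 0 ≤
      (2 / ρ ^ 2 + 2 * y / ρ) * (2 * Real.exp (-(ρ * y)) * Real.cosh (ρ * u)) := by
  have h1 : Real.exp (ρ * (u - y)) ≤ 2 * Real.exp (-(ρ * y)) * Real.cosh (ρ * u) := by
    rw [mul_sub, sub_eq_add_neg, Real.exp_add, Real.cosh_eq]
    nlinarith [mul_pos (Real.exp_pos (-(ρ * y))) (Real.exp_pos (-(ρ * u)))]
  have hco : 0 ≤ 2 / ρ ^ 2 + 2 * y / ρ := by positivity
  refine le_trans (max_le ?_ (by positivity)) (mul_le_mul_of_nonneg_left h1 hco)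
  rcases le_total u y with h | h
  · have : u ^ 2 ≤ y ^ 2 := pow_le_pow_left₀ hu h 2
    have : 0 ≤ (2 / ρ ^ 2 + 2 * y / ρ) * Real.exp (ρ * (u - y)) := by positivity
    linarith
  · have hw : 0 ≤ ρ * (u - y) := mul_nonneg hρ.le (by linarith)
    have h2 := Real.quadratic_le_exp_of_nonneg hw
    have h3 : 2 / ρ ^ 2 * Real.exp (ρ * (u - y)) ≥ (u - y) ^ 2 := by
      calc (u - y) ^ 2 = 2 / ρ ^ 2 * ((ρ * (u - y)) ^ 2 / 2) := by field_simp
        _ ≤ _ := by gcongr; linarith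
    have h4 : 2 * y / ρ * Real.exp (ρ * (u - y)) ≥ 2 * y * (u - y) := by
      calc 2 * y * (u - y) = 2 * y / ρ * (ρ * (u - y)) := by field_simp
        _ ≤ _ := by gcongr; nlinarith [sq_nonneg (ρ * (u - y))]
    rw [add_mul]
    nlinarith

section Certificate

variable {E K : Type*} [MeasurableSpace E] [Fintype K] [DecidableEq K] {μ : Measure E}
  [IsProbabilityMeasure μ] {Z : E → K → ℝ} {m q c : ℝ}

theorem integral_inv_dotProduct_mul (hZ : Measurable Z) (hm : ∀ᵐ d ∂μ, ∀ k, |Z d k| ≤ m)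
    (hc : 0 < c) (hA : ∀ t, c * (t ⬝ᵥ t) ≤ t ⬝ᵥ (secondMoment μ Z).mulVec t) (v t : K → ℝ) :
    ∫ d, (Z d ⬝ᵥ (secondMoment μ Z)⁻¹.mulVec v) * (Z d ⬝ᵥ t) ∂μ = v ⬝ᵥ t := by
  have h := dotProduct_secondMoment_mulVec hZ hm t ((secondMoment μ Z)⁻¹.mulVec v)
  rw [mulVec_inv_mulVec hc hA] at h
  rw [dotProduct_comm v t, h]
  simp only [mul_comm]

/-- Duality: a linear functional minus a Huber-type penalty is controlled by the size of the
linear predictor that represents the functional. -/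
theorem two_mul_dotProduct_sub_huber_le (hZ : Measurable Z) (hm : ∀ᵐ d ∂μ, ∀ k, |Z d k| ≤ m)
    (hm0 : 0 ≤ m) (hq : (Fintype.card K : ℝ) ≤ q) (hc : 0 < c)
    (hA : ∀ t, c * (t ⬝ᵥ t) ≤ t ⬝ᵥ (secondMoment μ Z).mulVec t) {β δ R : ℝ} (hβ : 0 < β)
    (hδ : 0 ≤ δ) (hR : 0 ≤ R) (v t : K → ℝ) (ht : t ⬝ᵥ t ≤ R ^ 2) :
    2 * (v ⬝ᵥ t) - β * ∫ d, huber δ (Z d ⬝ᵥ t) ∂μ ≤ (v ⬝ᵥ v) / (β * c) +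
      2 * (m * Real.sqrt q * R) *
        ∫ d, max (|Z d ⬝ᵥ (secondMoment μ Z)⁻¹.mulVec v| - β * δ / 2) 0 ∂μ := by
  set w := (secondMoment μ Z)⁻¹.mulVec v with hw
  set B := m * Real.sqrt q * R with hB
  have hB0 : 0 ≤ B := by positivity
  have hbd : ∀ᵐ d ∂μ, |Z d ⬝ᵥ t| ≤ B := by
    filter_upwards [hm] with d hd using abs_dotProduct_le hm0 hR hd hq ht
  have hit := integrable_dotProduct hZ hm t
  have hiw := integrable_dotProduct hZ hm w
  have hiwt := integrable_dotProduct_mul hZ hm w t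
  have hiww := integrable_dotProduct_mul hZ hm w w
  have hh : Integrable (fun d => huber δ (Z d ⬝ᵥ t)) μ := by
    refine (hit.abs.const_mul δ).mono'
      ((continuous_huber δ).measurable.comp (measurable_dotProduct_const hZ t)).aestronglyMeasurable
      (ae_of_all _ fun d => ?_)
    rw [Real.norm_of_nonneg (huber_nonneg hδ _)]
    exact min_le_right _ _
  have hp : Integrable (fun d => max (|Z d ⬝ᵥ w| - β * δ / 2) 0) μ :=
    (hiw.abs.sub (integrable_const _)).pos_part
  -- From here everything is one integral over `μ`, so `young_huber` applies pointwise with `g = Zᵀ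
  -- w` and `x = Zᵀ t`.
  rw [← integral_inv_dotProduct_mul hZ hm hc hA v t, ← hw]
  have e1 : (∫ d, (Z d ⬝ᵥ w) * (Z d ⬝ᵥ w) ∂μ) / β ≤ (v ⬝ᵥ v) / (β * c) := by
    rw [hw, integral_inv_dotProduct_mul hZ hm hc hA, dotProduct_comm, mul_comm β c, ← div_div]
    gcongr
    exact inv_mulVec_dotProduct_le hc hA v
  refine le_trans ?_ (add_le_add_left e1 _)
  rw [← integral_const_mul, ← integral_const_mul, ← integral_const_mul, ← integral_div,
    ← integral_sub (hiwt.const_mul 2) (hh.const_mul β),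
    ← integral_add (hiww.div_const β) (hp.const_mul _)]
  refine integral_mono_ae ((hiwt.const_mul 2).sub (hh.const_mul β))
    ((hiww.div_const β).add (hp.const_mul _)) ?_
  filter_upwards [hbd] with d hd
  have h1 := young_huber (δ := δ) hβ (Z d ⬝ᵥ w) (Z d ⬝ᵥ t)
  have h2 : max (|Z d ⬝ᵥ w| - β * δ / 2) 0 * |Z d ⬝ᵥ t| ≤
      max (|Z d ⬝ᵥ w| - β * δ / 2) 0 * B :=
    mul_le_mul_of_nonneg_left hd (le_max_right _ _)
  rw [sq] at h1
  linarith

/-- The signed mean of the vectors `Z` over a sample with signs. -/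
noncomputable def signedMean {n : ℕ} (Z : E → K → ℝ) (x : Fin n → E × Bool) : K → ℝ :=
  (n : ℝ)⁻¹ • ∑ i, sgn (x i).2 • Z (x i).1

theorem measurable_signedMean (hZ : Measurable Z) (n : ℕ) :
    Measurable (signedMean (n := n) Z) := by
  have h : Measurable fun x : Fin n → E × Bool => ∑ i, sgn (x i).2 • Z (x i).1 := by
    refine Finset.measurable_sum _ fun i _ => ?_
    have hi : Measurable fun x : Fin n → E × Bool => x i := measurable_pi_apply i
    exact (measurable_sgn.comp (measurable_snd.comp hi)).smul (hZ.comp (measurable_fst.comp hi))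
  exact (measurable_const_smul ((n : ℝ)⁻¹)).comp h

theorem cosh_le_one_add_sq {x : ℝ} (hx : x ^ 2 ≤ 1) : Real.cosh x ≤ 1 + x ^ 2 := by
  refine (Real.cosh_le_exp_half_sq x).trans ?_
  have h := Real.abs_exp_sub_one_sub_id_le (x := x ^ 2 / 2)
    (by rw [abs_of_nonneg (by positivity)]; linarith)
  have h2 := (abs_le.mp h).2
  nlinarith [sq_nonneg x]

/-- Exponential moment of one coordinate of the linear predictor. -/
theorem lintegral_cosh_predictor_le (hZ : Measurable Z) (hm : ∀ᵐ d ∂μ, ∀ k, |Z d k| ≤ m)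
    (hq : (Fintype.card K : ℝ) ≤ q) (hc : 0 < c)
    (hA : ∀ t, c * (t ⬝ᵥ t) ≤ t ⬝ᵥ (secondMoment μ Z).mulVec t) {l : ℝ} (hl : 0 < l)
    (hlq : l * (m ^ 2 * q / c) ≤ 1) {n : ℕ} (hn : n ≠ 0) :
    ∀ᵐ d ∂μ, ∫⁻ x, ENNReal.ofReal
        (Real.cosh (l * n * (Z d ⬝ᵥ (secondMoment μ Z)⁻¹.mulVec (signedMean Z x))))
        ∂(Measure.pi fun _ : Fin n => μ.prod signLaw) ≤
      ENNReal.ofReal (Real.exp (n * (l ^ 2 * (m ^ 2 * q / c)))) := by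
  set A := secondMoment μ Z with hAdef
  have hq0 : 0 ≤ q := (Nat.cast_nonneg _).trans hq
  filter_upwards [hm] with d hd
  set u := A⁻¹.mulVec (Z d) with hu
  have hAs : A⁻¹.IsHermitian := (secondMoment_isHermitian (μ := μ) (Z := Z)).inv
  -- By symmetry of `A⁻¹` the predictor at a fixed point `d` is a mean of signed scalars `Zᵢᵀ u`.
  -- Both their second moment and their absolute bound are `m² q / c`, as in a Bernstein inequality;
  -- the condition on `l` keeps the argument of `cosh` in `[-1, 1]`.
  have hsym : ∀ v, Z d ⬝ᵥ A⁻¹.mulVec v = v ⬝ᵥ u := by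
    intro v
    rw [hu, Matrix.dotProduct_mulVec, dotProduct_comm, ← Matrix.mulVec_transpose]
    have : A⁻¹.transpose = A⁻¹ := by
      rw [← Matrix.conjTranspose_eq_transpose_of_trivial]; exact hAs
    rw [this]
  have hzz := dotProduct_self_le hd hq
  have huu : u ⬝ᵥ u ≤ (m ^ 2 * q) / c ^ 2 :=
    (inv_mulVec_dotProduct_self_le hc hA (Z d)).trans (by gcongr)
  have hV : Measurable fun d' => l * (Z d' ⬝ᵥ u) := (measurable_dotProduct_const hZ u).const_mul l
  have hi2 := integrable_dotProduct_mul hZ hm u u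
  have hE : ∫ d', (Z d' ⬝ᵥ u) * (Z d' ⬝ᵥ u) ∂μ ≤ m ^ 2 * q / c := by
    rw [hu, integral_inv_dotProduct_mul hZ hm hc hA, dotProduct_comm]
    exact (inv_mulVec_dotProduct_le hc hA (Z d)).trans (by gcongr)
  have hM : ∫⁻ d', ENNReal.ofReal (Real.cosh ‖l * (Z d' ⬝ᵥ u)‖) ∂μ ≤
      ENNReal.ofReal (Real.exp (l ^ 2 * (m ^ 2 * q / c))) := by
    calc _ ≤ ∫⁻ d', ENNReal.ofReal (1 + l ^ 2 * ((Z d' ⬝ᵥ u) * (Z d' ⬝ᵥ u))) ∂μ := by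
          refine lintegral_mono_ae ?_
          filter_upwards [hm] with d' hd'
          refine ENNReal.ofReal_le_ofReal ?_
          rw [Real.norm_eq_abs, Real.cosh_abs]
          refine (cosh_le_one_add_sq ?_).trans_eq (by ring)
          have h1 := sq_dotProduct_le (Z d') u
          have h2 := dotProduct_self_le hd' hq
          have h3 : (Z d' ⬝ᵥ u) ^ 2 ≤ (m ^ 2 * q) * ((m ^ 2 * q) / c ^ 2) :=
            h1.trans (mul_le_mul h2 huu (dotProduct_self_nonneg' u) (by positivity))
          calc (l * (Z d' ⬝ᵥ u)) ^ 2 = l ^ 2 * (Z d' ⬝ᵥ u) ^ 2 := by ring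
            _ ≤ l ^ 2 * ((m ^ 2 * q) * ((m ^ 2 * q) / c ^ 2)) := by gcongr
            _ = (l * (m ^ 2 * q / c)) ^ 2 := by field_simp
            _ ≤ 1 := pow_le_one₀ (by positivity) hlq
      _ = ENNReal.ofReal (∫ d', (1 + l ^ 2 * ((Z d' ⬝ᵥ u) * (Z d' ⬝ᵥ u))) ∂μ) := by
          refine (ofReal_integral_eq_lintegral_ofReal
            ((integrable_const _).add (hi2.const_mul _)) (ae_of_all _ fun d' => ?_)).symm
          have := mul_self_nonneg (Z d' ⬝ᵥ u)
          simp only [Pi.zero_apply, Pi.add_apply]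
          positivity
      _ ≤ _ := by
          refine ENNReal.ofReal_le_ofReal ?_
          rw [integral_add (integrable_const _) (hi2.const_mul _), integral_const_mul]
          simp only [integral_const, probReal_univ, smul_eq_mul, one_mul]
          have h1 : l ^ 2 * ∫ d', (Z d' ⬝ᵥ u) * (Z d' ⬝ᵥ u) ∂μ ≤ l ^ 2 * (m ^ 2 * q / c) := by
            gcongr
          linarith [Real.add_one_le_exp (l ^ 2 * (m ^ 2 * q / c))]
  have key := lintegral_cosh_norm_sum_le hV hM n (0 : ℝ)
  rw [norm_zero, Real.cosh_zero, ENNReal.ofReal_one, one_mul,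
    ← ENNReal.ofReal_pow (Real.exp_pos _).le, ← Real.exp_nat_mul] at key
  refine le_trans (le_of_eq ?_) key
  refine lintegral_congr fun x => ?_
  rw [hsym, Real.norm_eq_abs, Real.cosh_abs, zero_add]
  congr 2
  have hn' : (n : ℝ) ≠ 0 := Nat.cast_ne_zero.mpr hn
  rw [signedMean, smul_dotProduct, sum_dotProduct, smul_eq_mul, ← mul_assoc, mul_assoc l,
    mul_inv_cancel₀ hn', mul_one, Finset.mul_sum]
  refine Finset.sum_congr rfl fun i _ => ?_
  rw [smul_dotProduct, smul_eq_mul, smul_eq_mul]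
  ring

/-- After exchanging the integral over the evaluation point with that over the signed sample, the
exponential moment at a fixed evaluation point applies. -/
theorem lintegral_predictor_excess_le (hZ : Measurable Z) (hm : ∀ᵐ d ∂μ, ∀ k, |Z d k| ≤ m)
    (hq : (Fintype.card K : ℝ) ≤ q) (hc : 0 < c)
    (hA : ∀ t, c * (t ⬝ᵥ t) ≤ t ⬝ᵥ (secondMoment μ Z).mulVec t) {l : ℝ} (hl : 0 < l)
    (hlq : l * (m ^ 2 * q / c) ≤ 1) {n : ℕ} (hn : n ≠ 0) (a : ℝ) :
    ∫⁻ x, ENNReal.ofReal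
        (∫ d, max (|Z d ⬝ᵥ (secondMoment μ Z)⁻¹.mulVec (signedMean Z x)| - a) 0 ∂μ)
        ∂(Measure.pi fun _ : Fin n => μ.prod signLaw) ≤
      ENNReal.ofReal (2 / (l * n) * Real.exp (n * (l ^ 2 * (m ^ 2 * q / c) - l * a))) := by
  have hn' : (0 : ℝ) < n := Nat.cast_pos.mpr (Nat.pos_of_ne_zero hn)
  set A := secondMoment μ Z
  have hmeas : Measurable fun y : (Fin n → E × Bool) × E =>
      Z y.2 ⬝ᵥ A⁻¹.mulVec (signedMean Z y.1) := by
    refine Finset.measurable_sum _ fun k _ => ?_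
    refine Measurable.mul ((measurable_pi_apply k).comp (hZ.comp measurable_snd)) ?_
    refine Finset.measurable_sum _ fun k' _ => ?_
    exact ((measurable_pi_apply k').comp
      ((measurable_signedMean hZ n).comp measurable_fst)).const_mul _
  have hmc : Measurable fun y : (Fin n → E × Bool) × E =>
      ENNReal.ofReal (Real.cosh (l * n * (Z y.2 ⬝ᵥ A⁻¹.mulVec (signedMean Z y.1)))) :=
    (Real.measurable_cosh.comp (hmeas.const_mul _)).ennreal_ofReal
  calc _ ≤ ∫⁻ x, ∫⁻ d, ENNReal.ofReal (2 / (l * n) * Real.exp (-(l * n * a))) *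
        ENNReal.ofReal (Real.cosh (l * n * (Z d ⬝ᵥ A⁻¹.mulVec (signedMean Z x)))) ∂μ
        ∂(Measure.pi fun _ : Fin n => μ.prod signLaw) := by
        refine lintegral_mono fun x => ?_
        refine (ofReal_integral_eq_lintegral_ofReal
          (((integrable_dotProduct hZ hm _).abs.sub (integrable_const a)).pos_part)
          (ae_of_all _ fun d => le_max_right _ _)).trans_le ?_
        refine lintegral_mono fun d => ?_
        rw [← ENNReal.ofReal_mul (by positivity)]
        exact ENNReal.ofReal_le_ofReal (max_sub_zero_le_cosh (by positivity) _ a)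
    _ = ∫⁻ d, ∫⁻ x, ENNReal.ofReal (2 / (l * n) * Real.exp (-(l * n * a))) *
        ENNReal.ofReal (Real.cosh (l * n * (Z d ⬝ᵥ A⁻¹.mulVec (signedMean Z x))))
        ∂(Measure.pi fun _ : Fin n => μ.prod signLaw) ∂μ :=
        lintegral_lintegral_swap (hmc.const_mul _).aemeasurable
    _ ≤ ∫⁻ _d, ENNReal.ofReal (2 / (l * n) * Real.exp (-(l * n * a))) *
        ENNReal.ofReal (Real.exp (n * (l ^ 2 * (m ^ 2 * q / c)))) ∂μ := by
        refine lintegral_mono_ae ?_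
        filter_upwards [lintegral_cosh_predictor_le hZ hm hq hc hA hl hlq hn] with d hd
        refine (lintegral_const_mul _ (hmc.comp measurable_prodMk_right)).trans_le ?_
        exact mul_le_mul_right hd _
    _ = _ := by
        rw [lintegral_const, measure_univ, mul_one, ← ENNReal.ofReal_mul (by positivity),
          mul_assoc, ← Real.exp_add]
        congr 3
        ring

/-- The Hilbert-space moment bound is used with the vectors `(ρ / n) Z`, of squared norm at most `(ρ
/ n)² m² q`. The dimension enters only through this norm, and no covering of the ball is needed. -/
theorem lintegral_signedMean_excess_le (hZ : Measurable Z) (hm : ∀ᵐ d ∂μ, ∀ k, |Z d k| ≤ m)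
    (hq : (Fintype.card K : ℝ) ≤ q) {ρ y : ℝ} (hρ : 0 < ρ) (hy : 0 ≤ y) {n : ℕ} (hn : n ≠ 0) :
    ∫⁻ x, ENNReal.ofReal (max (signedMean Z x ⬝ᵥ signedMean Z x - y ^ 2) 0)
        ∂(Measure.pi fun _ : Fin n => μ.prod signLaw) ≤
      ENNReal.ofReal ((2 / ρ ^ 2 + 2 * y / ρ) *
        (2 * Real.exp (ρ ^ 2 * (m ^ 2 * q) / (2 * n) - ρ * y))) := by
  have hn' : (n : ℝ) ≠ 0 := Nat.cast_ne_zero.mpr hn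
  have hnorm : ∀ v : K → ℝ, ‖(WithLp.toLp 2 v : EuclideanSpace ℝ K)‖ ^ 2 = v ⬝ᵥ v := by
    intro v
    rw [EuclideanSpace.real_norm_sq_eq]
    simp [dotProduct, sq]
  set V : E → EuclideanSpace ℝ K := fun d => WithLp.toLp 2 ((ρ / n) • Z d) with hVdef
  have hV : Measurable V := by
    have h : Measurable fun d => (ρ / n) • Z d :=
      (measurable_const_smul (ρ / (n : ℝ))).comp hZ
    exact (WithLp.measurable_toLp 2 _).comp h
  have hM : ∫⁻ d, ENNReal.ofReal (Real.cosh ‖V d‖) ∂μ ≤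
      ENNReal.ofReal (Real.exp ((ρ / n) ^ 2 * (m ^ 2 * q) / 2)) := by
    calc _ ≤ ∫⁻ _d, ENNReal.ofReal (Real.exp ((ρ / n) ^ 2 * (m ^ 2 * q) / 2)) ∂μ := by
          refine lintegral_mono_ae ?_
          filter_upwards [hm] with d hd
          refine ENNReal.ofReal_le_ofReal ((Real.cosh_le_exp_half_sq _).trans ?_)
          rw [hVdef, hnorm, smul_dotProduct, dotProduct_smul, smul_eq_mul, smul_eq_mul,
            ← mul_assoc, ← sq]
          have := dotProduct_self_le hd hq
          gcongr
      _ = _ := by simp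
  have key := lintegral_cosh_norm_sum_le hV hM n 0
  rw [norm_zero, Real.cosh_zero, ENNReal.ofReal_one, one_mul,
    ← ENNReal.ofReal_pow (Real.exp_pos _).le, ← Real.exp_nat_mul] at key
  have hrw : ∀ x : Fin n → E × Bool, ‖0 + ∑ i, sgn (x i).2 • V (x i).1‖ =
      ρ * Real.sqrt (signedMean Z x ⬝ᵥ signedMean Z x) := by
    intro x
    have e : 0 + ∑ i, sgn (x i).2 • V (x i).1 =
        ρ • (WithLp.toLp 2 (signedMean Z x) : EuclideanSpace ℝ K) := by
      ext k
      simp only [hVdef, signedMean, zero_add, WithLp.ofLp_sum, WithLp.ofLp_smul, Finset.sum_apply,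
        Pi.smul_apply, smul_eq_mul, Finset.mul_sum]
      refine Finset.sum_congr rfl fun i _ => ?_
      field_simp
    rw [e, norm_smul, Real.norm_of_nonneg hρ.le, ← hnorm, Real.sqrt_sq (norm_nonneg _)]
  simp only [hrw] at key
  have hcm : Measurable fun x : Fin n → E × Bool => ENNReal.ofReal
      (Real.cosh (ρ * Real.sqrt (signedMean Z x ⬝ᵥ signedMean Z x))) := by
    refine (Real.measurable_cosh.comp (Measurable.const_mul (Measurable.sqrt ?_) _)).ennreal_ofReal
    refine Finset.measurable_sum _ fun k _ => ?_
    have := (measurable_pi_apply k).comp (measurable_signedMean hZ n)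
    exact this.mul this
  calc _ ≤ ∫⁻ x, ENNReal.ofReal ((2 / ρ ^ 2 + 2 * y / ρ) * (2 * Real.exp (-(ρ * y)))) *
        ENNReal.ofReal (Real.cosh (ρ * Real.sqrt (signedMean Z x ⬝ᵥ signedMean Z x)))
        ∂(Measure.pi fun _ : Fin n => μ.prod signLaw) := by
        refine lintegral_mono fun x => ?_
        rw [← ENNReal.ofReal_mul (by positivity)]
        refine ENNReal.ofReal_le_ofReal ?_
        have := max_sq_sub_sq_le_cosh hρ hy (Real.sqrt_nonneg (signedMean Z x ⬝ᵥ signedMean Z x))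
        rw [Real.sq_sqrt (dotProduct_self_nonneg' _)] at this
        exact this.trans_eq (by ring)
    _ ≤ ENNReal.ofReal ((2 / ρ ^ 2 + 2 * y / ρ) * (2 * Real.exp (-(ρ * y)))) *
        ENNReal.ofReal (Real.exp (n * ((ρ / n) ^ 2 * (m ^ 2 * q) / 2))) := by
        rw [lintegral_const_mul _ hcm]
        exact mul_le_mul_right key _
    _ = _ := by
        rw [← ENNReal.ofReal_mul (by positivity), mul_assoc, mul_assoc, ← Real.exp_add]
        congr 4
        field_simp
        ring

end Certificate

end CPC

namespace CPC

/-! ### Uniform exponential bound for the penalized process. -/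

section UniformDeviation

variable {E K : Type*} [MeasurableSpace E] [Fintype K] [DecidableEq K] {μ : Measure E}
  [IsProbabilityMeasure μ] {Z : E → K → ℝ} {m q c : ℝ}

/-- The penalized centered process of Lipschitz functions of linear predictors. -/
noncomputable def penalizedDeviation {n : ℕ} (μ : Measure E) (Z : E → K → ℝ) (φ : E → ℝ → ℝ)
    (β δ : ℝ) (x : Fin n → E) (t : K → ℝ) : ℝ :=
  (n : ℝ)⁻¹ * ∑ i, φ (x i) (Z (x i) ⬝ᵥ t) - ∫ d, φ d (Z d ⬝ᵥ t) ∂μ -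
    β * ∫ d, huber δ (Z d ⬝ᵥ t) ∂μ

/-- The bound of the expected positive part of the penalized process. -/
noncomputable def excessBound (m q c β δ x : ℝ) (n : ℕ) : ℝ :=
  (4 * m ^ 4 / (β ^ 2 * c ^ 2 * (x * n / q) ^ 2) + 4 * m ^ 2 / (β * c * (x * n / q))) *
      Real.exp (-(β * c * (x * n / q) / (2 * m ^ 2))) +
    4 * m ^ 3 * q ^ 2 / (c * min 1 (β * δ / 4) * n * x) *
      Real.exp (-(n / q * (min 1 (β * δ / 4) * (β * δ) * c / (4 * m ^ 2))))

theorem integrable_lipschitz_predictor (hZ : Measurable Z) (hm : ∀ᵐ d ∂μ, ∀ k, |Z d k| ≤ m)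
    {φ : E → ℝ → ℝ} (hφ : ∀ d x y, |φ d x - φ d y| ≤ |x - y|) (hφ0 : ∀ d, φ d 0 = 0)
    (hφm : ∀ t, Measurable fun d => φ d (Z d ⬝ᵥ t)) (t : K → ℝ) :
    Integrable (fun d => φ d (Z d ⬝ᵥ t)) μ := by
  refine (integrable_dotProduct hZ hm t).abs.mono' (hφm t).aestronglyMeasurable
    (ae_of_all _ fun d => ?_)
  have := hφ d (Z d ⬝ᵥ t) 0
  rwa [hφ0, sub_zero, sub_zero] at this

/-- The constant `x` competes with the penalized deviations in one supremum. Symmetrization and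
contraction preserve it as an offset, so the expected excess of the supremum over `x` is bounded by
the tails of the two dual terms, and Markov's inequality at level `x` needs no further
concentration. The two summands of `excessBound` are these two tails. -/
theorem real_penalizedDeviation_le_of_finite (hZ : Measurable Z)
    (hm : ∀ᵐ d ∂μ, ∀ k, |Z d k| ≤ m)
    (hm0 : 0 < m) (hq : (Fintype.card K : ℝ) ≤ q) (hq0 : 0 < q) (hc : 0 < c)
    (hA : ∀ t, c * (t ⬝ᵥ t) ≤ t ⬝ᵥ (secondMoment μ Z).mulVec t) {β δ : ℝ} (hβ : 0 < β)
    (hδ : 0 < δ) {φ : E → ℝ → ℝ} (hφ : ∀ d x y, |φ d x - φ d y| ≤ |x - y|)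
    (hφ0 : ∀ d, φ d 0 = 0) (hφm : ∀ t, Measurable fun d => φ d (Z d ⬝ᵥ t))
    {x : ℝ} (hx : 0 < x) {n : ℕ} (hn : n ≠ 0) {ι : Type*} [Finite ι] (t : ι → K → ℝ)
    (ht : ∀ i, t i ⬝ᵥ t i ≤ q) :
    (Measure.pi fun _ : Fin n => μ).real
        {z | ∃ i, 2 * x ≤ penalizedDeviation μ Z φ β δ z (t i)} ≤ excessBound m q c β δ x n := by
  have hn' : (0 : ℝ) < n := Nat.cast_pos.mpr (Nat.pos_of_ne_zero hn)
  set Q := Measure.pi fun _ : Fin n => μ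
  set Q' := Measure.pi fun _ : Fin n => μ.prod signLaw
  have hφi := integrable_lipschitz_predictor hZ hm hφ hφ0 hφm
  set D : (K → ℝ) → ℝ := fun t => ∫ d, huber δ (Z d ⬝ᵥ t) ∂μ
  -- The index `none` carries the constant `x` with zero process. Contraction between `none` and
  -- `some i` is where `φ d 0 = 0` enters.
  let F : Option ι → E → ℝ := fun o d => o.elim 0 fun i => (n : ℝ)⁻¹ * φ d (Z d ⬝ᵥ t i)
  let Y : Option ι → E → ℝ := fun o d => o.elim 0 fun i => (n : ℝ)⁻¹ * (Z d ⬝ᵥ t i)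
  let b : Option ι → ℝ := fun o => o.elim x fun i => -(β * D (t i))
  have hF : ∀ o, Integrable (F o) μ := by
    rintro (_ | i)
    · exact integrable_zero _ _ _
    · exact (hφi (t i)).const_mul _
  have hY : ∀ o, Integrable (Y o) μ := by
    rintro (_ | i)
    · exact integrable_zero _ _ _
    · exact (integrable_dotProduct hZ hm (t i)).const_mul _
  have hFY : ∀ d s s', |F s d - F s' d| ≤ |Y s d - Y s' d| := by
    rintro d (_ | i) (_ | j)
    · simp [F, Y]
    · have := hφ d 0 (Z d ⬝ᵥ t j)
      simp only [F, Y, Option.elim, zero_sub, abs_neg, abs_mul]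
      rw [hφ0, zero_sub, zero_sub, abs_neg, abs_neg] at this
      gcongr
    · have := hφ d (Z d ⬝ᵥ t i) 0
      simp only [F, Y, Option.elim, sub_zero, abs_mul]
      rw [hφ0, sub_zero, sub_zero] at this
      gcongr
    · have := hφ d (Z d ⬝ᵥ t i) (Z d ⬝ᵥ t j)
      simp only [F, Y, Option.elim, ← mul_sub, abs_mul]
      gcongr
  have main := integral_ciSup_sum_centered_le hF hY hFY n b
  set S : (Fin n → E) → ℝ := fun z => ⨆ o, (b o + ∑ i, (F o (z i) - ∫ d, F o d ∂μ)) with hSdef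
  set S' : (Fin n → E × Bool) → ℝ := fun z => ⨆ o, (b o + ∑ i, 2 * (sgn (z i).2 * Y o (z i).1))
    with hS'def
  have hSi : Integrable S Q := integrable_ciSup_finite fun o => (integrable_const _).add
    (integrable_sum_pi ((hF o).sub (integrable_const _)) n)
  have hS'i : Integrable S' Q' := by
    refine integrable_ciSup_finite fun o => (integrable_const _).add
      (integrable_sum_pi (f := fun y : E × Bool => 2 * (sgn y.2 * Y o y.1)) ?_ n)
    refine Integrable.const_mul ?_ 2
    refine ((hY o).comp_fst signLaw).bdd_mul (c := 1)
      (measurable_sgn.comp measurable_snd).aestronglyMeasurable (ae_of_all _ fun y => ?_)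
    simp [abs_sgn]
  have hSx : ∀ z, x ≤ S z := fun z => by
    refine le_trans (le_of_eq ?_)
      (le_ciSup_finite (fun o => b o + ∑ i, (F o (z i) - ∫ d, F o d ∂μ)) none)
    simp [F, b]
  have hS'x : ∀ z, x ≤ S' z := fun z => by
    refine le_trans (le_of_eq ?_)
      (le_ciSup_finite (fun o => b o + ∑ i, 2 * (sgn (z i).2 * Y o (z i).1)) none)
    simp [Y, b]
  have hSsome : ∀ z i, penalizedDeviation μ Z φ β δ z (t i) ≤ S z := fun z i => by
    refine le_trans (le_of_eq ?_)
      (le_ciSup_finite (fun o => b o + ∑ i, (F o (z i) - ∫ d, F o d ∂μ)) (some i))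
    simp only [penalizedDeviation, F, b, Option.elim, Finset.sum_sub_distrib, Finset.sum_const,
      Finset.card_univ, Fintype.card_fin, nsmul_eq_mul, integral_const_mul, ← Finset.mul_sum]
    field_simp
    ring
  -- Markov's inequality for `S - x`
  have markov : x * Q.real {z | ∃ i, 2 * x ≤ penalizedDeviation μ Z φ β δ z (t i)} ≤
      ∫ z, (S z - x) ∂Q := by
    refine le_trans ?_ (mul_meas_ge_le_integral_of_nonneg (ae_of_all _ fun z => ?_)
      (hSi.sub (integrable_const x)) x)
    · refine mul_le_mul_of_nonneg_left (measureReal_mono ?_) hx.le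
      rintro z ⟨i, hi⟩
      have := hSsome z i
      change x ≤ S z - x
      linarith
    · simpa using hSx z
  -- Choice of constants: `y² / (β c) = x`, so the quadratic dual term exceeds `x` only when `|v| >
  -- y`; `ρ` minimizes `ρ² m² q / (2n) - ρ y`; `l Q0 = η ≤ 1` is the Bernstein condition; and `η ≤ β
  -- δ / 4` makes `l² Q0` at most half of `l β δ / 2`.
  set η := min 1 (β * δ / 4) with hη
  have hη0 : 0 < η := lt_min one_pos (by positivity)
  set y := Real.sqrt (β * c * x) with hy
  have hy0 : 0 < y := Real.sqrt_pos.mpr (by positivity)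
  have hysq : y ^ 2 = β * c * x := Real.sq_sqrt (by positivity)
  set Q0 := m ^ 2 * q / c with hQ0
  have hQ0p : 0 < Q0 := by positivity
  set l := η / Q0 with hl
  set ρ := y * n / (m ^ 2 * q) with hρ
  have hρ0 : 0 < ρ := by positivity
  have hl0 : 0 < l := by positivity
  have b1 := lintegral_signedMean_excess_le hZ hm hq hρ0 hy0.le hn
  have b2 := lintegral_predictor_excess_le hZ hm hq hc hA hl0
    (by rw [hl, div_mul_cancel₀ _ hQ0p.ne']; exact min_le_left _ _) hn (β * δ / 2)
  have hsq : Real.sqrt q * Real.sqrt q = q := Real.mul_self_sqrt hq0.le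
  -- the dual bound of the symmetrized supremum
  have dual : ∀ z : Fin n → E × Bool, S' z - x ≤
      (β * c)⁻¹ * max (signedMean Z z ⬝ᵥ signedMean Z z - y ^ 2) 0 +
      2 * (m * q) *
        ∫ d, max (|Z d ⬝ᵥ (secondMoment μ Z)⁻¹.mulVec (signedMean Z z)| - β * δ / 2) 0 ∂μ := by
    intro z
    have hI : 0 ≤ ∫ d, max (|Z d ⬝ᵥ (secondMoment μ Z)⁻¹.mulVec (signedMean Z z)| - β * δ / 2) 0
        ∂μ := integral_nonneg fun d => le_max_right _ _
    have hM : 0 ≤ max (signedMean Z z ⬝ᵥ signedMean Z z - y ^ 2) 0 := le_max_right _ _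
    rw [sub_le_iff_le_add]
    refine ciSup_le fun o => ?_
    cases o with
    | none =>
      have : 0 ≤ (β * c)⁻¹ * max (signedMean Z z ⬝ᵥ signedMean Z z - y ^ 2) 0 +
        2 * (m * q) * ∫ d, max (|Z d ⬝ᵥ (secondMoment μ Z)⁻¹.mulVec (signedMean Z z)| -
          β * δ / 2) 0 ∂μ := by positivity
      simpa [Y, b] using this
    | some i =>
      have h1 := two_mul_dotProduct_sub_huber_le hZ hm hm0.le hq hc hA hβ hδ.le
        (Real.sqrt_nonneg q) (signedMean Z z) (t i) (by rw [Real.sq_sqrt hq0.le]; exact ht i)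
      rw [mul_assoc m, hsq] at h1
      have e : b (some i) + ∑ j, 2 * (sgn (z j).2 * Y (some i) (z j).1) =
          2 * (signedMean Z z ⬝ᵥ t i) - β * D (t i) := by
        simp only [b, Y, Option.elim, signedMean, smul_dotProduct, sum_dotProduct, smul_eq_mul,
          Finset.mul_sum]
        rw [neg_add_eq_sub]
        congr 1
        refine Finset.sum_congr rfl fun j _ => by ring
      rw [e]
      have h2 : (signedMean Z z ⬝ᵥ signedMean Z z) / (β * c) ≤
          (β * c)⁻¹ * max (signedMean Z z ⬝ᵥ signedMean Z z - y ^ 2) 0 + x := by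
        have h3 : signedMean Z z ⬝ᵥ signedMean Z z - y ^ 2 ≤
          max (signedMean Z z ⬝ᵥ signedMean Z z - y ^ 2) 0 := le_max_left _ _
        have h4 := mul_le_mul_of_nonneg_left h3 (inv_nonneg.mpr (mul_pos hβ hc).le)
        rw [hysq, mul_sub] at h4
        have h5 : (β * c)⁻¹ * (β * c * x) = x := by field_simp
        rw [h5] at h4
        rw [div_eq_inv_mul, hysq]
        linarith
      linarith
  have total : ∫ z, (S' z - x) ∂Q' ≤
      (β * c)⁻¹ * ((2 / ρ ^ 2 + 2 * y / ρ) *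
        (2 * Real.exp (ρ ^ 2 * (m ^ 2 * q) / (2 * n) - ρ * y))) +
      2 * (m * q) * (2 / (l * n) * Real.exp (n * (l ^ 2 * Q0 - l * (β * δ / 2)))) := by
    have hSm : AEStronglyMeasurable (fun z => S' z - x) Q' :=
      (hS'i.sub (integrable_const x)).aestronglyMeasurable
    rw [integral_eq_lintegral_of_nonneg_ae (ae_of_all _ fun z => by simpa using hS'x z) hSm]
    refine ENNReal.toReal_le_of_le_ofReal (by positivity) ?_
    have hmm : Measurable fun z : Fin n → E × Bool => ENNReal.ofReal ((β * c)⁻¹) *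
        ENNReal.ofReal (max (signedMean Z z ⬝ᵥ signedMean Z z - y ^ 2) 0) := by
      refine Measurable.const_mul (Measurable.ennreal_ofReal ?_) _
      refine Measurable.max (Measurable.sub_const ?_ _) measurable_const
      refine Finset.measurable_sum _ fun k _ => ?_
      have := (measurable_pi_apply k).comp (measurable_signedMean hZ n)
      exact this.mul this
    calc _ ≤ ∫⁻ z, (ENNReal.ofReal ((β * c)⁻¹) *
          ENNReal.ofReal (max (signedMean Z z ⬝ᵥ signedMean Z z - y ^ 2) 0) +
          ENNReal.ofReal (2 * (m * q)) * ENNReal.ofReal (∫ d, max (|Z d ⬝ᵥ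
            (secondMoment μ Z)⁻¹.mulVec (signedMean Z z)| - β * δ / 2) 0 ∂μ)) ∂Q' := by
          refine lintegral_mono fun z => ?_
          have hI : 0 ≤ ∫ d, max (|Z d ⬝ᵥ (secondMoment μ Z)⁻¹.mulVec (signedMean Z z)| -
            β * δ / 2) 0 ∂μ := integral_nonneg fun d => le_max_right _ _
          have hM : 0 ≤ max (signedMean Z z ⬝ᵥ signedMean Z z - y ^ 2) 0 := le_max_right _ _
          rw [← ENNReal.ofReal_mul (by positivity), ← ENNReal.ofReal_mul (by positivity),
            ← ENNReal.ofReal_add (by positivity) (by positivity)]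
          exact ENNReal.ofReal_le_ofReal (dual z)
      _ = ENNReal.ofReal ((β * c)⁻¹) * (∫⁻ z,
          ENNReal.ofReal (max (signedMean Z z ⬝ᵥ signedMean Z z - y ^ 2) 0) ∂Q') +
          ENNReal.ofReal (2 * (m * q)) * ∫⁻ z, ENNReal.ofReal (∫ d, max (|Z d ⬝ᵥ
            (secondMoment μ Z)⁻¹.mulVec (signedMean Z z)| - β * δ / 2) 0 ∂μ) ∂Q' := by
          rw [lintegral_add_left hmm, lintegral_const_mul' _ _ ENNReal.ofReal_ne_top,
            lintegral_const_mul' _ _ ENNReal.ofReal_ne_top]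
      _ ≤ _ := by
          refine (add_le_add (mul_le_mul_right b1 _) (mul_le_mul_right b2 _)).trans_eq ?_
          rw [← ENNReal.ofReal_mul (by positivity), ← ENNReal.ofReal_mul (by positivity),
            ← ENNReal.ofReal_add (by positivity) (by positivity)]
  have hint : ∫ z, (S z - x) ∂Q ≤ ∫ z, (S' z - x) ∂Q' := by
    rw [integral_sub hSi (integrable_const _), integral_sub hS'i (integrable_const _)]
    simpa using main
  have hfin : x * Q.real {z | ∃ i, 2 * x ≤ penalizedDeviation μ Z φ β δ z (t i)} ≤
      x * excessBound m q c β δ x n := by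
    refine (markov.trans (hint.trans total)).trans ?_
    rw [excessBound, ← hη, mul_add x]
    refine add_le_add (le_of_eq ?_) ?_
    · have e1 : ρ ^ 2 * (m ^ 2 * q) / (2 * n) - ρ * y =
          -(β * c * (x * n / q) / (2 * m ^ 2)) := by
        have : ρ ^ 2 * (m ^ 2 * q) / (2 * n) - ρ * y = -(y ^ 2 * (n / q) / (2 * m ^ 2)) := by
          rw [hρ]; field_simp; ring
        rw [this, hysq]; ring
      have e2 : 2 / ρ ^ 2 + 2 * y / ρ = 2 * m ^ 4 * q ^ 2 / (β * c * x * n ^ 2) +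
          2 * m ^ 2 * q / n := by
        have : 2 / ρ ^ 2 + 2 * y / ρ = 2 * m ^ 4 * q ^ 2 / (y ^ 2 * n ^ 2) +
          2 * m ^ 2 * q / n := by
          rw [hρ]; field_simp
        rw [this, hysq]
      rw [e1, e2]
      field_simp
      ring
    · have e1 : (n : ℝ) * (l ^ 2 * Q0 - l * (β * δ / 2)) ≤
          -(n / q * (η * (β * δ) * c / (4 * m ^ 2))) := by
        have : (n : ℝ) * (l ^ 2 * Q0 - l * (β * δ / 2)) =
            n / q * (c / m ^ 2) * (η * (η - β * δ / 2)) := by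
          rw [hl, hQ0]; field_simp
        rw [this]
        have h1 : η ≤ β * δ / 4 := min_le_right _ _
        have h2 : η * (η - β * δ / 2) ≤ -(η * (β * δ) / 4) := by nlinarith
        calc n / q * (c / m ^ 2) * (η * (η - β * δ / 2))
            ≤ n / q * (c / m ^ 2) * (-(η * (β * δ) / 4)) := by gcongr
          _ = _ := by field_simp
      have e2 : 2 * (m * q) * (2 / (l * n)) = x * (4 * m ^ 3 * q ^ 2 / (c * η * n * x)) := by
        rw [hl, hQ0]; field_simp; ring
      rw [← mul_assoc, ← mul_assoc x, e2]
      gcongr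
  exact le_of_mul_le_mul_left hfin hx

/-- Uniform one-sided deviation over the ball of squared radius `q`. -/
theorem real_penalizedDeviation_le (hZ : Measurable Z)
    (hm : ∀ᵐ d ∂μ, ∀ k, |Z d k| ≤ m)
    (hm0 : 0 < m) (hq : (Fintype.card K : ℝ) ≤ q) (hq0 : 0 < q) (hc : 0 < c)
    (hA : ∀ t, c * (t ⬝ᵥ t) ≤ t ⬝ᵥ (secondMoment μ Z).mulVec t) {β δ : ℝ} (hβ : 0 < β)
    (hδ : 0 < δ) {φ : E → ℝ → ℝ} (hφ : ∀ d x y, |φ d x - φ d y| ≤ |x - y|)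
    (hφ0 : ∀ d, φ d 0 = 0) (hφm : ∀ t, Measurable fun d => φ d (Z d ⬝ᵥ t))
    {x : ℝ} (hx : 0 < x) {n : ℕ} (hn : n ≠ 0) :
    (Measure.pi fun _ : Fin n => μ).real
        {z | ∃ t, t ⬝ᵥ t ≤ q ∧ 2 * x < penalizedDeviation μ Z φ β δ z t} ≤
      excessBound m q c β δ x n := by
  set Q := Measure.pi fun _ : Fin n => μ
  let B : Set (K → ℝ) := {t | t ⬝ᵥ t ≤ q}
  have : Nonempty B := ⟨0, by simpa [B] using hq0.le⟩
  let u := TopologicalSpace.denseSeq B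
  have hdot : ∀ d, Continuous fun t : B => Z d ⬝ᵥ (t : K → ℝ) := fun d =>
    continuous_finsetSum _ fun k _ =>
      continuous_const.mul ((continuous_apply k).comp continuous_subtype_val)
  have hφc : ∀ d, Continuous (φ d) := fun d =>
    (LipschitzWith.of_dist_le_mul (K := 1) fun a b => by
      simpa [Real.dist_eq] using hφ d a b).continuous
  have hbd : ∀ t : B, ∀ᵐ d ∂μ, |Z d ⬝ᵥ (t : K → ℝ)| ≤ m * Real.sqrt q * Real.sqrt q := by
    intro t
    filter_upwards [hm] with d hd
    exact abs_dotProduct_le hm0.le (Real.sqrt_nonneg q) hd hq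
      (by rw [Real.sq_sqrt hq0.le]; exact t.2)
  have hcont : ∀ z : Fin n → E, Continuous fun t : B => penalizedDeviation μ Z φ β δ z t := by
    intro z
    refine Continuous.sub (Continuous.sub ?_ ?_) (continuous_const.mul ?_)
    · exact continuous_const.mul
        (continuous_finsetSum _ fun i _ => (hφc _).comp (hdot _))
    · refine continuous_of_dominated (bound := fun _ => m * Real.sqrt q * Real.sqrt q)
        (fun t => (hφm t).aestronglyMeasurable) (fun t => ?_) (integrable_const _)
        (ae_of_all _ fun d => (hφc d).comp (hdot d))
      filter_upwards [hbd t] with d hd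
      have := hφ d (Z d ⬝ᵥ t) 0
      rw [hφ0, sub_zero, sub_zero] at this
      exact this.trans hd
    · refine continuous_of_dominated (bound := fun _ => δ * (m * Real.sqrt q * Real.sqrt q))
        (fun t => ((continuous_huber δ).measurable.comp
          (measurable_dotProduct_const hZ t)).aestronglyMeasurable) (fun t => ?_)
        (integrable_const _) (ae_of_all _ fun d => (continuous_huber δ).comp (hdot d))
      filter_upwards [hbd t] with d hd
      rw [Real.norm_of_nonneg (huber_nonneg hδ.le _)]
      exact (min_le_right _ _).trans (by gcongr)
  -- The deviation is continuous in `t` and the inequality is strict, so a dense sequence detects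
  -- the event. Its initial segments give increasing sets, along which the measure is continuous
  -- even without measurability.
  let A : ℕ → Set (Fin n → E) := fun N =>
    {z | ∃ i : Fin N, 2 * x ≤ penalizedDeviation μ Z φ β δ z (u i : K → ℝ)}
  have hsub : {z : Fin n → E | ∃ t, t ⬝ᵥ t ≤ q ∧ 2 * x < penalizedDeviation μ Z φ β δ z t} ⊆
      ⋃ N, A N := by
    rintro z ⟨t, htq, ht⟩
    obtain ⟨s, hs⟩ := (TopologicalSpace.denseRange_denseSeq B).exists_mem_open
      (isOpen_lt continuous_const (hcont z)) ⟨⟨t, htq⟩, ht⟩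
    have hs' : 2 * x < penalizedDeviation μ Z φ β δ z (u s : K → ℝ) := hs
    exact mem_iUnion.mpr ⟨s + 1, ⟨s, s.lt_succ_self⟩, hs'.le⟩
  have hmono : Monotone A := by
    rintro N N' h z ⟨i, hi⟩
    exact ⟨⟨i, i.2.trans_le h⟩, hi⟩
  have hle : Q (⋃ N, A N) ≤ ENNReal.ofReal (excessBound m q c β δ x n) := by
    rw [hmono.measure_iUnion]
    refine iSup_le fun N => ?_
    rw [ENNReal.le_ofReal_iff_toReal_le (measure_ne_top _ _)]
    · exact real_penalizedDeviation_le_of_finite hZ hm hm0 hq hq0 hc hA hβ hδ hφ hφ0 hφm hx hn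
        (fun i : Fin N => (u i : K → ℝ)) fun i => (u i).2
    · unfold excessBound
      have : 0 < min 1 (β * δ / 4) := lt_min one_pos (by positivity)
      positivity
  refine ENNReal.toReal_le_of_le_ofReal ?_ ((measure_mono hsub).trans hle)
  unfold excessBound
  have : 0 < min 1 (β * δ / 4) := lt_min one_pos (by positivity)
  positivity

end UniformDeviation

end CPC

namespace CPC

/-! ### The check loss, Knight's remainder, and a Lipschitz majorant of crossings. -/

section Losses

theorem measurable_psi (w : ℝ) : Measurable (psi w) := by
  unfold psi
  exact measurable_const.sub
    (Measurable.ite measurableSet_Iic measurable_const measurable_const)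

theorem checkLoss_eq_mul_psi (w u : ℝ) : checkLoss w u = u * psi w u := rfl

theorem measurable_checkLoss (w : ℝ) : Measurable (checkLoss w) := by
  simp only [funext (checkLoss_eq_mul_psi w)]
  exact measurable_id.mul (measurable_psi w)

theorem abs_psi_le_one {w : ℝ} (hw : w ∈ Ioo (0 : ℝ) 1) (u : ℝ) : |psi w u| ≤ 1 := by
  unfold psi
  rw [abs_le]
  split_ifs <;> constructor <;> linarith [hw.1, hw.2]

theorem abs_psi_sub_psi_le_one (w u v : ℝ) : |psi w u - psi w v| ≤ 1 := by
  unfold psi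
  rw [abs_le]
  split_ifs <;> constructor <;> linarith

theorem checkLoss_eq_max {w : ℝ} (u : ℝ) :
    checkLoss w u = max (w * u) ((w - 1) * u) := by
  unfold checkLoss
  split_ifs with h
  · rw [max_eq_right (by linarith)]; ring
  · rw [max_eq_left (by linarith)]; ring

theorem abs_checkLoss_sub_le {w : ℝ} (hw : w ∈ Ioo (0 : ℝ) 1) (u v : ℝ) :
    |checkLoss w u - checkLoss w v| ≤ |u - v| := by
  obtain ⟨h0, h1⟩ := hw
  rw [checkLoss_eq_max, checkLoss_eq_max]
  refine (abs_max_sub_max_le_max _ _ _ _).trans (max_le ?_ ?_)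
  · rw [← mul_sub, abs_mul, abs_of_pos h0]
    exact mul_le_of_le_one_left (abs_nonneg _) h1.le
  · rw [← mul_sub, abs_mul, abs_of_neg (by linarith)]
    exact mul_le_of_le_one_left (abs_nonneg _) (by linarith)

theorem checkLoss_convex {w l : ℝ} (hl0 : 0 ≤ l) (hl1 : l ≤ 1) (u v : ℝ) :
    checkLoss w ((1 - l) * u + l * v) ≤ (1 - l) * checkLoss w u + l * checkLoss w v := by
  simp only [checkLoss_eq_max]
  have h1 := le_max_left (w * u) ((w - 1) * u)
  have h2 := le_max_right (w * u) ((w - 1) * u)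
  have h3 := le_max_left (w * v) ((w - 1) * v)
  have h4 := le_max_right (w * v) ((w - 1) * v)
  have h5 : 0 ≤ 1 - l := by linarith
  refine max_le ?_ ?_
  · nlinarith [mul_le_mul_of_nonneg_left h1 h5, mul_le_mul_of_nonneg_left h3 hl0]
  · nlinarith [mul_le_mul_of_nonneg_left h2 h5, mul_le_mul_of_nonneg_left h4 hl0]

/-- The remainder of the first-order expansion of the check loss (Knight's identity). -/
noncomputable def knight (w e x : ℝ) : ℝ := checkLoss w (e - x) - checkLoss w e + x * psi w e

theorem knight_nonneg (w e x : ℝ) : 0 ≤ knight w e x := by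
  unfold knight checkLoss psi
  split_ifs <;> nlinarith

theorem knight_le (w e x : ℝ) : knight w e x ≤ if |e| ≤ |x| then |x| else 0 := by
  unfold knight checkLoss psi
  rcases abs_cases e with ⟨h1, h1'⟩ | ⟨h1, h1'⟩ <;>
  rcases abs_cases x with ⟨h2, h2'⟩ | ⟨h2, h2'⟩ <;> rw [h1, h2] <;>
  split_ifs <;> nlinarith

/-- The remainder equals `x - e` for residuals between `0` and `x`, hence is at least `x / 2` on
half of that interval; this yields the curvature. -/
theorem le_knight_of_pos {w e x : ℝ} (he : 0 < e) (hex : e ≤ x / 2) : x / 2 ≤ knight w e x := by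
  unfold knight checkLoss psi
  rw [if_pos (by linarith), if_neg (by linarith)]
  nlinarith

theorem le_knight_of_neg {w e x : ℝ} (hx : x < 0) (he : e ≤ 0) (hex : x / 2 < e) :
    -x / 2 ≤ knight w e x := by
  unfold knight checkLoss psi
  rw [if_neg (by linarith), if_pos he]
  nlinarith

/-- A continuous majorant of the indicator of `|e| ≤ |x|`. -/
noncomputable def ramp (s e x : ℝ) : ℝ := max 0 (min 1 ((|x| - |e|) / s + 1))

theorem ramp_nonneg (s e x : ℝ) : 0 ≤ ramp s e x := le_max_left _ _

theorem ramp_le_one (s e x : ℝ) : ramp s e x ≤ 1 := max_le zero_le_one (min_le_left _ _)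

theorem one_le_ramp {s e x : ℝ} (hs : 0 < s) (h : |e| ≤ |x|) : 1 ≤ ramp s e x := by
  refine le_max_of_le_right (le_min le_rfl ?_)
  have : 0 ≤ (|x| - |e|) / s := div_nonneg (by linarith) hs.le
  linarith

theorem ramp_eq_zero {s e x : ℝ} (hs : 0 < s) (h : |x| + s < |e|) : ramp s e x = 0 := by
  refine max_eq_left (min_le_of_right_le ?_)
  have : (|x| - |e|) / s ≤ -1 := by rw [div_le_iff₀ hs]; linarith
  linarith

/-- The ramp has slope `1 / s`; multiplied by `s` it meets the Lipschitz requirement of the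
deviation bound. -/
theorem mul_abs_ramp_sub_le {s : ℝ} (hs : 0 < s) (e x y : ℝ) :
    s * |ramp s e x - ramp s e y| ≤ |x - y| := by
  have h1 : |ramp s e x - ramp s e y| ≤ |((|x| - |e|) / s + 1) - ((|y| - |e|) / s + 1)| := by
    unfold ramp
    refine (abs_max_sub_max_le_max _ _ _ _).trans (max_le (by simp) ?_)
    exact (abs_min_sub_min_le_max _ _ _ _).trans (by simp)
  have h2 : ((|x| - |e|) / s + 1) - ((|y| - |e|) / s + 1) = (|x| - |y|) / s := by ring
  rw [h2, abs_div, abs_of_pos hs, le_div_iff₀ hs] at h1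
  rw [mul_comm]
  exact h1.trans (abs_abs_sub_abs_le _ _)

theorem measurable_ramp (s : ℝ) : Measurable fun p : ℝ × ℝ => ramp s p.1 p.2 := by
  unfold ramp
  fun_prop

/-- In the quadratic regime `|x| ≤ s + x² / s`; in the linear one `s ≤ δ ≤ |x|` makes `huber δ x /
s` at least `δ`. -/
theorem min_abs_add_le {δ s : ℝ} (hs : 0 < s) (hsδ : s ≤ δ) (x : ℝ) :
    min (|x| + s) δ ≤ 2 * s + huber δ x / s := by
  have hδ : 0 < δ := hs.trans_le hsδ
  rcases le_total |x| δ with h | h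
  · have e : huber δ x = |x| ^ 2 := by
      rw [huber, ← sq_abs, min_eq_left]
      nlinarith [abs_nonneg x]
    refine (min_le_left _ _).trans ?_
    have : |x| - s ≤ |x| ^ 2 / s := by
      rw [le_div_iff₀ hs]; nlinarith [sq_nonneg (|x| - s), abs_nonneg x]
    rw [e]; linarith
  · have e : huber δ x = δ * |x| := by
      rw [huber, ← sq_abs, min_eq_right]
      nlinarith [abs_nonneg x]
    refine (min_le_right _ _).trans ?_
    have : δ ≤ δ * |x| / s := by
      rw [le_div_iff₀ hs]; exact mul_le_mul_of_nonneg_left (hsδ.trans h) hδ.le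
    rw [e]; linarith

end Losses

/-! ### Consequences of a regular conditional density: small balls and curvature. -/

section Density

variable {E K : Type*} [MeasurableSpace E] [Fintype K] {μ : Measure E} [IsProbabilityMeasure μ]
  {U : E → ℝ} {Z : E → K → ℝ}

theorem lintegral_of_isCondDensity {f : (K → ℝ) → ℝ → ℝ} (hf : IsCondDensity μ U Z f)
    (hU : Measurable U) (hZ : Measurable Z) {G : (K → ℝ) → ℝ → ENNReal}
    (hG : Measurable (Function.uncurry G)) :
    ∫⁻ d, G (Z d) (U d) ∂μ =
      ∫⁻ z, ∫⁻ u, ENNReal.ofReal (f z u) * G z u ∂volume ∂(μ.map Z) := by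
  have := Measure.isProbabilityMeasure_map (μ := μ) hZ.aemeasurable
  have hfm : Measurable fun v : (K → ℝ) × ℝ => ENNReal.ofReal (f v.1 v.2) :=
    hf.1.ennreal_ofReal
  have h1 : ∫⁻ d, G (Z d) (U d) ∂μ =
      ∫⁻ v, Function.uncurry G v ∂(μ.map fun d => (Z d, U d)) :=
    (lintegral_map hG (hZ.prodMk hU)).symm
  rw [h1, hf.2.2, lintegral_withDensity_eq_lintegral_mul _ hfm hG,
    lintegral_prod _ (hfm.mul hG).aemeasurable]
  rfl

/-- Normalization is not part of `IsCondDensity`; testing the joint law against sets of `z` alone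
forces it. -/
theorem ae_lintegral_condDensity_eq_one {f : (K → ℝ) → ℝ → ℝ} (hf : IsCondDensity μ U Z f)
    (hU : Measurable U) (hZ : Measurable Z) :
    ∀ᵐ z ∂(μ.map Z), ∫⁻ u, ENNReal.ofReal (f z u) = 1 := by
  have := Measure.isProbabilityMeasure_map (μ := μ) hZ.aemeasurable
  have hfm : Measurable fun v : (K → ℝ) × ℝ => ENNReal.ofReal (f v.1 v.2) :=
    hf.1.ennreal_ofReal
  refine ae_eq_of_forall_setLIntegral_eq_of_sigmaFinite (g := fun _ => 1)
    hfm.lintegral_prod_right' measurable_const fun s hs _ => ?_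
  have hG : Measurable (Function.uncurry fun (z : K → ℝ) (_ : ℝ) =>
      s.indicator (fun _ => (1 : ENNReal)) z) :=
    (measurable_const.indicator hs).comp measurable_fst
  have h := lintegral_of_isCondDensity hf hU hZ hG
  have h2 : ∫⁻ d, s.indicator (fun _ => (1 : ENNReal)) (Z d) ∂μ = μ.map Z s := by
    rw [← lintegral_map (measurable_const.indicator hs) hZ, lintegral_indicator hs]
    simp
  rw [h2] at h
  rw [setLIntegral_const, one_mul, h, ← lintegral_indicator hs]
  refine lintegral_congr fun z => ?_
  by_cases hz : z ∈ s <;> simp [hz]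

/-- A Lipschitz function varies by at most `2 L δ` on the interval, and its mean there is at most `1
/ (2 δ)` because the total mass is one. -/
theorem condDensity_le {f : ℝ → ℝ} {c L δ : ℝ} (hL : 0 ≤ L) (hδ : 0 < δ)
    (h1 : ∫⁻ u, ENNReal.ofReal (f u) = 1)
    (hlip : ∀ u ∈ Icc (c - δ) (c + δ), ∀ v ∈ Icc (c - δ) (c + δ), |f u - f v| ≤ L * |u - v|)
    {u : ℝ} (hu : u ∈ Icc (c - δ) (c + δ)) : f u ≤ 1 / (2 * δ) + 2 * L * δ := by
  have h2 : ENNReal.ofReal (f u - 2 * L * δ) * ENNReal.ofReal (2 * δ) ≤ 1 := by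
    calc ENNReal.ofReal (f u - 2 * L * δ) * ENNReal.ofReal (2 * δ)
        = ∫⁻ _v in Icc (c - δ) (c + δ), ENNReal.ofReal (f u - 2 * L * δ) := by
          rw [setLIntegral_const, Real.volume_Icc]
          congr 2
          ring
      _ ≤ ∫⁻ v in Icc (c - δ) (c + δ), ENNReal.ofReal (f v) := by
          refine setLIntegral_mono' measurableSet_Icc fun v hv => ENNReal.ofReal_le_ofReal ?_
          have h3 := (le_abs_self _).trans (hlip u hu v hv)
          have h4 : |u - v| ≤ 2 * δ := by
            rw [abs_le]; constructor <;> linarith [hu.1, hu.2, hv.1, hv.2]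
          nlinarith [mul_le_mul_of_nonneg_left h4 hL]
      _ ≤ _ := (setLIntegral_le_lintegral _ _).trans_eq h1
  rw [← ENNReal.ofReal_mul' (by positivity), ENNReal.ofReal_le_one] at h2
  rw [← sub_le_iff_le_add, le_div_iff₀ (by positivity)]
  exact h2

/-- Small ball upper bound from a regular conditional density. -/
theorem measure_abs_sub_le_of_regular {a : K → ℝ} {L δ b : ℝ} (hL : 0 ≤ L) (hδ : 0 < δ)
    (h : HasRegularCondDensity μ U Z a L δ b) (hU : Measurable U) (hZ : Measurable Z)
    {r : (K → ℝ) → ℝ} (hr : Measurable r) :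
    μ {d | |U d - Z d ⬝ᵥ a| ≤ r (Z d)} ≤
      ∫⁻ d, ENNReal.ofReal ((1 / δ + 4 * L * δ) * min (r (Z d)) δ) ∂μ := by
  obtain ⟨f, hf, hreg⟩ := h
  have hdot : Measurable fun z : K → ℝ => z ⬝ᵥ a := measurable_dotProduct_const measurable_id a
  let s : Set ((K → ℝ) × ℝ) := {v | |v.2 - v.1 ⬝ᵥ a| ≤ r v.1}
  have hs : MeasurableSet s := measurableSet_le
    (measurable_snd.sub (hdot.comp measurable_fst)).abs (hr.comp measurable_fst)
  have hG : Measurable (Function.uncurry fun (z : K → ℝ) (u : ℝ) =>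
      s.indicator (fun _ => (1 : ENNReal)) (z, u)) := measurable_const.indicator hs
  have e := lintegral_of_isCondDensity hf hU hZ hG
  have e2 : ∫⁻ d, s.indicator (fun _ => (1 : ENNReal)) (Z d, U d) ∂μ =
      μ {d | |U d - Z d ⬝ᵥ a| ≤ r (Z d)} := by
    have hs' : MeasurableSet {d | |U d - Z d ⬝ᵥ a| ≤ r (Z d)} := (hZ.prodMk hU) hs
    rw [← lintegral_indicator_one hs']
    rfl
  have hR : Measurable fun z => ENNReal.ofReal ((1 / δ + 4 * L * δ) * min (r z) δ) :=
    ((hr.min measurable_const).const_mul _).ennreal_ofReal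
  rw [← e2, e, ← lintegral_map hR hZ]
  refine lintegral_mono_ae ?_
  filter_upwards [hreg, ae_lintegral_condDensity_eq_one hf hU hZ] with z hz h1
  have hrw : ∀ u, ENNReal.ofReal (f z u) * s.indicator (fun _ => (1 : ENNReal)) (z, u) =
      (Icc (z ⬝ᵥ a - r z) (z ⬝ᵥ a + r z)).indicator (fun u => ENNReal.ofReal (f z u)) u := by
    intro u
    by_cases hu : (z, u) ∈ s
    · have : u ∈ Icc (z ⬝ᵥ a - r z) (z ⬝ᵥ a + r z) := by
        have := abs_le.mp (show |u - z ⬝ᵥ a| ≤ r z from hu)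
        constructor <;> linarith [this.1, this.2]
      simp [hu, this]
    · have : u ∉ Icc (z ⬝ᵥ a - r z) (z ⬝ᵥ a + r z) := by
        intro hu'
        exact hu (show |u - z ⬝ᵥ a| ≤ r z from
          abs_le.mpr ⟨by linarith [hu'.1], by linarith [hu'.2]⟩)
      simp [hu, this]
  simp only [hrw]
  rw [lintegral_indicator measurableSet_Icc]
  -- For `r z ≤ δ` the density bound holds on the whole interval. Beyond that the right side is at
  -- least one, while the conditional mass is at most one.
  rcases le_total (r z) δ with hrδ | hrδ
  · calc _ ≤ ∫⁻ _u in Icc (z ⬝ᵥ a - r z) (z ⬝ᵥ a + r z),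
          ENNReal.ofReal (1 / (2 * δ) + 2 * L * δ) := by
          refine setLIntegral_mono' measurableSet_Icc fun u hu => ENNReal.ofReal_le_ofReal ?_
          exact condDensity_le hL hδ h1 hz.1 ⟨by linarith [hu.1], by linarith [hu.2]⟩
      _ = _ := by
          rw [setLIntegral_const, Real.volume_Icc, ← ENNReal.ofReal_mul (by positivity),
            min_eq_left hrδ]
          congr 1
          field_simp
          ring
  · refine ((setLIntegral_le_lintegral _ _).trans_eq h1).trans ?_
    rw [min_eq_right hrδ, ENNReal.one_le_ofReal, add_mul]
    have : 1 / δ * δ = 1 := by field_simp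
    rw [this]
    have : 0 ≤ 4 * L * δ * δ := by positivity
    linarith

theorem measurable_knight (w : ℝ) : Measurable fun p : ℝ × ℝ => knight w p.1 p.2 := by
  unfold knight
  exact (((measurable_checkLoss w).comp (measurable_fst.sub measurable_snd)).sub
    ((measurable_checkLoss w).comp measurable_fst)).add
    (measurable_snd.mul ((measurable_psi w).comp measurable_fst))

/-- Curvature of the population check loss from a regular conditional density. -/
theorem lintegral_huber_le_knight {a : K → ℝ} {L δ b : ℝ} (hδ : 0 < δ) (hb : 0 < b)
    (h : HasRegularCondDensity μ U Z a L δ b) (hU : Measurable U) (hZ : Measurable Z)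
    (w : ℝ) (t : K → ℝ) :
    ∫⁻ d, ENNReal.ofReal (b / 4 * huber δ (Z d ⬝ᵥ t)) ∂μ ≤
      ∫⁻ d, ENNReal.ofReal (knight w (U d - Z d ⬝ᵥ a) (Z d ⬝ᵥ t)) ∂μ := by
  obtain ⟨f, hf, hreg⟩ := h
  have hdot : ∀ t : K → ℝ, Measurable fun z : K → ℝ => z ⬝ᵥ t :=
    measurable_dotProduct_const measurable_id
  have hG : Measurable (Function.uncurry fun (z : K → ℝ) (u : ℝ) =>
      ENNReal.ofReal (knight w (u - z ⬝ᵥ a) (z ⬝ᵥ t))) :=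
    ((measurable_knight w).comp ((measurable_snd.sub ((hdot a).comp measurable_fst)).prodMk
      ((hdot t).comp measurable_fst))).ennreal_ofReal
  have hR : Measurable fun z : K → ℝ => ENNReal.ofReal (b / 4 * huber δ (z ⬝ᵥ t)) :=
    (((continuous_huber δ).measurable.comp (hdot t)).const_mul _).ennreal_ofReal
  rw [lintegral_of_isCondDensity hf hU hZ hG, ← lintegral_map hR hZ]
  refine lintegral_mono_ae ?_
  filter_upwards [hreg] with z hz
  set x := z ⬝ᵥ t
  set c := z ⬝ᵥ a
  set k := min |x| δ with hk
  have hkx : k ≤ |x| := min_le_left _ _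
  have hkδ : k ≤ δ := min_le_right _ _
  have hk0 : 0 ≤ k := le_min (abs_nonneg _) hδ.le
  have hhub : huber δ x = |x| * k := by
    rw [huber, hk, mul_min_of_nonneg _ _ (abs_nonneg x), ← sq, sq_abs, mul_comm δ]
  -- Only an interval of length `k / 2` next to `c` on the side of `x` is kept: there the density is
  -- at least `b` and the remainder at least `|x| / 2`, and `b * (|x| / 2) * (k / 2)` is `b / 4 *
  -- huber δ x`.
  have aux : ∀ I : Set ℝ, MeasurableSet I → volume I = ENNReal.ofReal (k / 2) →
      (∀ u ∈ I, u ∈ Icc (c - δ) (c + δ) ∧ |x| / 2 ≤ knight w (u - c) x) →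
      ENNReal.ofReal (b / 4 * huber δ x) ≤
        ∫⁻ u, ENNReal.ofReal (f z u) * ENNReal.ofReal (knight w (u - c) x) := by
    intro I hI hvol hIk
    calc ENNReal.ofReal (b / 4 * huber δ x)
        = ∫⁻ _u in I, ENNReal.ofReal (b * (|x| / 2)) := by
          rw [setLIntegral_const, hvol, ← ENNReal.ofReal_mul (by positivity), hhub]
          congr 1
          ring
      _ ≤ ∫⁻ u in I, ENNReal.ofReal (f z u) * ENNReal.ofReal (knight w (u - c) x) := by
          refine setLIntegral_mono' hI fun u hu => ?_
          rw [← ENNReal.ofReal_mul (hf.2.1 z u)]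
          exact ENNReal.ofReal_le_ofReal (mul_le_mul (hz.2 u (hIk u hu).1) (hIk u hu).2
            (by positivity) (hf.2.1 z u))
      _ ≤ _ := setLIntegral_le_lintegral _ _
  rcases lt_trichotomy x 0 with hx | hx | hx
  · have hax : |x| = -x := abs_of_neg hx
    refine aux (Ioc (c - k / 2) c) measurableSet_Ioc (by rw [Real.volume_Ioc]; congr 1; ring)
      fun u hu => ⟨⟨by linarith [hu.1], by linarith [hu.2]⟩, ?_⟩
    rw [hax]
    exact le_knight_of_neg hx (by linarith [hu.2]) (by linarith [hu.1])
  · simp [hx, huber]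
  · have hax : |x| = x := abs_of_pos hx
    refine aux (Ioc c (c + k / 2)) measurableSet_Ioc (by rw [Real.volume_Ioc]; congr 1; ring)
      fun u hu => ⟨⟨by linarith [hu.1], by linarith [hu.2]⟩, ?_⟩
    rw [hax]
    exact le_knight_of_pos (by linarith [hu.1]) (by linarith [hu.2])

variable {m : ℝ}

theorem integrable_knight (hU : Measurable U) (hZ : Measurable Z)
    (hm : ∀ᵐ d ∂μ, ∀ k, |Z d k| ≤ m) (w : ℝ) (a t : K → ℝ) :
    Integrable (fun d => knight w (U d - Z d ⬝ᵥ a) (Z d ⬝ᵥ t)) μ := by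
  refine (integrable_dotProduct hZ hm t).abs.mono' ((measurable_knight w).comp
    ((hU.sub (measurable_dotProduct_const hZ a)).prodMk
      (measurable_dotProduct_const hZ t))).aestronglyMeasurable (ae_of_all _ fun d => ?_)
  rw [Real.norm_of_nonneg (knight_nonneg _ _ _)]
  refine (knight_le _ _ _).trans ?_
  split_ifs
  · exact le_rfl
  · exact abs_nonneg _

theorem integrable_dotProduct_mul_psi (hU : Measurable U) (hZ : Measurable Z)
    (hm : ∀ᵐ d ∂μ, ∀ k, |Z d k| ≤ m) {w : ℝ} (hw : w ∈ Ioo (0 : ℝ) 1) (a t : K → ℝ) :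
    Integrable (fun d => (Z d ⬝ᵥ t) * psi w (U d - Z d ⬝ᵥ a)) μ :=
  (integrable_dotProduct hZ hm t).mul_bdd (c := 1)
    ((measurable_psi w).comp (hU.sub (measurable_dotProduct_const hZ a))).aestronglyMeasurable
    (ae_of_all _ fun _ => abs_psi_le_one hw _)

theorem checkLoss_sub_eq_knight (w e x : ℝ) :
    checkLoss w (e - x) - checkLoss w e = knight w e x - x * psi w e := by
  unfold knight; ring

/-- First-order optimality of the population quantile regression coefficient. -/
theorem integral_dotProduct_mul_psi_nonpos {a : K → ℝ} {L δ b : ℝ} (hL : 0 ≤ L) (hδ : 0 < δ)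
    (h : HasRegularCondDensity μ U Z a L δ b) (hU : Measurable U) (hZ : Measurable Z)
    (hm : ∀ᵐ d ∂μ, ∀ k, |Z d k| ≤ m) {w : ℝ} (hw : w ∈ Ioo (0 : ℝ) 1)
    (hpop : IsPopQuantileCoef μ w U Z a) (t : K → ℝ) :
    ∫ d, (Z d ⬝ᵥ t) * psi w (U d - Z d ⬝ᵥ a) ∂μ ≤ 0 := by
  set B := |m * ∑ k, (|t k|)| with hB
  have hB0 : 0 ≤ B := abs_nonneg _
  have hbd : ∀ᵐ d ∂μ, |Z d ⬝ᵥ t| ≤ B := by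
    filter_upwards [ae_abs_dotProduct_le hm t] with d hd using hd.trans (le_abs_self _)
  set C := 1 / δ + 4 * L * δ with hC
  have hC0 : 0 < C := by positivity
  -- Perturb `a` by `l t`. The Knight remainder is at most `l B` and vanishes unless `|U - Zᵀ a| ≤ l
  -- B`, an event of probability `O(l)`, so it is `O(l²)`; dividing by `l` and letting `l` tend to
  -- zero gives the claim.
  have key : ∀ l : ℝ, 0 < l → ∫ d, (Z d ⬝ᵥ t) * psi w (U d - Z d ⬝ᵥ a) ∂μ ≤ l * (B * B * C) := by
    intro l hl
    have h0 := hpop (a + l • t)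
    have e : ∀ d, checkLoss w (U d - Z d ⬝ᵥ (a + l • t)) - checkLoss w (U d - Z d ⬝ᵥ a) =
        knight w (U d - Z d ⬝ᵥ a) (Z d ⬝ᵥ (l • t)) -
          l * ((Z d ⬝ᵥ t) * psi w (U d - Z d ⬝ᵥ a)) := by
      intro d
      rw [dotProduct_add, ← sub_sub, checkLoss_sub_eq_knight, dotProduct_smul, smul_eq_mul,
        mul_assoc]
    simp only [e] at h0
    rw [integral_sub (integrable_knight hU hZ hm w a _)
      ((integrable_dotProduct_mul_psi hU hZ hm hw a t).const_mul l), integral_const_mul] at h0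
    have hs : MeasurableSet {d | |U d - Z d ⬝ᵥ a| ≤ l * B} :=
      measurableSet_le (hU.sub (measurable_dotProduct_const hZ a)).abs measurable_const
    have h1 : μ.real {d | |U d - Z d ⬝ᵥ a| ≤ l * B} ≤ C * (l * B) := by
      refine ENNReal.toReal_le_of_le_ofReal (by positivity) ?_
      refine (measure_abs_sub_le_of_regular hL hδ h hU hZ (r := fun _ => l * B)
        measurable_const).trans ?_
      rw [lintegral_const, measure_univ, mul_one]
      exact ENNReal.ofReal_le_ofReal (mul_le_mul_of_nonneg_left (min_le_left _ _) hC0.le)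
    have h2 : ∫ d, knight w (U d - Z d ⬝ᵥ a) (Z d ⬝ᵥ (l • t)) ∂μ ≤ l * B * (C * (l * B)) := by
      calc _ ≤ ∫ d, {d | |U d - Z d ⬝ᵥ a| ≤ l * B}.indicator (fun _ => l * B) d ∂μ := by
            refine integral_mono_ae (integrable_knight hU hZ hm w a _)
              ((integrable_const _).indicator hs) ?_
            filter_upwards [hbd] with d hd
            refine (knight_le _ _ _).trans ?_
            have hle : |Z d ⬝ᵥ (l • t)| ≤ l * B := by
              rw [dotProduct_smul, smul_eq_mul, abs_mul, abs_of_pos hl]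
              gcongr
            split_ifs with hd2
            · rw [indicator_of_mem (show d ∈ {d | |U d - Z d ⬝ᵥ a| ≤ l * B} from hd2.trans hle)]
              exact hle
            · exact indicator_nonneg (fun _ _ => by positivity) _
        _ = l * B * μ.real {d | |U d - Z d ⬝ᵥ a| ≤ l * B} := by
            rw [integral_indicator_const _ hs, smul_eq_mul, mul_comm]
        _ ≤ _ := by gcongr
    have h3 : l * ∫ d, (Z d ⬝ᵥ t) * psi w (U d - Z d ⬝ᵥ a) ∂μ ≤ l * (l * (B * B * C)) := by
      linarith
    exact le_of_mul_le_mul_left h3 hl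
  refine le_of_forall_pos_le_add fun ε hε => ?_
  have hpos : 0 < B * B * C + 1 := by positivity
  refine (key (ε / (B * B * C + 1)) (by positivity)).trans ?_
  rw [zero_add, div_mul_eq_mul_div, div_le_iff₀ hpos]
  nlinarith

/-- Quadratic-linear lower bound of the excess risk of quantile regression. -/
theorem mul_integral_huber_le_excess_risk {a : K → ℝ} {L δ b : ℝ} (hL : 0 ≤ L) (hδ : 0 < δ)
    (hb : 0 < b) (h : HasRegularCondDensity μ U Z a L δ b) (hU : Measurable U)
    (hZ : Measurable Z) (hm : ∀ᵐ d ∂μ, ∀ k, |Z d k| ≤ m) {w : ℝ} (hw : w ∈ Ioo (0 : ℝ) 1)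
    (hpop : IsPopQuantileCoef μ w U Z a) (t : K → ℝ) :
    b / 4 * ∫ d, huber δ (Z d ⬝ᵥ t) ∂μ ≤
      ∫ d, (checkLoss w (U d - Z d ⬝ᵥ a - Z d ⬝ᵥ t) - checkLoss w (U d - Z d ⬝ᵥ a)) ∂μ := by
  simp only [checkLoss_sub_eq_knight]
  rw [integral_sub (integrable_knight hU hZ hm w a t)
    (integrable_dotProduct_mul_psi hU hZ hm hw a t)]
  have h1 := integral_dotProduct_mul_psi_nonpos hL hδ h hU hZ hm hw hpop t
  have hk := integrable_knight hU hZ hm w a t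
  have h2 : b / 4 * ∫ d, huber δ (Z d ⬝ᵥ t) ∂μ ≤
      ∫ d, knight w (U d - Z d ⬝ᵥ a) (Z d ⬝ᵥ t) ∂μ := by
    rw [← integral_const_mul]
    have hh : Measurable fun d => b / 4 * huber δ (Z d ⬝ᵥ t) :=
      ((continuous_huber δ).measurable.comp (measurable_dotProduct_const hZ t)).const_mul _
    rw [integral_eq_lintegral_of_nonneg_ae
      (ae_of_all _ fun d => mul_nonneg (by positivity) (huber_nonneg hδ.le _))
      hh.aestronglyMeasurable, integral_eq_lintegral_of_nonneg_ae
      (ae_of_all _ fun d => knight_nonneg _ _ _) hk.aestronglyMeasurable]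
    refine ENNReal.toReal_mono ?_ (lintegral_huber_le_knight hδ hb h hU hZ w t)
    exact hk.lintegral_lt_top.ne
  linarith

/-- The expected ramp is controlled by the Huber-type distance. -/
theorem integral_ramp_le {a : K → ℝ} {L δ b : ℝ} (hL : 0 ≤ L) (hδ : 0 < δ)
    (h : HasRegularCondDensity μ U Z a L δ b) (hU : Measurable U)
    (hZ : Measurable Z) (hm : ∀ᵐ d ∂μ, ∀ k, |Z d k| ≤ m) {s : ℝ} (hs : 0 < s) (hsδ : s ≤ δ)
    (t : K → ℝ) :
    ∫ d, ramp s (U d - Z d ⬝ᵥ a) (Z d ⬝ᵥ t) ∂μ ≤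
      (1 / δ + 4 * L * δ) * (2 * s + (∫ d, huber δ (Z d ⬝ᵥ t) ∂μ) / s) := by
  set C := 1 / δ + 4 * L * δ with hC
  have hC0 : 0 < C := by positivity
  have hZt := measurable_dotProduct_const hZ t
  have hmr : Measurable fun d => ramp s (U d - Z d ⬝ᵥ a) (Z d ⬝ᵥ t) :=
    (measurable_ramp s).comp ((hU.sub (measurable_dotProduct_const hZ a)).prodMk hZt)
  have hh : Integrable (fun d => huber δ (Z d ⬝ᵥ t)) μ := by
    refine ((integrable_dotProduct hZ hm t).abs.const_mul δ).mono'
      ((continuous_huber δ).measurable.comp hZt).aestronglyMeasurable (ae_of_all _ fun d => ?_)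
    rw [Real.norm_of_nonneg (huber_nonneg hδ.le _)]
    exact min_le_right _ _
  have hH : 0 ≤ ∫ d, huber δ (Z d ⬝ᵥ t) ∂μ := integral_nonneg fun d => huber_nonneg hδ.le _
  rw [integral_eq_lintegral_of_nonneg_ae (ae_of_all _ fun d => ramp_nonneg _ _ _)
    hmr.aestronglyMeasurable]
  refine ENNReal.toReal_le_of_le_ofReal (by positivity) ?_
  have hr : Measurable fun z : K → ℝ => |z ⬝ᵥ t| + s :=
    (measurable_dotProduct_const measurable_id t).abs.add_const s
  have hS : MeasurableSet {d | |U d - Z d ⬝ᵥ a| ≤ |Z d ⬝ᵥ t| + s} :=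
    measurableSet_le (hU.sub (measurable_dotProduct_const hZ a)).abs (hZt.abs.add_const s)
  have hi : Integrable (fun d => C * (2 * s + huber δ (Z d ⬝ᵥ t) / s)) μ :=
    ((integrable_const _).add (hh.div_const s)).const_mul C
  calc _ ≤ ∫⁻ d, {d | |U d - Z d ⬝ᵥ a| ≤ |Z d ⬝ᵥ t| + s}.indicator 1 d ∂μ := by
        refine lintegral_mono fun d => ?_
        by_cases hd : |U d - Z d ⬝ᵥ a| ≤ |Z d ⬝ᵥ t| + s
        · rw [indicator_of_mem (show d ∈ {d | |U d - Z d ⬝ᵥ a| ≤ |Z d ⬝ᵥ t| + s} from hd)]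
          simpa using ramp_le_one _ _ _
        · rw [ramp_eq_zero hs (not_le.mp hd)]
          simp
    _ = μ {d | |U d - Z d ⬝ᵥ a| ≤ |Z d ⬝ᵥ t| + s} := lintegral_indicator_one hS
    _ ≤ ∫⁻ d, ENNReal.ofReal (C * min (|Z d ⬝ᵥ t| + s) δ) ∂μ :=
        measure_abs_sub_le_of_regular hL hδ h hU hZ hr
    _ ≤ ∫⁻ d, ENNReal.ofReal (C * (2 * s + huber δ (Z d ⬝ᵥ t) / s)) ∂μ :=
        lintegral_mono fun d => ENNReal.ofReal_le_ofReal
          (mul_le_mul_of_nonneg_left (min_abs_add_le hs hsδ _) hC0.le)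
    _ = ENNReal.ofReal (∫ d, C * (2 * s + huber δ (Z d ⬝ᵥ t) / s) ∂μ) := by
        refine (ofReal_integral_eq_lintegral_ofReal hi (ae_of_all _ fun d => ?_)).symm
        have := huber_nonneg hδ.le (Z d ⬝ᵥ t)
        simp only [Pi.zero_apply]
        positivity
    _ = _ := by
        rw [integral_const_mul, integral_add (integrable_const _) (hh.div_const s), integral_div]
        simp

end Density

end CPC

/-! ### Concentration and localization of sample quantile fits. -/

namespace CPC

/-- Hoeffding's inequality for the mean of a bounded function of an i.i.d. sample. -/
theorem real_mean_sub_integral_gt_le {E : Type*} [MeasurableSpace E] {μ : Measure E}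
    [IsProbabilityMeasure μ] {f : E → ℝ} (hf : Measurable f) (hf1 : ∀ d, |f d| ≤ 1) {n : ℕ}
    (hn : n ≠ 0) {s : ℝ} (hs : 0 ≤ s) :
    (Measure.pi fun _ : Fin n => μ).real {z | s < (n : ℝ)⁻¹ * ∑ i, f (z i) - ∫ d, f d ∂μ} ≤
      Real.exp (-(n * s ^ 2 / 2)) := by
  have hn' : (0 : ℝ) < n := Nat.cast_pos.mpr (Nat.pos_of_ne_zero hn)
  set g : E → ℝ := fun d => f d - ∫ d, f d ∂μ with hg
  have hgm : Measurable g := hf.sub_const _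
  have hind : iIndepFun (fun i (z : Fin n → E) => g (z i)) (Measure.pi fun _ : Fin n => μ) :=
    iIndepFun_pi (X := fun _ : Fin n => g) fun _ => hgm.aemeasurable
  have hsub : ∀ i ∈ (Finset.univ : Finset (Fin n)), HasSubgaussianMGF
      (fun z : Fin n → E => g (z i)) ((‖(1 : ℝ) - (-1)‖₊ / 2) ^ 2)
      (Measure.pi fun _ : Fin n => μ) := by
    intro i _
    have hm : AEMeasurable (fun z : Fin n → E => f (z i)) (Measure.pi fun _ : Fin n => μ) :=
      (hf.comp (measurable_pi_apply i)).aemeasurable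
    have h := hasSubgaussianMGF_of_mem_Icc (a := -1) (b := 1) hm
      (ae_of_all _ fun z => abs_le.mp (hf1 (z i)))
    have e : ∫ z, f (z i) ∂(Measure.pi fun _ : Fin n => μ) = ∫ d, f d ∂μ :=
      integral_comp_eval (μ := fun _ : Fin n => μ) hf.aestronglyMeasurable
    rwa [e] at h
  have h := HasSubgaussianMGF.measure_sum_ge_le_of_iIndepFun hind hsub
    (ε := n * s) (by positivity)
  refine (measureReal_mono fun z hz => ?_).trans (h.trans_eq ?_)
  · have hz' : s < (n : ℝ)⁻¹ * ∑ i, f (z i) - ∫ d, f d ∂μ := hz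
    change n * s ≤ ∑ i, g (z i)
    have e : ∑ i, g (z i) = n * ((n : ℝ)⁻¹ * ∑ i, f (z i) - ∫ d, f d ∂μ) := by
      simp only [hg, Finset.sum_sub_distrib, Finset.sum_const, Finset.card_univ, Fintype.card_fin,
        nsmul_eq_mul]
      field_simp
    rw [e]
    gcongr
  · congr 1
    have : ((‖(1 : ℝ) - (-1)‖₊ / 2) ^ 2 : NNReal) = 1 := by
      ext
      norm_num
    rw [this]
    simp
    field_simp

/-- Bounded conditioning vectors with second moment matrix bounded below. -/
structure RegularDesign {E K : Type*} [MeasurableSpace E] [Fintype K] (μ : Measure E)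
    (Z : E → K → ℝ) (m q c : ℝ) : Prop where
  measurable : Measurable Z
  bound : ∀ᵐ d ∂μ, ∀ k, |Z d k| ≤ m
  card_le : (Fintype.card K : ℝ) ≤ q
  one_le : 1 ≤ q
  le_secondMoment : ∀ t, c * (t ⬝ᵥ t) ≤ t ⬝ᵥ (secondMoment μ Z).mulVec t

section Fit

variable {E K : Type*} [MeasurableSpace E] [Fintype K] {μ : Measure E}
  [IsProbabilityMeasure μ] {U : E → ℝ} {Z : E → K → ℝ} {m q c : ℝ}

/-- The proportion of observations whose residual at `a` is exceeded by the change of the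
predictor between `a` and `a + t`. -/
noncomputable def crossing {n : ℕ} (U : E → ℝ) (Z : E → K → ℝ) (a : K → ℝ) (z : Fin n → E)
    (t : K → ℝ) : ℝ :=
  (n : ℝ)⁻¹ * ∑ i, if |U (z i) - Z (z i) ⬝ᵥ a| ≤ |Z (z i) ⬝ᵥ t| then 1 else 0

/-- On a bounded range the linear branch also dominates a square, since `δ |x| ≥ δ x² / B`. -/
theorem mul_sq_le_huber {δ B x : ℝ} (hδ : 0 < δ) (hx : |x| ≤ B) :
    δ / (δ + B) * x ^ 2 ≤ huber δ x := by
  have hB : 0 ≤ B := (abs_nonneg x).trans hx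
  have hs : 0 < δ + B := by positivity
  refine le_min ?_ ?_
  · refine mul_le_of_le_one_left (sq_nonneg _) ?_
    rw [div_le_one hs]
    linarith
  · rw [div_mul_eq_mul_div, div_le_iff₀ hs, ← sq_abs]
    nlinarith [mul_le_mul_of_nonneg_left hx (mul_nonneg hδ.le (abs_nonneg x)),
      mul_nonneg hδ.le (mul_nonneg hδ.le (abs_nonneg x))]

/-- On this sphere `|Zᵀ t| ≤ m q` while `E (Zᵀ t)² ≥ c q`, so the powers of `q` cancel. The radius
`√q` is chosen to make the lower bound independent of the dimension. -/
theorem le_integral_huber_of_sphere (hd : RegularDesign μ Z m q c) (hm0 : 0 < m) (hc : 0 < c)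
    {δ : ℝ} (hδ : 0 < δ) {t : K → ℝ} (ht : t ⬝ᵥ t = q) :
    c * δ / (δ + m) ≤ ∫ d, huber δ (Z d ⬝ᵥ t) ∂μ := by
  obtain ⟨hZ, hm, hq, hq1, hA⟩ := hd
  have hq0 : 0 < q := by linarith
  have hbd : ∀ᵐ d ∂μ, |Z d ⬝ᵥ t| ≤ m * q := by
    filter_upwards [hm] with d hd
    have := abs_dotProduct_le hm0.le (Real.sqrt_nonneg q) hd hq
      (by rw [Real.sq_sqrt hq0.le]; exact ht.le)
    rwa [mul_assoc, Real.mul_self_sqrt hq0.le] at this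
  have hi := integrable_dotProduct_mul hZ hm t t
  have hh : Integrable (fun d => huber δ (Z d ⬝ᵥ t)) μ := by
    refine ((integrable_dotProduct hZ hm t).abs.const_mul δ).mono'
      ((continuous_huber δ).measurable.comp (measurable_dotProduct_const hZ t)).aestronglyMeasurable
      (ae_of_all _ fun d => ?_)
    rw [Real.norm_of_nonneg (huber_nonneg hδ.le _)]
    exact min_le_right _ _
  have h1 := hA t
  rw [ht, dotProduct_secondMoment_mulVec hZ hm] at h1
  calc c * δ / (δ + m) ≤ δ / (δ + m * q) * (c * q) := by
        rw [div_mul_eq_mul_div, div_le_div_iff₀ (by positivity) (by positivity)]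
        have : 0 ≤ c * δ * δ * (q - 1) := mul_nonneg (by positivity) (by linarith)
        nlinarith
    _ ≤ δ / (δ + m * q) * ∫ d, (Z d ⬝ᵥ t) * (Z d ⬝ᵥ t) ∂μ := by gcongr
    _ = ∫ d, δ / (δ + m * q) * ((Z d ⬝ᵥ t) * (Z d ⬝ᵥ t)) ∂μ := (integral_const_mul _ _).symm
    _ ≤ _ := by
        refine integral_mono_ae (hi.const_mul _) hh ?_
        filter_upwards [hbd] with d hd
        have := mul_sq_le_huber hδ hd
        rwa [sq] at this

/-- A sample quantile regression fit is close to the population one, in the sense that few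
observations lie between the two fits, outside an event of small probability. -/
theorem real_crossing_gt_le (hd : RegularDesign μ Z m q c) (hm0 : 0 < m) (hc : 0 < c)
    (hU : Measurable U) {a : K → ℝ} {L δ b : ℝ} (hL : 0 ≤ L) (hδ : 0 < δ) (hb : 0 < b)
    (h : HasRegularCondDensity μ U Z a L δ b) {w : ℝ} (hw : w ∈ Ioo (0 : ℝ) 1)
    (hpop : IsPopQuantileCoef μ w U Z a) {n : ℕ} (hn : n ≠ 0) {s : ℝ} (hs : 0 < s)
    (hsδ : s ≤ δ) (hsc : s ^ 2 < c * δ / (δ + m)) :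
    (Measure.pi fun _ : Fin n => μ).real {z | ∃ ah : K → ℝ, IsSampleQuantileCoef w U Z z ah ∧
        3 * (1 / δ + 4 * L * δ + 1) * s < crossing U Z a z (ah - a)} ≤
      excessBound m q c (b / 8) δ (b / 16 * s ^ 2) n + excessBound m q c 1 δ (1 / 2 * s ^ 2) n +
        Real.exp (-(n * s ^ 2 / 2)) := by
  classical
  have hn' : (0 : ℝ) < n := Nat.cast_pos.mpr (Nat.pos_of_ne_zero hn)
  have hd' := hd
  obtain ⟨hZ, hm, hq, hq1, hA⟩ := hd
  have hq0 : 0 < q := by linarith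
  set C := 1 / δ + 4 * L * δ with hC
  have hC0 : 0 < C := by positivity
  set e : E → ℝ := fun d => U d - Z d ⬝ᵥ a with he
  have hem : Measurable e := hU.sub (measurable_dotProduct_const hZ a)
  -- `φ₁` is the negated loss difference, so its one-sided deviation bounds the population risk by
  -- the sample risk. `φ₂` is the ramp scaled by `s` and centered at zero; the mean ramp at zero is
  -- handled apart by Hoeffding's inequality.
  set φ₁ : E → ℝ → ℝ := fun d x => -(checkLoss w (e d - x) - checkLoss w (e d)) with hφ₁
  set φ₂ : E → ℝ → ℝ := fun d x => s * (ramp s (e d) x - ramp s (e d) 0) with hφ₂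
  have m₁ : ∀ t, Measurable fun d => φ₁ d (Z d ⬝ᵥ t) := fun t =>
    (((measurable_checkLoss w).comp (hem.sub (measurable_dotProduct_const hZ t))).sub
      ((measurable_checkLoss w).comp hem)).neg
  have mr : ∀ t, Measurable fun d => ramp s (e d) (Z d ⬝ᵥ t) := fun t =>
    (measurable_ramp s).comp (hem.prodMk (measurable_dotProduct_const hZ t))
  have mr0 : Measurable fun d => ramp s (e d) 0 :=
    (measurable_ramp s).comp (hem.prodMk measurable_const)
  have m₂ : ∀ t, Measurable fun d => φ₂ d (Z d ⬝ᵥ t) := fun t => ((mr t).sub mr0).const_mul s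
  have l₁ : ∀ d x y, |φ₁ d x - φ₁ d y| ≤ |x - y| := by
    intro d x y
    have h1 := abs_checkLoss_sub_le hw (e d - y) (e d - x)
    have e1 : φ₁ d x - φ₁ d y = checkLoss w (e d - y) - checkLoss w (e d - x) := by
      simp only [hφ₁]; ring
    have e2 : e d - y - (e d - x) = x - y := by ring
    rwa [e1, ← e2]
  have l₂ : ∀ d x y, |φ₂ d x - φ₂ d y| ≤ |x - y| := by
    intro d x y
    have e1 : φ₂ d x - φ₂ d y = s * (ramp s (e d) x - ramp s (e d) y) := by
      simp only [hφ₂]; ring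
    rw [e1, abs_mul, abs_of_pos hs]
    exact mul_abs_ramp_sub_le hs _ _ _
  -- The penalty `b / 8` is half the curvature `b / 4`, and `2 x = b / 8 * s ^ 2`, so the other half
  -- of the curvature gives `E huber ≤ s ^ 2`. In `p₂` likewise `2 x = s ^ 2`.
  have p₁ := real_penalizedDeviation_le hZ hm hm0 hq hq0 hc hA (β := b / 8) (by positivity) hδ l₁
    (fun d => by simp [hφ₁]) m₁ (x := b / 16 * s ^ 2) (by positivity) hn
  have p₂ := real_penalizedDeviation_le hZ hm hm0 hq hq0 hc hA (β := 1) one_pos hδ l₂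
    (fun d => by simp [hφ₂]) m₂ (x := 1 / 2 * s ^ 2) (by positivity) hn
  have p₃ := real_mean_sub_integral_gt_le (μ := μ) mr0
    (fun d => by rw [abs_of_nonneg (ramp_nonneg _ _ _)]; exact ramp_le_one _ _ _) hn hs.le
  have hir : ∀ x : E → ℝ, Measurable (fun d => ramp s (e d) (x d)) →
      Integrable (fun d => ramp s (e d) (x d)) μ := fun x hx =>
    Integrable.of_bound hx.aestronglyMeasurable 1 (ae_of_all _ fun d => by
      rw [Real.norm_of_nonneg (ramp_nonneg _ _ _)]; exact ramp_le_one _ _ _)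
  refine (measureReal_mono ?_).trans ((measureReal_union_le _ _).trans (add_le_add
    ((measureReal_union_le _ _).trans (add_le_add p₁ p₂)) p₃))
  rintro z ⟨ah, hah, hcross⟩
  by_contra hz
  simp only [mem_union, not_or] at hz
  obtain ⟨⟨hz₁, hz₂⟩, hz₃⟩ := hz
  have hz₁' : ∀ t, t ⬝ᵥ t ≤ q →
      penalizedDeviation μ Z φ₁ (b / 8) δ z t ≤ 2 * (b / 16 * s ^ 2) := fun t ht =>
    not_lt.mp fun hlt => hz₁ ⟨t, ht, hlt⟩
  have hz₂' : ∀ t, t ⬝ᵥ t ≤ q →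
      penalizedDeviation μ Z φ₂ 1 δ z t ≤ 2 * (1 / 2 * s ^ 2) := fun t ht =>
    not_lt.mp fun hlt => hz₂ ⟨t, ht, hlt⟩
  have hz₃' : (n : ℝ)⁻¹ * ∑ i, ramp s (e (z i)) 0 - ∫ d, ramp s (e d) 0 ∂μ ≤ s :=
    not_lt.mp fun hlt => hz₃ hlt
  -- localization: a direction in the ball along which the sample loss does not increase
  have local_bound : ∀ t, t ⬝ᵥ t ≤ q →
      ∑ i, (checkLoss w (e (z i) - Z (z i) ⬝ᵥ t) - checkLoss w (e (z i))) ≤ 0 →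
      ∫ d, huber δ (Z d ⬝ᵥ t) ∂μ ≤ s ^ 2 := by
    intro t ht hloss
    have h1 := hz₁' t ht
    have h2 := mul_integral_huber_le_excess_risk hL hδ hb h hU hZ hm hw hpop t
    simp only [penalizedDeviation, hφ₁, integral_neg, Finset.sum_neg_distrib] at h1
    have h3 : (n : ℝ)⁻¹ * ∑ i, (checkLoss w (e (z i) - Z (z i) ⬝ᵥ t) - checkLoss w (e (z i))) ≤
      0 := mul_nonpos_of_nonneg_of_nonpos (by positivity) hloss
    have h4 : b / 8 * ∫ d, huber δ (Z d ⬝ᵥ t) ∂μ ≤ b / 8 * s ^ 2 := by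
      simp only [he] at h1 h3
      linarith
    exact le_of_mul_le_mul_left h4 (by positivity)
  set t := ah - a with ht
  have hloss : ∑ i, (checkLoss w (e (z i) - Z (z i) ⬝ᵥ t) - checkLoss w (e (z i))) ≤ 0 := by
    have h1 := le_of_mul_le_mul_left (hah a) (inv_pos.mpr hn')
    rw [Finset.sum_sub_distrib, sub_nonpos]
    refine le_trans (le_of_eq (Finset.sum_congr rfl fun i _ => ?_)) h1
    congr 1
    simp only [he, ht, dotProduct_sub]
    ring
  -- Were the fit outside the ball, by convexity the sample loss would not increase at the point of
  -- the sphere on the segment to it. `local_bound` there contradicts the lower bound on the sphere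
  -- because of `hsc`.
  have htq : t ⬝ᵥ t ≤ q := by
    by_contra hlt
    rw [not_le] at hlt
    have hT : 0 < t ⬝ᵥ t := hq0.trans hlt
    set l := Real.sqrt (q / (t ⬝ᵥ t)) with hl
    have hl0 : 0 ≤ l := Real.sqrt_nonneg _
    have hlsq : l ^ 2 = q / (t ⬝ᵥ t) := Real.sq_sqrt (by positivity)
    have hl1 : l ≤ 1 := by
      rw [hl, Real.sqrt_le_iff, one_pow, div_le_one hT]
      exact ⟨zero_le_one, hlt.le⟩
    have hlt2 : (l • t) ⬝ᵥ (l • t) = q := by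
      rw [smul_dotProduct, dotProduct_smul, smul_eq_mul, smul_eq_mul, ← mul_assoc, ← sq, hlsq]
      field_simp
    have hloss2 : ∑ i, (checkLoss w (e (z i) - Z (z i) ⬝ᵥ (l • t)) - checkLoss w (e (z i))) ≤
        l * ∑ i, (checkLoss w (e (z i) - Z (z i) ⬝ᵥ t) - checkLoss w (e (z i))) := by
      rw [Finset.mul_sum]
      refine Finset.sum_le_sum fun i _ => ?_
      have h1 := checkLoss_convex (w := w) hl0 hl1 (e (z i)) (e (z i) - Z (z i) ⬝ᵥ t)
      have h2 : (1 - l) * e (z i) + l * (e (z i) - Z (z i) ⬝ᵥ t) =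
          e (z i) - Z (z i) ⬝ᵥ (l • t) := by
        rw [dotProduct_smul, smul_eq_mul]; ring
      rw [h2] at h1
      linarith
    have h1 := local_bound (l • t) hlt2.le
      (hloss2.trans (mul_nonpos_of_nonneg_of_nonpos hl0 hloss))
    have h2 := le_integral_huber_of_sphere hd' hm0 hc hδ hlt2
    linarith
  have hD := local_bound t htq hloss
  have h2 := hz₂' t htq
  have h3 := integral_ramp_le hL hδ h hU hZ hm hs hsδ t
  have h4 : crossing U Z a z t ≤ (n : ℝ)⁻¹ * ∑ i, ramp s (e (z i)) (Z (z i) ⬝ᵥ t) := by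
    refine mul_le_mul_of_nonneg_left (Finset.sum_le_sum fun i _ => ?_) (by positivity)
    split_ifs with hi
    · exact one_le_ramp hs hi
    · exact ramp_nonneg _ _ _
  have h5 : penalizedDeviation μ Z φ₂ 1 δ z t =
      s * ((n : ℝ)⁻¹ * ∑ i, ramp s (e (z i)) (Z (z i) ⬝ᵥ t) -
        (n : ℝ)⁻¹ * ∑ i, ramp s (e (z i)) 0 - (∫ d, ramp s (e d) (Z d ⬝ᵥ t) ∂μ -
          ∫ d, ramp s (e d) 0 ∂μ)) - ∫ d, huber δ (Z d ⬝ᵥ t) ∂μ := by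
    simp only [penalizedDeviation, hφ₂]
    rw [integral_const_mul, integral_sub (hir _ (mr t)) (hir _ mr0), ← Finset.mul_sum,
      Finset.sum_sub_distrib]
    ring
  rw [h5] at h2
  have h6 : (∫ d, huber δ (Z d ⬝ᵥ t) ∂μ) / s ≤ s := by
    rw [div_le_iff₀ hs, ← sq]; exact hD
  have h7 : ∫ d, ramp s (e d) (Z d ⬝ᵥ t) ∂μ ≤ C * (3 * s) :=
    h3.trans (mul_le_mul_of_nonneg_left (by linarith) hC0.le)
  have h8 : s * ((n : ℝ)⁻¹ * ∑ i, ramp s (e (z i)) (Z (z i) ⬝ᵥ t) -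
        (n : ℝ)⁻¹ * ∑ i, ramp s (e (z i)) 0 - (∫ d, ramp s (e d) (Z d ⬝ᵥ t) ∂μ -
          ∫ d, ramp s (e d) 0 ∂μ)) ≤ s * (2 * s) := by linarith
  have h9 := le_of_mul_le_mul_left h8 hs
  have h10 : crossing U Z a z t ≤ 3 * (C + 1) * s := by linarith
  exact absurd hcross (not_lt.mpr h10)

theorem abs_psi_sub_psi_le (w e x : ℝ) :
    |psi w (e - x) - psi w e| ≤ if |e| ≤ |x| then 1 else 0 := by
  split_ifs with hx
  · exact abs_psi_sub_psi_le_one _ _ _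
  · have h1 : (e - x ≤ 0) ↔ (e ≤ 0) := by
      rw [not_le] at hx
      rcases abs_cases e with ⟨h1, h1'⟩ | ⟨h1, h1'⟩ <;>
      rcases abs_cases x with ⟨h2, h2'⟩ | ⟨h2, h2'⟩ <;> constructor <;> intro <;> linarith
    simp [psi, h1]

/-- Deviation of the sample copula-based partial covariance. -/
theorem real_psi_mean_deviation_le {X Y : E → ℝ} (hd : RegularDesign μ Z m q c) (hm0 : 0 < m)
    (hc : 0 < c) (hY : Measurable Y) (hX : Measurable X) {a t : K → ℝ} {L δ b : ℝ} (hL : 0 ≤ L)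
    (hδ : 0 < δ) (hb : 0 < b) (ha : HasRegularCondDensity μ Y Z a L δ b)
    (ht : HasRegularCondDensity μ X Z t L δ b) {τ ι : ℝ} (hτ : τ ∈ Ioo (0 : ℝ) 1)
    (hι : ι ∈ Ioo (0 : ℝ) 1) (hap : IsPopQuantileCoef μ τ Y Z a)
    (htp : IsPopQuantileCoef μ ι X Z t) {n : ℕ} (hn : n ≠ 0) {s : ℝ} (hs : 0 < s)
    (hsδ : s ≤ δ) (hsc : s ^ 2 < c * δ / (δ + m)) :
    (Measure.pi fun _ : Fin n => μ).real {z | ∃ ah th : K → ℝ,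
        IsSampleQuantileCoef τ Y Z z ah ∧ IsSampleQuantileCoef ι X Z z th ∧
        (6 * (1 / δ + 4 * L * δ + 1) + 1) * s <
          |(n : ℝ)⁻¹ * ∑ i, psi τ (Y (z i) - Z (z i) ⬝ᵥ ah) * psi ι (X (z i) - Z (z i) ⬝ᵥ th) -
            ∫ d, psi τ (Y d - Z d ⬝ᵥ a) * psi ι (X d - Z d ⬝ᵥ t) ∂μ|} ≤
      2 * excessBound m q c (b / 8) δ (b / 16 * s ^ 2) n +
        2 * excessBound m q c 1 δ (1 / 2 * s ^ 2) n + 4 * Real.exp (-(n * s ^ 2 / 2)) := by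
  set f : E → ℝ := fun d => psi τ (Y d - Z d ⬝ᵥ a) * psi ι (X d - Z d ⬝ᵥ t) with hf
  have hfm : Measurable f :=
    ((measurable_psi τ).comp (hY.sub (measurable_dotProduct_const hd.measurable a))).mul
      ((measurable_psi ι).comp (hX.sub (measurable_dotProduct_const hd.measurable t)))
  have hf1 : ∀ d, |f d| ≤ 1 := fun d => by
    rw [hf, abs_mul]
    exact mul_le_one₀ (abs_psi_le_one hτ _) (abs_nonneg _) (abs_psi_le_one hι _)
  have p₁ := real_crossing_gt_le hd hm0 hc hY hL hδ hb ha hτ hap hn hs hsδ hsc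
  have p₂ := real_crossing_gt_le hd hm0 hc hX hL hδ hb ht hι htp hn hs hsδ hsc
  have p₃ := real_mean_sub_integral_gt_le (μ := μ) hfm hf1 hn hs.le
  have p₄ := real_mean_sub_integral_gt_le (μ := μ) hfm.neg
    (fun d => by simpa using hf1 d) hn hs.le
  -- Each regression contributes crossings up to `3 (C + 1) s` with `C = 1 / δ + 4 L δ`, and the
  -- mean at the population coefficients contributes `s`, from two one-sided Hoeffding bounds.
  refine (measureReal_mono ?_).trans ((measureReal_union_le _ _).trans (add_le_add
    ((measureReal_union_le _ _).trans (add_le_add p₁ p₂))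
    ((measureReal_union_le _ _).trans (add_le_add p₃ p₄)))) |>.trans_eq (by ring)
  rintro z ⟨ah, th, hah, hth, hdev⟩
  by_contra hz
  simp only [mem_union, not_or] at hz
  obtain ⟨⟨hz₁, hz₂⟩, hz₃, hz₄⟩ := hz
  have h1 : crossing Y Z a z (ah - a) ≤ 3 * (1 / δ + 4 * L * δ + 1) * s :=
    not_lt.mp fun hlt => hz₁ ⟨ah, hah, hlt⟩
  have h2 : crossing X Z t z (th - t) ≤ 3 * (1 / δ + 4 * L * δ + 1) * s :=
    not_lt.mp fun hlt => hz₂ ⟨th, hth, hlt⟩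
  have h3 : (n : ℝ)⁻¹ * ∑ i, f (z i) - ∫ d, f d ∂μ ≤ s := not_lt.mp fun hlt => hz₃ hlt
  have h4 : (n : ℝ)⁻¹ * ∑ i, (-f) (z i) - ∫ d, (-f) d ∂μ ≤ s := not_lt.mp fun hlt => hz₄ hlt
  simp only [Pi.neg_apply, Finset.sum_neg_distrib, integral_neg] at h4
  have h5 : |(n : ℝ)⁻¹ * ∑ i, f (z i) - ∫ d, f d ∂μ| ≤ s :=
    abs_le.mpr ⟨by linarith, h3⟩
  set g : E → ℝ := fun d => psi τ (Y d - Z d ⬝ᵥ ah) * psi ι (X d - Z d ⬝ᵥ th)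
  have h6 : |(n : ℝ)⁻¹ * ∑ i, g (z i) - (n : ℝ)⁻¹ * ∑ i, f (z i)| ≤
      crossing Y Z a z (ah - a) + crossing X Z t z (th - t) := by
    rw [← mul_sub, ← Finset.sum_sub_distrib, abs_mul, abs_of_nonneg (by positivity), crossing,
      crossing, ← mul_add, ← Finset.sum_add_distrib]
    refine mul_le_mul_of_nonneg_left ((Finset.abs_sum_le_sum_abs _ _).trans
      (Finset.sum_le_sum fun i _ => ?_)) (by positivity)
    have e1 : ∀ (U : E → ℝ) (v v' : K → ℝ), U (z i) - Z (z i) ⬝ᵥ v =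
        (U (z i) - Z (z i) ⬝ᵥ v') - Z (z i) ⬝ᵥ (v - v') := by
      intro U v v'
      rw [dotProduct_sub]; ring
    have k1 := abs_psi_sub_psi_le τ (Y (z i) - Z (z i) ⬝ᵥ a) (Z (z i) ⬝ᵥ (ah - a))
    have k2 := abs_psi_sub_psi_le ι (X (z i) - Z (z i) ⬝ᵥ t) (Z (z i) ⬝ᵥ (th - t))
    rw [← e1] at k1 k2
    refine le_trans ?_ (add_le_add k1 k2)
    have e2 : g (z i) - f (z i) =
        (psi τ (Y (z i) - Z (z i) ⬝ᵥ ah) - psi τ (Y (z i) - Z (z i) ⬝ᵥ a)) *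
          psi ι (X (z i) - Z (z i) ⬝ᵥ th) +
        psi τ (Y (z i) - Z (z i) ⬝ᵥ a) *
          (psi ι (X (z i) - Z (z i) ⬝ᵥ th) - psi ι (X (z i) - Z (z i) ⬝ᵥ t)) := by
      simp only [g, hf]; ring
    rw [e2]
    refine (abs_add_le _ _).trans (add_le_add ?_ ?_)
    · rw [abs_mul]
      exact mul_le_of_le_one_right (abs_nonneg _) (abs_psi_le_one hι _)
    · rw [abs_mul]
      exact mul_le_of_le_one_left (abs_nonneg _) (abs_psi_le_one hτ _)
  have h7 := abs_sub_le ((n : ℝ)⁻¹ * ∑ i, g (z i)) ((n : ℝ)⁻¹ * ∑ i, f (z i)) (∫ d, f d ∂μ)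
  have h8 : (6 * (1 / δ + 4 * L * δ + 1) + 1) * s <
      |(n : ℝ)⁻¹ * ∑ i, g (z i) - ∫ d, f d ∂μ| := hdev
  linarith

end Fit

end CPC

namespace CPC

/-! ### Rates: absorbing polynomial factors and constants. -/

section Asymptotics

theorem eventually_rpow_mul_exp_le_one (p : ℝ) {κ h : ℝ} (hκ : 0 < κ) (hh : 0 < h) :
    ∀ᶠ n : ℕ in atTop, (n : ℝ) ^ p * Real.exp (-(h * (n : ℝ) ^ κ)) ≤ 1 := by
  have h1 : Tendsto (fun x : ℝ => x ^ (p / κ) * Real.exp (-h * x)) atTop (nhds 0) :=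
    tendsto_rpow_mul_exp_neg_mul_atTop_nhds_zero (p / κ) h hh
  have h2 : Tendsto (fun n : ℕ => (n : ℝ) ^ κ) atTop atTop :=
    (tendsto_rpow_atTop hκ).comp tendsto_natCast_atTop_atTop
  filter_upwards [(h1.comp h2).eventually_le_const zero_lt_one] with n hn
  have e : ((n : ℝ) ^ κ) ^ (p / κ) = (n : ℝ) ^ p := by
    rw [← Real.rpow_mul (Nat.cast_nonneg n), mul_div_cancel₀ _ hκ.ne']
  simpa only [Function.comp, e, neg_mul] using hn

/-- Along `x = g n ^ (-2κ)` the bound decays exponentially in `q⁻¹ n ^ (1 - 2κ)`. -/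
theorem eventually_excessBound_le {m c β δ g κ : ℝ} (hm : 0 < m) (hc : 0 < c) (hβ : 0 < β)
    (hδ : 0 < δ) (hg : 0 < g) (hκ : 0 < κ) :
    ∃ A h : ℝ, 0 < A ∧ 0 < h ∧ ∀ᶠ n : ℕ in atTop, ∀ q : ℝ, 1 ≤ q →
      1 ≤ q⁻¹ * (n : ℝ) ^ (1 - 2 * κ) →
      excessBound m q c β δ (g * (n : ℝ) ^ (-(2 * κ))) n ≤
        A * Real.exp (-(h * (q⁻¹ * (n : ℝ) ^ (1 - 2 * κ)))) := by
  set η := min 1 (β * δ / 4) with hη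
  have hη0 : 0 < η := lt_min one_pos (by positivity)
  set h₁ := β * c * g / (2 * m ^ 2) with hh₁
  set h₂ := η * (β * δ) * c / (4 * m ^ 2) with hh₂
  have h₁0 : 0 < h₁ := by positivity
  have h₂0 : 0 < h₂ := by positivity
  set A₁ := 4 * m ^ 4 / (β ^ 2 * c ^ 2 * g ^ 2) + 4 * m ^ 2 / (β * c * g) with hA₁
  set A₂ := 4 * m ^ 3 / (c * η * g) * Real.exp h₂ with hA₂
  have hA₁0 : 0 < A₁ := by positivity
  have hA₂0 : 0 < A₂ := by positivity
  refine ⟨A₁ + A₂, min h₁ h₂, by positivity, lt_min h₁0 h₂0, ?_⟩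
  filter_upwards [eventually_rpow_mul_exp_le_one (1 + 2 * κ) (κ := 2 * κ) (by positivity) h₂0,
    eventually_ge_atTop 1] with n hn hn1 q hq hN
  have hn' : (1 : ℝ) ≤ n := by exact_mod_cast hn1
  have hn0 : (0 : ℝ) < n := by linarith
  have hq0 : 0 < q := by linarith
  set N := q⁻¹ * (n : ℝ) ^ (1 - 2 * κ) with hNdef
  have hN0 : 0 < N := by linarith
  set r := (n : ℝ) ^ (2 * κ) with hr
  have hr0 : 0 < r := Real.rpow_pos_of_pos hn0 _
  have hr1 : 1 ≤ r := Real.one_le_rpow hn' (by positivity)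
  have e1 : (n : ℝ) ^ (1 - 2 * κ) = n / r := by rw [Real.rpow_sub hn0, Real.rpow_one]
  have e2 : (n : ℝ) ^ (-(2 * κ)) = r⁻¹ := Real.rpow_neg hn0.le _
  have e3 : (n : ℝ) ^ (1 + 2 * κ) = n * r := by rw [Real.rpow_add hn0, Real.rpow_one]
  have e4 : g * r⁻¹ * n / q = g * N := by rw [hNdef, e1]; ring
  have e5 : n / q = N * r := by rw [hNdef, e1]; field_simp
  -- This is all that is needed of the size of `q`: it makes the prefactor of the second term
  -- polynomial in `n`.
  have hqn : q ≤ n := by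
    have : n / q = N * r := e5
    have h1 : 1 ≤ (n : ℝ) / q := by rw [this]; nlinarith
    rwa [one_le_div hq0] at h1
  rw [e3] at hn
  unfold excessBound
  rw [e2, e4, e5, ← hη, ← hh₂, add_mul A₁ A₂]
  refine add_le_add (mul_le_mul ?_ ?_ (Real.exp_pos _).le hA₁0.le) ?_
  · rw [hA₁]
    have k1 : 4 * m ^ 4 / (β ^ 2 * c ^ 2 * (g * N) ^ 2) ≤ 4 * m ^ 4 / (β ^ 2 * c ^ 2 * g ^ 2) := by
      gcongr
      nlinarith
    have k2 : 4 * m ^ 2 / (β * c * (g * N)) ≤ 4 * m ^ 2 / (β * c * g) := by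
      gcongr
      nlinarith
    exact add_le_add k1 k2
  · refine Real.exp_le_exp.mpr (neg_le_neg ?_)
    have : β * c * (g * N) / (2 * m ^ 2) = h₁ * N := by rw [hh₁]; ring
    rw [this]
    exact mul_le_mul_of_nonneg_right (min_le_left _ _) hN0.le
  · have k1 : 4 * m ^ 3 * q ^ 2 / (c * η * n * (g * r⁻¹)) ≤
        4 * m ^ 3 / (c * η * g) * (n * r) := by
      have : 4 * m ^ 3 * q ^ 2 / (c * η * n * (g * r⁻¹)) =
          4 * m ^ 3 / (c * η * g) * (q ^ 2 / n * r) := by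
        field_simp
      rw [this]
      gcongr
      rw [div_le_iff₀ hn0, ← sq]
      gcongr
    -- From `(N - 1)(r - 1) ≥ 0` one gets `N r ≥ N + r - 1`: the factor in `r` kills the polynomial
    -- `n r`, and the factor in `N` is the desired rate.
    have k2 : Real.exp (-(N * r * h₂)) ≤
        Real.exp h₂ * Real.exp (-(h₂ * r)) * Real.exp (-(h₂ * N)) := by
      rw [← Real.exp_add, ← Real.exp_add]
      refine Real.exp_le_exp.mpr ?_
      linarith [mul_nonneg h₂0.le (mul_nonneg (sub_nonneg.mpr hN) (sub_nonneg.mpr hr1))]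
    have k3 : Real.exp (-(h₂ * N)) ≤ Real.exp (-(min h₁ h₂ * N)) :=
      Real.exp_le_exp.mpr (neg_le_neg (mul_le_mul_of_nonneg_right (min_le_right _ _) hN0.le))
    calc _ ≤ 4 * m ^ 3 / (c * η * g) * (n * r) *
          (Real.exp h₂ * Real.exp (-(h₂ * r)) * Real.exp (-(h₂ * N))) := by gcongr
      _ = A₂ * (n * r * Real.exp (-(h₂ * r))) * Real.exp (-(h₂ * N)) := by rw [hA₂]; ring
      _ ≤ A₂ * 1 * Real.exp (-(min h₁ h₂ * N)) := by gcongr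
      _ = _ := by rw [mul_one]

/-- The constant in front of an exponential bound can be replaced by `12`, at the price of a
smaller rate. -/
theorem exists_rate_twelve {A h : ℝ} (hA : 0 < A) (hh : 0 < h) :
    ∃ c : ℝ, 0 < c ∧ (∀ N : ℝ, N ≤ 1 → 1 ≤ 12 * Real.exp (-(c * N))) ∧
      ∀ N : ℝ, 0 ≤ N → ∀ P : ℝ, P ≤ 1 → P ≤ A * Real.exp (-(h * N)) →
        P ≤ 12 * Real.exp (-(c * N)) := by
  -- If `c N ≤ 1`, then `12 exp (-1) ≥ 1` makes the bound trivial. Otherwise `c ≤ h / (2 A)` forces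
  -- `A ≤ h N / 2 ≤ exp (h N / 2)`, so half of the exponent absorbs `A`.
  set c := min (h / 2) (min 1 (h / (2 * A))) with hc
  have hc0 : 0 < c := by positivity
  have hc1 : c ≤ 1 := (min_le_right _ _).trans (min_le_left _ _)
  have he : 1 ≤ Real.exp (-1) * 12 := by
    rw [Real.exp_neg, ← div_eq_inv_mul, one_le_div (Real.exp_pos 1)]
    linarith [Real.exp_one_lt_d9]
  refine ⟨c, hc0, fun N hN => ?_, fun N hN P hP1 hP => ?_⟩
  · have : Real.exp (-1) ≤ Real.exp (-(c * N)) := Real.exp_le_exp.mpr (by nlinarith)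
    linarith
  · rcases le_total (c * N) 1 with hcN | hcN
    · have : Real.exp (-1) ≤ Real.exp (-(c * N)) := Real.exp_le_exp.mpr (by linarith)
      linarith
    · have hc2 : c ≤ h / (2 * A) := (min_le_right _ _).trans (min_le_right _ _)
      have hc3 : c ≤ h / 2 := min_le_left _ _
      have k1 : A ≤ h / 2 * N := by
        have : 1 ≤ h / (2 * A) * N := hcN.trans (mul_le_mul_of_nonneg_right hc2 hN)
        have e : h / (2 * A) * N = h / 2 * N / A := by field_simp
        rwa [e, one_le_div hA] at this
      have k2 : A * Real.exp (-(h / 2 * N)) ≤ 1 := by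
        rw [Real.exp_neg, ← div_eq_mul_inv, div_le_one (Real.exp_pos _)]
        linarith [Real.add_one_le_exp (h / 2 * N)]
      have k3 : Real.exp (-(h * N)) ≤ Real.exp (-(h / 2 * N)) * Real.exp (-(c * N)) := by
        rw [← Real.exp_add]
        refine Real.exp_le_exp.mpr ?_
        nlinarith
      calc P ≤ A * (Real.exp (-(h / 2 * N)) * Real.exp (-(c * N))) := hP.trans (by gcongr)
        _ = (A * Real.exp (-(h / 2 * N))) * Real.exp (-(c * N)) := by ring
        _ ≤ 12 * Real.exp (-(c * N)) := by
            refine mul_le_mul_of_nonneg_right ?_ (Real.exp_pos _).le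
            linarith

end Asymptotics

/-- Exponential deviation bound of one sample copula-based partial correlation, with constants
that depend on the law of the observations only through the constants of the conditions. -/
theorem exists_eventually_real_cpcHat_deviation_le {τ ι m c L δ b κ C : ℝ}
    (hτ : τ ∈ Ioo (0 : ℝ) 1) (hι : ι ∈ Ioo (0 : ℝ) 1) (hm0 : 0 < m) (hc : 0 < c) (hL : 0 ≤ L)
    (hδ : 0 < δ) (hb : 0 < b) (hκ : 0 < κ) (hC : 0 < C) :
    ∃ c' : ℝ, 0 < c' ∧ ∀ᶠ n : ℕ in atTop, ∀ (q : ℝ) (E : Type) (K : Type) [MeasurableSpace E]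
      [Fintype K] (μ : Measure E) [IsProbabilityMeasure μ] (Y X : E → ℝ) (Z : E → K → ℝ)
      (a t : K → ℝ), RegularDesign μ Z m q c → Measurable Y → Measurable X →
      HasRegularCondDensity μ Y Z a L δ b → HasRegularCondDensity μ X Z t L δ b →
      IsPopQuantileCoef μ τ Y Z a → IsPopQuantileCoef μ ι X Z t →
      (Measure.pi fun _ : Fin n => μ).real {z | ∃ ah th : K → ℝ,
        IsSampleQuantileCoef τ Y Z z ah ∧ IsSampleQuantileCoef ι X Z z th ∧
        C * (n : ℝ) ^ (-κ) ≤ |(|cpcHat τ ι Y X Z z ah th|) - (|cpc μ τ ι Y X Z a t|)|} ≤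
      12 * Real.exp (-c' * q⁻¹ * (n : ℝ) ^ (1 - 2 * κ)) := by
  set σ := Real.sqrt (τ * (1 - τ) * (ι * (1 - ι))) with hσ
  have hσ0 : 0 < σ := Real.sqrt_pos.mpr (mul_pos (mul_pos hτ.1 (by linarith [hτ.2]))
    (mul_pos hι.1 (by linarith [hι.2])))
  set M := 6 * (1 / δ + 4 * L * δ + 1) + 1 with hM
  have hM0 : 0 < M := by positivity
  -- This makes `M s` half of `C σ n ^ (-κ)`; the slack turns the weak inequality of the event into
  -- the strict one required.
  set k := C * σ / (2 * M) with hk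
  have hk0 : 0 < k := by positivity
  obtain ⟨A₁, h₁, hA₁, hh₁, ev₁⟩ := eventually_excessBound_le (β := b / 8)
    (g := b / 16 * k ^ 2) hm0 hc (by positivity) hδ (by positivity) hκ
  obtain ⟨A₂, h₂, hA₂, hh₂, ev₂⟩ := eventually_excessBound_le (β := 1)
    (g := 1 / 2 * k ^ 2) hm0 hc one_pos hδ (by positivity) hκ
  set h := min (min h₁ h₂) (k ^ 2 / 2) with hh
  have hh0 : 0 < h := by positivity
  obtain ⟨c', hc'0, hc'1, hc'2⟩ := exists_rate_twelve (A := 2 * A₁ + 2 * A₂ + 4) (h := h)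
    (by positivity) hh0
  refine ⟨c', hc'0, ?_⟩
  have hlim : Tendsto (fun n : ℕ => k * (n : ℝ) ^ (-κ)) atTop (nhds 0) := by
    have := ((tendsto_rpow_neg_atTop hκ).comp tendsto_natCast_atTop_atTop).const_mul k
    rwa [mul_zero] at this
  have hlim2 : Tendsto (fun n : ℕ => (k * (n : ℝ) ^ (-κ)) ^ 2) atTop (nhds 0) := by
    have := hlim.pow 2
    rwa [zero_pow two_ne_zero] at this
  -- None of these conditions on `n` involves `q` or the law, so one threshold serves all
  -- coordinates `j` at once.
  filter_upwards [ev₁, ev₂, hlim.eventually_le_const hδ,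
    hlim2.eventually_lt_const (show 0 < c * δ / (δ + m) by positivity),
    eventually_ge_atTop 1] with n hn₁ hn₂ hsδ hsc hn1
  intro q E K _ _ μ _ Y X Z a t hd hY hX ha ht hap htp
  have hn' : (1 : ℝ) ≤ n := by exact_mod_cast hn1
  have hn0 : (0 : ℝ) < n := by linarith
  have hq := hd.one_le
  set N := q⁻¹ * (n : ℝ) ^ (1 - 2 * κ) with hN
  have hN0 : 0 ≤ N := by positivity
  have erw : -c' * q⁻¹ * (n : ℝ) ^ (1 - 2 * κ) = -(c' * N) := by rw [hN]; ring
  rw [erw]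
  rcases le_total N 1 with hN1 | hN1
  · exact measureReal_le_one.trans (hc'1 N hN1)
  refine hc'2 N hN0 _ measureReal_le_one ?_
  set s := k * (n : ℝ) ^ (-κ) with hs
  have hs0 : 0 < s := mul_pos hk0 (Real.rpow_pos_of_pos hn0 _)
  have hs2 : s ^ 2 = k ^ 2 * (n : ℝ) ^ (-(2 * κ)) := by
    rw [hs, mul_pow, ← Real.rpow_mul_natCast hn0.le]
    congr 2
    push_cast
    ring
  have main := real_psi_mean_deviation_le hd hm0 hc hY hX hL hδ hb ha ht hτ hι hap htp
    (Nat.one_le_iff_ne_zero.mp hn1) hs0 hsδ hsc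
  have b₁ := hn₁ q hq hN1
  have b₂ := hn₂ q hq hN1
  rw [mul_assoc, ← hs2] at b₁ b₂
  have b₃ : Real.exp (-(n * s ^ 2 / 2)) ≤ Real.exp (-(h * N)) := by
    refine Real.exp_le_exp.mpr (neg_le_neg ?_)
    have e1 : n * s ^ 2 / 2 = k ^ 2 / 2 * (n : ℝ) ^ (1 - 2 * κ) := by
      rw [hs2, sub_eq_add_neg, Real.rpow_add hn0, Real.rpow_one]; ring
    rw [e1]
    refine mul_le_mul (min_le_right _ _) ?_ hN0 (by positivity)
    exact mul_le_of_le_one_left (Real.rpow_nonneg hn0.le _) (inv_le_one_of_one_le₀ hq)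
  have b₁' : Real.exp (-(h₁ * N)) ≤ Real.exp (-(h * N)) :=
    Real.exp_le_exp.mpr (neg_le_neg (mul_le_mul_of_nonneg_right
      ((min_le_left _ _).trans (min_le_left _ _)) hN0))
  have b₂' : Real.exp (-(h₂ * N)) ≤ Real.exp (-(h * N)) :=
    Real.exp_le_exp.mpr (neg_le_neg (mul_le_mul_of_nonneg_right
      ((min_le_left _ _).trans (min_le_right _ _)) hN0))
  refine (measureReal_mono ?_).trans (main.trans ?_)
  · rintro z ⟨ah, th, hah, hth, hdev⟩
    refine ⟨ah, th, hah, hth, ?_⟩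
    have h1 := hdev.trans (abs_abs_sub_abs_le _ _)
    rw [cpcHat, cpc, ← sub_div, abs_div, abs_of_pos hσ0, le_div_iff₀ hσ0] at h1
    refine lt_of_lt_of_le ?_ h1
    have e : C * (n : ℝ) ^ (-κ) * σ = 2 * (M * s) := by
      rw [hs, hk]; field_simp
    rw [e]
    have : 0 < M * s := by positivity
    linarith
  · have c₁ := b₁.trans (mul_le_mul_of_nonneg_left b₁' hA₁.le)
    have c₂ := b₂.trans (mul_le_mul_of_nonneg_left b₂' hA₂.le)
    linarith

/-! ### Measurability and dimension of the observations; transfer to the sample. -/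

section Sample

variable {p r : ℕ}

theorem measurable_resp : Measurable (resp : Obs p r → ℝ) := measurable_fst

theorem measurable_covar (j : Fin p) : Measurable (covar j : Obs p r → ℝ) :=
  (measurable_pi_apply j).comp (measurable_fst.comp measurable_snd)

theorem measurable_condVec (S : Finset (Fin p)) :
    Measurable (condVec S : Obs p r → ZIdx r S → ℝ) := by
  refine measurable_pi_iff.mpr ?_
  rintro (k | k)
  · exact (measurable_pi_apply k).comp (measurable_snd.comp measurable_snd)
  · exact (measurable_pi_apply k.1).comp (measurable_fst.comp measurable_snd)

theorem card_zIdx_le_condDim (S : Fin p → Finset (Fin p)) (j : Fin p) :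
    Fintype.card (ZIdx r (S j)) ≤ condDim r S := by
  have h : Fintype.card (ZIdx r (S j)) = r + (S j).card := by
    simp [ZIdx]
  rw [h]
  exact Finset.le_sup (f := fun j => r + (S j).card) (Finset.mem_univ j)

end Sample

/-- An event on an i.i.d. sample has at most the probability that the product law gives to it. -/
theorem real_sample_le {Ω E : Type*} [MeasurableSpace Ω] [MeasurableSpace E] {P : Measure Ω}
    [IsProbabilityMeasure P] {μ : Measure E} [IsProbabilityMeasure μ] {n : ℕ}
    {D : Fin n → Ω → E} (hlaw : ∀ i, HasLaw (D i) μ P) (hind : iIndepFun D P)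
    (A : Set (Fin n → E)) :
    P.real {ω | (fun i => D i ω) ∈ A} ≤ (Measure.pi fun _ : Fin n => μ).real A := by
  have hm : ∀ i, AEMeasurable (D i) P := fun i => (hlaw i).aemeasurable
  have h := (iIndepFun_iff_map_fun_eq_pi_map hm).mp hind
  simp only [(hlaw _).map_eq] at h
  rw [← h]
  exact ENNReal.toReal_mono (measure_ne_top _ _)
    (Measure.le_map_apply (aemeasurable_pi_lambda _ hm) A)

end CPC

/-! ### Union bounds over the covariates. -/

theorem theorem6
    {Ω : ℕ → Type*} [∀ n, MeasurableSpace (Ω n)]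
    (P : ∀ n, Measure (Ω n)) [∀ n, IsProbabilityMeasure (P n)]
    -- dimensions, conditioning sets, and the law of `(Y, X, W)` at sample size `n`
    (p r : ℕ → ℕ) (S : ∀ n, Fin (p n) → Finset (Fin (p n))) (hS : ∀ n j, j ∉ S n j)
    (μ : ∀ n, Measure (CPC.Obs (p n) (r n))) [∀ n, IsProbabilityMeasure (μ n)]
    -- the i.i.d. sample of size `n`
    (D : ∀ n, Fin n → Ω n → CPC.Obs (p n) (r n))
    (hDlaw : ∀ n i, HasLaw (D n i) (μ n) (P n))
    (hDindep : ∀ n, iIndepFun (D n) (P n))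
    (τ ι : ℝ) (hτ : τ ∈ Ioo (0 : ℝ) 1) (hι : ι ∈ Ioo (0 : ℝ) 1)
    -- population quantile regression coefficients
    (α₀ θ₀ : ∀ n (j : Fin (p n)), CPC.ZIdx (r n) (S n j) → ℝ)
    (hα₀ : ∀ n j, CPC.IsPopQuantileCoef (μ n) τ CPC.resp (CPC.condVec (S n j)) (α₀ n j))
    (hθ₀ : ∀ n j, CPC.IsPopQuantileCoef (μ n) ι (CPC.covar j) (CPC.condVec (S n j)) (θ₀ n j))
    -- sample quantile regression coefficients
    (αh θh : ∀ n (j : Fin (p n)),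
      (Fin n → CPC.Obs (p n) (r n)) → CPC.ZIdx (r n) (S n j) → ℝ)
    (hαh_meas : ∀ n j, Measurable (αh n j)) (hθh_meas : ∀ n j, Measurable (θh n j))
    (hαh : ∀ n j x, CPC.IsSampleQuantileCoef τ CPC.resp (CPC.condVec (S n j)) x (αh n j x))
    (hθh : ∀ n j x, CPC.IsSampleQuantileCoef ι (CPC.covar j) (CPC.condVec (S n j)) x (θh n j x))
    (hD1 : CPC.CondD1 p r S μ α₀ θ₀) (hD2 : CPC.CondD2 p r S μ α₀ θ₀)
    (κ : ℝ) (hκ : 0 < κ) :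
    ∃ c : ℝ → ℝ,
      -- (i)
      (∀ C : ℝ, 0 < C → 0 < c C ∧ ∀ᶠ n : ℕ in atTop,
        (P n).real {ω | C * (n : ℝ) ^ (-κ) ≤
            ⨆ j : Fin (p n), |CPC.utilHat (S n) τ ι (αh n) (θh n) (fun i => D n i ω) j
              - CPC.util (S n) (μ n) τ ι (α₀ n) (θ₀ n) j|}
          ≤ 12 * (p n : ℝ) *
            Real.exp (-(c C) * (CPC.condDim (r n) (S n) : ℝ)⁻¹ * (n : ℝ) ^ (1 - 2 * κ))) ∧
      -- (ii)
      (∀ C₀ : ℝ, 0 < C₀ →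
        (∀ n, ∀ j ∈ CPC.activeSet (CPC.util (S n) (μ n) τ ι (α₀ n) (θ₀ n)),
          C₀ * (n : ℝ) ^ (-κ) ≤ CPC.util (S n) (μ n) τ ι (α₀ n) (θ₀ n) j) →
        ∀ C₂ : ℝ, C₂ ≤ C₀ / 2 → ∀ᶠ n : ℕ in atTop,
          1 - 12 * ((CPC.activeSet (CPC.util (S n) (μ n) τ ι (α₀ n) (θ₀ n))).ncard : ℝ) *
              Real.exp (-(c (C₀ / 2)) * (CPC.condDim (r n) (S n) : ℝ)⁻¹ *
                (n : ℝ) ^ (1 - 2 * κ))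
            ≤ (P n).real {ω | CPC.activeSet (CPC.util (S n) (μ n) τ ι (α₀ n) (θ₀ n)) ⊆
                CPC.selectedSet
                  (CPC.utilHat (S n) τ ι (αh n) (θh n) (fun i => D n i ω))
                  (C₂ * (n : ℝ) ^ (-κ))}) := by
  classical
  obtain ⟨L, δ, b, hL, hδ, hb, hD1⟩ := hD1
  obtain ⟨⟨m₁, m₂, m₃, hD2⟩, cmin, cmax, hcmin, hcmax, heig⟩ := hD2
  have hm0 : 0 < max m₁ 1 := lt_max_of_lt_right one_pos
  -- one coordinate
  have coord : ∀ C : ℝ, 0 < C → ∃ c' : ℝ, 0 < c' ∧ ∀ᶠ n : ℕ in atTop, ∀ j : Fin (p n),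
      (P n).real {ω | C * (n : ℝ) ^ (-κ) ≤
        |CPC.utilHat (S n) τ ι (αh n) (θh n) (fun i => D n i ω) j
          - CPC.util (S n) (μ n) τ ι (α₀ n) (θ₀ n) j|} ≤
        12 * Real.exp (-c' * (CPC.condDim (r n) (S n) : ℝ)⁻¹ * (n : ℝ) ^ (1 - 2 * κ)) := by
    intro C hC
    obtain ⟨c', hc', hev⟩ := CPC.exists_eventually_real_cpcHat_deviation_le hτ hι hm0 hcmin hL.le
      hδ hb hκ hC
    refine ⟨c', hc', ?_⟩
    filter_upwards [hev] with n hn j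
    -- With no conditioning variables the inverse of the dimension is `0` by convention, and the
    -- bound reads `12`.
    rcases Nat.eq_zero_or_pos (CPC.condDim (r n) (S n)) with hq | hq
    · rw [hq]
      simp only [Nat.cast_zero, inv_zero, mul_zero, zero_mul, Real.exp_zero, mul_one]
      exact measureReal_le_one.trans (by norm_num)
    have hZ := CPC.measurable_condVec (r := r n) (S n j)
    have hbound : ∀ᵐ d ∂(μ n), ∀ k, |CPC.condVec (S n j) d k| ≤ max m₁ 1 := by
      filter_upwards [hD2 n j] with d hd k using (hd.1 k).trans (le_max_left _ _)
    have hdes : CPC.RegularDesign (μ n) (CPC.condVec (S n j)) (max m₁ 1)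
        (CPC.condDim (r n) (S n)) cmin :=
      ⟨hZ, hbound, by exact_mod_cast CPC.card_zIdx_le_condDim (S n) j, by exact_mod_cast hq,
        CPC.mul_dotProduct_self_le_of_eigenvalues CPC.secondMoment_isHermitian
          fun ev hev => (heig n j ev (by convert hev)).1⟩
    refine le_trans ?_ (hn _ _ _ (μ n) CPC.resp (CPC.covar j) (CPC.condVec (S n j)) (α₀ n j)
      (θ₀ n j) hdes CPC.measurable_resp (CPC.measurable_covar j) (hD1 n j).1 (hD1 n j).2
      (hα₀ n j) (hθ₀ n j))
    refine le_trans (measureReal_mono ?_) (CPC.real_sample_le (hDlaw n) (hDindep n) _)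
    intro ω hω
    exact ⟨αh n j _, θh n j _, hαh n j _, hθh n j _, hω⟩
  -- The rate is fixed at the level of one coordinate, so both parts share the same function `c`.
  choose! c hc0 hc using coord
  refine ⟨c, fun C hC => ⟨hc0 C hC, ?_⟩, fun C₀ hC₀ hact C₂ hC₂ => ?_⟩
  · filter_upwards [hc C hC, eventually_ge_atTop 1] with n hn hn1
    have hn0 : (0 : ℝ) < n := by exact_mod_cast hn1
    have hpos : 0 < C * (n : ℝ) ^ (-κ) := mul_pos hC (Real.rpow_pos_of_pos hn0 _)
    calc _ ≤ (P n).real (⋃ j ∈ (Finset.univ : Finset (Fin (p n))), {ω | C * (n : ℝ) ^ (-κ) ≤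
          |CPC.utilHat (S n) τ ι (αh n) (θh n) (fun i => D n i ω) j
            - CPC.util (S n) (μ n) τ ι (α₀ n) (θ₀ n) j|}) := by
          refine measureReal_mono (fun ω hω => ?_) (measure_ne_top _ _)
          -- For `p n = 0` the supremum is `0` by convention, below the positive threshold.
          rcases isEmpty_or_nonempty (Fin (p n)) with he | he
          · have hω' : C * (n : ℝ) ^ (-κ) ≤ _ := hω
            rw [Real.iSup_of_isEmpty] at hω'
            exact absurd hω' (not_le.mpr hpos)
          · obtain ⟨j, hj⟩ := exists_eq_ciSup_of_finite (f := fun j : Fin (p n) =>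
              |CPC.utilHat (S n) τ ι (αh n) (θh n) (fun i => D n i ω) j
                - CPC.util (S n) (μ n) τ ι (α₀ n) (θ₀ n) j|)
            refine mem_biUnion (Finset.mem_univ j) ?_
            exact le_of_le_of_eq hω hj.symm
      _ ≤ ∑ _j : Fin (p n), 12 * Real.exp (-(c C) * (CPC.condDim (r n) (S n) : ℝ)⁻¹ *
          (n : ℝ) ^ (1 - 2 * κ)) :=
          (measureReal_biUnion_finset_le _ _).trans (Finset.sum_le_sum fun j _ => hn j)
      _ = _ := by
          rw [Finset.sum_const, Finset.card_univ, Fintype.card_fin, nsmul_eq_mul]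
          ring
  · filter_upwards [hc (C₀ / 2) (by positivity)] with n hn
    set A := CPC.activeSet (CPC.util (S n) (μ n) τ ι (α₀ n) (θ₀ n)) with hA
    set G := {ω | A ⊆ CPC.selectedSet
      (CPC.utilHat (S n) τ ι (αh n) (θh n) (fun i => D n i ω)) (C₂ * (n : ℝ) ^ (-κ))} with hG
    -- A missed active index has `u_j ≥ C₀ n ^ (-κ)` and an estimate below half of that. Only active
    -- indices enter the union, whence the factor `A.ncard` in place of `p n`.
    have hbad : (P n).real Gᶜ ≤ 12 * (A.ncard : ℝ) * Real.exp (-(c (C₀ / 2)) *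
        (CPC.condDim (r n) (S n) : ℝ)⁻¹ * (n : ℝ) ^ (1 - 2 * κ)) := by
      calc (P n).real Gᶜ ≤ (P n).real (⋃ j ∈ A.toFinset, {ω | C₀ / 2 * (n : ℝ) ^ (-κ) ≤
          |CPC.utilHat (S n) τ ι (αh n) (θh n) (fun i => D n i ω) j
            - CPC.util (S n) (μ n) τ ι (α₀ n) (θ₀ n) j|}) := by
            refine measureReal_mono (fun ω hω => ?_) (measure_ne_top _ _)
            obtain ⟨j, hjA, hj⟩ := not_subset.mp hω
            refine mem_biUnion (mem_toFinset.mpr hjA) ?_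
            have h1 := hact n j hjA
            have h2 : CPC.utilHat (S n) τ ι (αh n) (θh n) (fun i => D n i ω) j <
              C₂ * (n : ℝ) ^ (-κ) := not_le.mp hj
            have h3 : C₂ * (n : ℝ) ^ (-κ) ≤ C₀ / 2 * (n : ℝ) ^ (-κ) := by gcongr
            change C₀ / 2 * (n : ℝ) ^ (-κ) ≤ |_|
            rw [abs_sub_comm]
            refine le_trans ?_ (le_abs_self _)
            linarith
        _ ≤ ∑ _j ∈ A.toFinset, 12 * Real.exp (-(c (C₀ / 2)) *
            (CPC.condDim (r n) (S n) : ℝ)⁻¹ * (n : ℝ) ^ (1 - 2 * κ)) :=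
            (measureReal_biUnion_finset_le _ _).trans (Finset.sum_le_sum fun j _ => hn j)
        _ = _ := by
            rw [Finset.sum_const, nsmul_eq_mul, ncard_eq_toFinset_card']
            ring
    -- Subadditivity replaces the complement rule, so `G` need not be measurable.
    have htot : 1 ≤ (P n).real G + (P n).real Gᶜ := by
      have := measureReal_union_le (μ := P n) G Gᶜ
      rwa [union_compl_self, probReal_univ] at this
    linarith
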